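/- **Setting.** Let $(X_n)_{n\in\mathbb N}$ be finite metric spaces with uniformly bounded geometry: for every $R$ there is $N$ such that every closed ball of radius $R$ in every $X_n$ has at most $N$ points. Assume that $(X_n)$ has a fibred coarse embedding into a real Hilbert space $H$: there are Hilbert spaces $H_x$ and vectors $s(x)\in H_x$ ($x\in X_n$, $n\in\mathbb N$), non-decreasing $\rho_\pm:[0,\infty)\to[0,\infty)$ tending to $\infty$, a non-decreasing sequence $0\le l_0\le l_1\le\cdots\to\infty$, and for all $x\in X_n$, $z\in B(x,l_n)$ a bijective affine isometry $t_x(z):H_z\to H$ such that $\rho_-(d(z,z'))\le\|t_x(z)(s(z))-t_x(z')(s(z'))\|\le\rho_+(d(z,z'))$ for $z,z'\in B(x,l_n)$, and such that for all $x,y\in X_n$ there is an affine isometry $t_{xy}$ of $H$ with $t_x(z)=t_{xy}\circ t_y(z)$ for all $z\in B(x,l_n)\cap B(y,l_n)$. **Coefficients.** For a finite-dimensional affine subspace $V\subseteq H$ with direction $V^0$ put $\mathcal A(V)=\mathcal S\,\widehat\otimes\,\mathcal C(V)$, where $\mathcal S=C_0(\mathbb R)$ is graded by even and odd functions and $\mathcal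 C(V)=C_0(V,\mathrm{Cliff}_{\mathbb C}(V^0))$. For $V\subseteq W$ let $\beta_{V,W}:\mathcal A(V)\to\mathcal A(W)$, $g\widehat\otimes h\mapsto g(X\widehat\otimes1+1\widehat\otimes C)\widehat\otimes h$, be the Bott map, where $X$ is multiplication by the variable of $\mathbb R$ and $C(u)=u$ is the Clifford multiplier on $W^0\ominus V^0$. An affine isometry $t$ acts by $t_*$ (composition with $t^{-1}$ and the Clifford map of the linear part of $t$). The algebra $C_0(\mathbb R_+\times V)$ is central in $\mathcal A(V)$, and the support of $a$ is the complement of the set of points $p\in\mathbb R_+\times V$ for which some $g\in C_0(\mathbb R_+\times V)$ has $g(p)\neq0$ and $ga=0$. Let $\mathcal K$ be the compact operators on $\ell^2(\mathbb N)$ (trivially graded), let $V_n$ be the affine span of all $t_x(z)(s(z))$ with $x\in X_n$, $z\in B(x,l_n)$, and let $W_k(x)\subseteq V_n$ be the affine span of the $t_x(z)(s(z))$ with $z\in B(x,k)\cap B(x,l_n)$. **The algebra.** Let $\mathbb C_{u,\infty}[(X_n,\mathcal A(V_n))]$ be the $*$-algebra (generated by the) classes of sequences of maps $T^{(n)}:X_n\times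 X_n\to\mathcal A(V_n)\widehat\otimes\mathcal K$ such that 1. $\sup_{n,x,y}\|T^{(n)}(x,y)\|<\infty$; 2. for some $k>0$ every $T^{(n)}(x,y)$ is $\beta_{W_k(x),V_n}(T_1(x,y))$ for a finite linear combination $T_1(x,y)$ of elementary tensors of $\mathcal S\widehat\otimes\mathcal C(W_k(x))\widehat\otimes\mathcal K$; 3. for some $R$, $T^{(n)}(x,y)=0$ whenever $d(x,y)>R$; 4. for some $r>0$, $\mathrm{supp}\,T^{(n)}(x,y)\subseteq\{(t,v)\in\mathbb R_+\times V_n: t^2+\|v-t_x(x)(s(x))\|^2<r^2\}$ for all $n,x,y$; 5. for some $c>0$, the derivatives of all the $T_1(x,y)$ in all directions of $\mathbb R\times W_k(x)^0$ of norm at most $1$ exist in $\mathcal A(W_k(x))\widehat\otimes\mathcal K$ and have norm at most $c$. Sequences are equivalent if $\lim_n\sup_{x,y}\|T^{(n)}(x,y)-S^{(n)}(x,y)\|=0$. The operations are given, for all large $n$, by $(TS)^{(n)}(x,y)=\sum_zT^{(n)}(x,z)\,(t_{xz})_*(S^{(n)}(z,y))$ and $(T^*)^{(n)}(x,y)=(t_{xy})_*(T^{(n)}(y,x)^*)$.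 **The norms.** Let $E_n$ be the Hilbert $\mathcal A(V_n)\widehat\otimes\mathcal K$-module of all $f:X_n\times X_n\to\mathcal A(V_n)\widehat\otimes\mathcal K$ with $f(x)(y)=0$ unless $d(x,y)\le l_n/2$, with $\langle f,f'\rangle=\sum_{x,y}f(x)(y)^*f'(x)(y)$. A matrix $T^{(n)}$ acts on it by $(T^{(n)}f)(x)(y)=\sum_z(t_{yx})_*(T^{(n)}(x,z))\,f(z)(y)$ for $d(x,y)\le l_n/2$ (and $0$ otherwise). Let $B^*$ be the completion of $\mathbb C_{u,\infty}[(X_n,\mathcal A(V_n))]$ in $\limsup_n\|T^{(n)}\|_{E_n}$. An element $S$ of $B^*$, represented by a sequence of matrices, is a ghost if $\lim_n\sup_{x,y\in X_n}\|\chi_{B(x,R)}S^{(n)}\chi_{B(y,R)}\|=0$ for every $R>0$. The reduced norm of a class $T$ is $\inf\sup_n\|T^{(n)}+S^{(n)}\|_{E_n}$ over its representatives $(T^{(n)})$ of finite propagation and the ghosts $(S^{(n)})$. The maximal norm of $T$ is $\sup_\phi\|\phi(T)\|$ over all $*$-representations $\phi$ of $\mathbb C_{u,\infty}[(X_n,\mathcal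 A(V_n))]$ on Hilbert spaces. The completions in these norms are the reduced and the maximal twisted Roe algebras at infinity, $C^*_{u,\infty}((X_n,\mathcal A(V_n)))$ and $C^*_{u,\max,\infty}((X_n,\mathcal A(V_n)))$. **Proposition.** The maximal norm and the reduced norm are (finite) $C^*$-seminorms on $\mathbb C_{u,\infty}[(X_n,\mathcal A(V_n))]$, the reduced norm is at most the maximal one, and the canonical $*$-homomorphism $$\pi^{\mathcal A}:C^*_{u,\max,\infty}((X_n,\mathcal A(V_n)))\to C^*_{u,\infty}((X_n,\mathcal A(V_n)))$$ that extends the identity of $\mathbb C_{u,\infty}[(X_n,\mathcal A(V_n))]$ is a $*$-isomorphism. -/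

import Mathlib

open UniformSpace

universe u v w

noncomputable section

set_option linter.unusedSectionVars false

/-- A `C⋆`-seminorm on a complex `*`-algebra. -/
structure CStarSeminorm (A : Type*) [NonUnitalRing A] [StarRing A] [Module ℂ A] where
  toFun : A → ℝ
  add_le' : ∀ a b, toFun (a + b) ≤ toFun a + toFun b
  smul' : ∀ (c : ℂ) (a : A), toFun (c • a) = ‖c‖ * toFun a
  mul_le' : ∀ a b, toFun (a * b) ≤ toFun a * toFun b
  star_mul_self' : ∀ a, toFun (star a * a) = toFun a * toFun a

namespace CStarSeminorm

section basic

variable {A : Type*} [NonUnitalRing A] [StarRing A] [Module ℂ A]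

instance : CoeFun (CStarSeminorm A) (fun _ => A → ℝ) := ⟨toFun⟩

theorem map_zero (p : CStarSeminorm A) : p 0 = 0 := by
  simpa using p.smul' 0 0

theorem map_neg (p : CStarSeminorm A) (a : A) : p (-a) = p a := by
  simpa using p.smul' (-1) a

theorem nonneg (p : CStarSeminorm A) (a : A) : 0 ≤ p a := by
  have h := p.add_le' a (-a)
  rw [add_neg_cancel, p.map_zero, p.map_neg] at h
  linarith

theorem le_star (p : CStarSeminorm A) (a : A) : p a ≤ p (star a) := by
  have h := p.mul_le' (star a) a
  rw [p.star_mul_self'] at h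
  rcases (p.nonneg a).eq_or_lt with h0 | h0
  · rw [← h0]; exact p.nonneg _
  · exact le_of_mul_le_mul_right h h0

theorem map_star (p : CStarSeminorm A) (a : A) : p (star a) = p a :=
  le_antisymm (by simpa using p.le_star (star a)) (p.le_star a)

/-- The algebra `A`, topologised by the seminorm `p`. -/
def Carrier (_p : CStarSeminorm A) : Type _ := A

end basic

variable {A : Type*} [NonUnitalRing A] [StarRing A] [Module ℂ A] [IsScalarTower ℂ A A]
  [SMulCommClass ℂ A A] [StarModule ℂ A]

variable (p : CStarSeminorm A)

instance : NonUnitalRing p.Carrier := inferInstanceAs (NonUnitalRing A)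
instance : StarRing p.Carrier := inferInstanceAs (StarRing A)
instance : Module ℂ p.Carrier := inferInstanceAs (Module ℂ A)
instance : IsScalarTower ℂ p.Carrier p.Carrier := inferInstanceAs (IsScalarTower ℂ A A)
instance : SMulCommClass ℂ p.Carrier p.Carrier := inferInstanceAs (SMulCommClass ℂ A A)
instance : StarModule ℂ p.Carrier := inferInstanceAs (StarModule ℂ A)

/-- `p` as a seminorm of additive groups. -/
def toAddGroupSeminorm : AddGroupSeminorm p.Carrier where
  toFun := p.toFun
  map_zero' := p.map_zero
  add_le' := p.add_le'
  neg' := p.map_neg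

instance : NonUnitalSeminormedRing p.Carrier where
  __ := p.toAddGroupSeminorm.toSeminormedAddCommGroup
  __ := (inferInstance : NonUnitalRing p.Carrier)
  norm_mul_le := p.mul_le'

instance : NormedSpace ℂ p.Carrier where
  norm_smul_le c a := (p.smul' c a).le

theorem norm_def (a : p.Carrier) : ‖a‖ = p.toFun a := rfl

instance : NormedStarGroup p.Carrier where
  norm_star_le a := (p.map_star a).le

/-- The completion of `A` with respect to the `C⋆`-seminorm `p` (elements of seminorm zero are
identified with `0`). -/
def Completed : Type _ := Completion p.Carrier

namespace Completed

instance : NormedAddCommGroup p.Completed := inferInstanceAs (NormedAddCommGroup (Completion p.Carrier))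
instance : NormedSpace ℂ p.Completed := inferInstanceAs (NormedSpace ℂ (Completion p.Carrier))
instance : CompleteSpace p.Completed := inferInstanceAs (CompleteSpace (Completion p.Carrier))

variable {p}

/-- The canonical map of `A` into its completion. -/
def of (p : CStarSeminorm A) (a : A) : p.Completed := ((show p.Carrier from a : p.Carrier) : Completion p.Carrier)

theorem norm_of (a : A) : ‖of p a‖ = p a := Completion.norm_coe (E := p.Carrier) a

theorem of_add (a b : A) : of p (a + b) = of p a + of p b :=
  Completion.coe_add (α := p.Carrier) a b

theorem of_smul (c : ℂ) (a : A) : of p (c • a) = c • of p a :=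
  Completion.coe_smul (X := p.Carrier) c a

theorem of_zero : of p (0 : A) = 0 := rfl

theorem denseRange_of : DenseRange (of p) := Completion.denseRange_coe (α := p.Carrier)

theorem continuous_of : Continuous (show p.Carrier → p.Completed from of p) :=
  Completion.continuous_coe p.Carrier

theorem ind {P : p.Completed → Prop} (hc : IsClosed {x | P x}) (h : ∀ a, P (of p a)) (x : p.Completed) :
    P x := Completion.induction_on (α := p.Carrier) x hc h

/-- The multiplication of the completion: the continuous extension of the one of `A`. -/
@[irreducible] def mulFun (x y : p.Completed) : p.Completed :=
  (Completion.isDenseInducing_coe.prodMap Completion.isDenseInducing_coe).extend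
    (fun z : p.Carrier × p.Carrier => ((z.1 * z.2 : p.Carrier) : Completion p.Carrier)) (x, y)

instance : Mul p.Completed := ⟨mulFun⟩

theorem of_mul (a b : A) : of p (a * b) = of p a * of p b := by
  change _ = mulFun _ _
  unfold mulFun
  exact ((Completion.isDenseInducing_coe.prodMap Completion.isDenseInducing_coe).extend_eq
      ((Completion.continuous_coe p.Carrier).comp (@continuous_mul p.Carrier _ _ _)) (a, b)).symm

theorem continuous_mulFun :
    Continuous (fun z : p.Completed × p.Completed => mulFun z.1 z.2) := by
  unfold mulFun
  let m := (AddMonoidHom.mul : p.Carrier →+ p.Carrier →+ p.Carrier).compr₂ Completion.toCompl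
  have : Continuous fun z : p.Carrier × p.Carrier => m z.1 z.2 :=
    (Completion.continuous_coe _).comp continuous_mul
  have di : IsDenseInducing (Completion.toCompl : p.Carrier → Completion p.Carrier) :=
    Completion.isDenseInducing_coe
  exact (di.extend_Z_bilin di this :)

instance : ContinuousMul p.Completed := ⟨continuous_mulFun⟩

/-- The involution of the completion: the continuous extension of the one of `A`. -/
@[irreducible] def starFun (x : p.Completed) : p.Completed :=
  Completion.map (star : p.Carrier → p.Carrier) x

instance : Star p.Completed := ⟨starFun⟩

theorem of_star (a : A) : of p (star a) = star (of p a) := by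
  change _ = starFun _
  unfold starFun
  exact (Completion.map_coe
    (starNormedAddGroupHom (E := p.Carrier)).lipschitz.uniformContinuous a).symm

theorem continuous_starFun : Continuous (starFun : p.Completed → p.Completed) := by
  unfold starFun
  exact Completion.continuous_map

instance : ContinuousStar p.Completed := ⟨continuous_starFun⟩

theorem cstar {X : Type*} [TopologicalSpace X] {f : X → p.Completed} (hf : Continuous f) :
    Continuous fun x => star (f x) := continuous_starFun.comp hf

theorem csmul (c : ℂ) {X : Type*} [TopologicalSpace X] {f : X → p.Completed} (hf : Continuous f) :
    Continuous fun x => c • f x :=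
  (continuous_const_smul c : Continuous fun x : p.Completed => c • x).comp hf

theorem cmul {X : Type*} [TopologicalSpace X] {f g : X → p.Completed} (hf : Continuous f) (hg : Continuous g) :
    Continuous fun x => f x * g x := hf.mul hg

theorem left_distrib' (a b c : p.Completed) : a * (b + c) = a * b + a * c := by
  induction a using ind with
  | hc => exact isClosed_eq (by fun_prop) (by fun_prop)
  | h a =>
  induction b using ind with
  | hc => exact isClosed_eq (by fun_prop) (by fun_prop)
  | h b =>
  induction c using ind with
  | hc => exact isClosed_eq (by fun_prop) (by fun_prop)
  | h c =>
  rw [← of_add, ← of_mul, mul_add, of_add, of_mul, of_mul]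

theorem right_distrib' (a b c : p.Completed) : (a + b) * c = a * c + b * c := by
  induction a using ind with
  | hc => exact isClosed_eq (by fun_prop) (by fun_prop)
  | h a =>
  induction b using ind with
  | hc => exact isClosed_eq (by fun_prop) (by fun_prop)
  | h b =>
  induction c using ind with
  | hc => exact isClosed_eq (by fun_prop) (by fun_prop)
  | h c =>
  rw [← of_add, ← of_mul, add_mul, of_add, of_mul, of_mul]

theorem zero_mul' (a : p.Completed) : 0 * a = 0 := by
  induction a using ind with
  | hc => exact isClosed_eq (by fun_prop) (by fun_prop)
  | h a =>
  have h := of_mul (p := p) (0 : A) a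
  rw [zero_mul] at h
  exact h.symm

theorem mul_zero' (a : p.Completed) : a * 0 = 0 := by
  induction a using ind with
  | hc => exact isClosed_eq (by fun_prop) (by fun_prop)
  | h a =>
  have h := of_mul (p := p) a (0 : A)
  rw [mul_zero] at h
  exact h.symm

theorem mul_assoc' (a b c : p.Completed) : a * b * c = a * (b * c) := by
  induction a using ind with
  | hc => exact isClosed_eq (by fun_prop) (by fun_prop)
  | h a =>
  induction b using ind with
  | hc => exact isClosed_eq (by fun_prop) (by fun_prop)
  | h b =>
  induction c using ind with
  | hc => exact isClosed_eq (by fun_prop) (by fun_prop)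
  | h c =>
  simp only [← of_mul, mul_assoc]

theorem star_star' (a : p.Completed) : star (star a) = a := by
  induction a using ind with
  | hc => exact isClosed_eq (cstar (cstar continuous_id)) continuous_id
  | h a =>
  rw [← of_star, ← of_star, star_star]

theorem star_mul' (a b : p.Completed) : star (a * b) = star b * star a := by
  induction a using ind with
  | hc => exact isClosed_eq (cstar (by fun_prop)) (continuous_const.mul (cstar continuous_id))
  | h a =>
  induction b using ind with
  | hc => exact isClosed_eq (cstar (by fun_prop)) ((cstar continuous_id).mul continuous_const)
  | h b =>
  simp only [← of_mul, ← of_star, star_mul]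

theorem star_add' (a b : p.Completed) : star (a + b) = star a + star b := by
  induction a using ind with
  | hc => exact isClosed_eq (cstar (by fun_prop)) ((cstar continuous_id).add continuous_const)
  | h a =>
  induction b using ind with
  | hc => exact isClosed_eq (cstar (by fun_prop)) (continuous_const.add (cstar continuous_id))
  | h b =>
  simp only [← of_add, ← of_star, star_add]

theorem norm_mul_le' (a b : p.Completed) : ‖a * b‖ ≤ ‖a‖ * ‖b‖ := by
  induction a using ind with
  | hc => exact isClosed_le (by fun_prop) (by fun_prop)
  | h a =>
  induction b using ind with
  | hc => exact isClosed_le (by fun_prop) (by fun_prop)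
  | h b =>
  simpa only [← of_mul, norm_of] using p.mul_le' a b

theorem norm_mul_self_le' (a : p.Completed) : ‖a‖ * ‖a‖ ≤ ‖star a * a‖ := by
  induction a using ind with
  | hc => exact isClosed_le (by fun_prop) (continuous_norm.comp ((cstar continuous_id).mul continuous_id))
  | h a =>
  simpa only [← of_mul, ← of_star, norm_of] using (p.star_mul_self' a).ge

theorem smul_mul' (c : ℂ) (a b : p.Completed) : c • a * b = c • (a * b) := by
  induction a using ind with
  | hc => exact isClosed_eq (cmul (csmul c continuous_id) continuous_const) (csmul c (cmul continuous_id continuous_const))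
  | h a =>
  induction b using ind with
  | hc => exact isClosed_eq (cmul continuous_const continuous_id) (csmul c (cmul continuous_const continuous_id))
  | h b =>
  simp only [← of_smul, ← of_mul, smul_mul_assoc]

theorem mul_smul' (c : ℂ) (a b : p.Completed) : c • (a * b) = a * c • b := by
  induction a using ind with
  | hc => exact isClosed_eq (csmul c (cmul continuous_id continuous_const)) (cmul continuous_id continuous_const)
  | h a =>
  induction b using ind with
  | hc => exact isClosed_eq (csmul c (cmul continuous_const continuous_id)) (cmul continuous_const (csmul c continuous_id))
  | h b =>
  simp only [← of_smul, ← of_mul, mul_smul_comm]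

theorem star_smul' (c : ℂ) (a : p.Completed) : star (c • a) = star c • star a := by
  induction a using ind with
  | hc => exact isClosed_eq (cstar (csmul c continuous_id)) (csmul _ (cstar continuous_id))
  | h a =>
  simp only [← of_smul, ← of_star, star_smul]

instance : NonUnitalNormedRing p.Completed where
  __ := (inferInstance : NormedAddCommGroup p.Completed)
  left_distrib := left_distrib'
  right_distrib := right_distrib'
  zero_mul := zero_mul'
  mul_zero := mul_zero'
  mul_assoc := mul_assoc'
  norm_mul_le := norm_mul_le'

instance : StarRing p.Completed where
  star_involutive := star_star'
  star_mul := star_mul'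
  star_add := star_add'

instance : NonUnitalCStarAlgebra p.Completed where
  complete := CompleteSpace.complete
  norm_mul_self_le := norm_mul_self_le'
  norm_smul_le := norm_smul_le
  smul_assoc := smul_mul'
  smul_comm := mul_smul'
  star_smul := star_smul'

end Completed

variable {p}
variable {B : Type*} [NonUnitalRing B] [StarRing B] [Module ℂ B] [IsScalarTower ℂ B B]
  [SMulCommClass ℂ B B] [StarModule ℂ B] {q : CStarSeminorm B}

/-- The continuous extension to the completions of a contractive `*`-homomorphism. -/
def complFun (p : CStarSeminorm A) (q : CStarSeminorm B) (f : A →⋆ₙₐ[ℂ] B) :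
    p.Completed → q.Completed :=
  Completion.map (show p.Carrier → q.Carrier from f)

theorem complFun_of (f : A →⋆ₙₐ[ℂ] B) (hf : ∀ a, q (f a) ≤ p a) (a : A) :
    complFun p q f (Completed.of p a) = Completed.of q (f a) := by
  let f' : p.Carrier →+ q.Carrier := (f : A →+ B)
  have huc : UniformContinuous f' :=
    (AddMonoidHomClass.lipschitz_of_bound f' 1 (fun a => by
      rw [one_mul]; exact hf a)).uniformContinuous
  exact Completion.map_coe huc a

theorem continuous_complFun (f : A →⋆ₙₐ[ℂ] B) : Continuous (complFun p q f) :=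
  Completion.continuous_map

open Completed in
/-- The continuous extension to the completions of a contractive `*`-homomorphism, as a
`*`-homomorphism. -/
def complMap (f : A →⋆ₙₐ[ℂ] B) (hf : ∀ a, q (f a) ≤ p a) : p.Completed →⋆ₙₐ[ℂ] q.Completed :=
  have hF : Continuous (complFun p q f) := continuous_complFun f
  have hof := complFun_of (p := p) (q := q) f hf
  { toFun := complFun p q f
    map_zero' := by
      have := hof 0
      rwa [_root_.map_zero, of_zero, of_zero] at this
    map_add' := fun a b => by
      induction a using ind with
      | hc => exact isClosed_eq (by fun_prop) (by fun_prop)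
      | h a =>
      induction b using ind with
      | hc => exact isClosed_eq (by fun_prop) (by fun_prop)
      | h b =>
      rw [← of_add, hof, hof, hof, _root_.map_add, of_add]
    map_mul' := fun a b => by
      induction a using ind with
      | hc => exact isClosed_eq (by fun_prop) (by fun_prop)
      | h a =>
      induction b using ind with
      | hc => exact isClosed_eq (by fun_prop) (by fun_prop)
      | h b =>
      rw [← of_mul, hof, hof, hof, _root_.map_mul, of_mul]
    map_smul' := fun c a => by
      induction a using ind with
      | hc => exact isClosed_eq (hF.comp (csmul c continuous_id)) (csmul c continuous_id |>.comp hF)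
      | h a =>
      rw [← of_smul, hof, hof, _root_.map_smul, of_smul]; rfl
    map_star' := fun a => by
      induction a using ind with
      | hc => exact isClosed_eq (hF.comp (cstar continuous_id)) (cstar hF)
      | h a =>
      rw [← of_star, hof, hof, StarHomClass.map_star, of_star] }

theorem complMap_of (f : A →⋆ₙₐ[ℂ] B) (hf : ∀ a, q (f a) ≤ p a) (a : A) :
    complMap f hf (Completed.of p a) = Completed.of q (f a) := complFun_of f hf a

theorem continuous_complMap (f : A →⋆ₙₐ[ℂ] B) (hf : ∀ a, q (f a) ≤ p a) :
    Continuous (complMap f hf) := continuous_complFun f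

end CStarSeminorm

section coefficients

open scoped TensorProduct InnerProductSpace

/-- The separable infinite-dimensional Hilbert space `ℓ²(ℕ)`. -/
abbrev HilbertSeq : Type := lp (fun _ : ℕ => ℂ) 2

/-- The bounded operators on `ℓ²(ℕ)`. -/
abbrev HilbertOp : Type := HilbertSeq →L[ℂ] HilbertSeq

instance : Ring HilbertOp := inferInstance
instance : StarRing HilbertOp := inferInstance
instance : Algebra ℝ HilbertOp := inferInstance
instance : Algebra ℂ HilbertOp := inferInstance
instance : StarModule ℝ HilbertOp :=
  ⟨fun r b => by
    have h : ∀ (r : ℝ) (b : HilbertOp), r • b = (r : ℂ) • b := fun r b => rfl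
    rw [h, star_smul, h]; simp⟩

/-- The quadratic form `e ↦ -‖e‖²`. -/
def negNormSq (E : Type*) [NormedAddCommGroup E] [InnerProductSpace ℝ E] : QuadraticForm ℝ E :=
  -(LinearMap.BilinMap.toQuadraticMap (innerₗ E))

theorem negNormSq_apply {E : Type*} [NormedAddCommGroup E] [InnerProductSpace ℝ E] (e : E) :
    negNormSq E e = -(‖e‖ ^ 2) := by
  simp [negNormSq]

/-- The `*`-algebra `B(ℓ²) ⊗_ℝ Cliff(E) = B(ℓ²) ⊗_ℂ Cliff_ℂ(E)`. -/
abbrev CliffOp (E : Type*) [NormedAddCommGroup E] [InnerProductSpace ℝ E] : Type _ :=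
  HilbertOp ⊗[ℝ] CliffordAlgebra (negNormSq E)

variable {E : Type*} [NormedAddCommGroup E] [InnerProductSpace ℝ E]

instance : StarModule ℝ (CliffordAlgebra (negNormSq E)) :=
  ⟨fun r x => by rw [CliffordAlgebra.star_smul]; simp⟩

instance : Ring (CliffOp E) := inferInstance
instance : StarRing (CliffOp E) := inferInstance
instance : Algebra ℂ (CliffOp E) := inferInstance

instance : StarModule ℂ (CliffOp E) :=
  ⟨fun c x => by
    induction x using TensorProduct.induction_on with
    | zero => simp
    | tmul b x => simp [TensorProduct.smul_tmul', star_smul]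
    | add x y hx hy => rw [smul_add, star_add, hx, hy, star_add, smul_add]⟩

/-- The Clifford generator attached to `e`: since `ι(e)² = -‖e‖²` and `ι(e)* = -ι(e)`, the element
`c(e) = i ⊗ ι(e)` is self-adjoint with `c(e)² = ‖e‖²`. -/
def cliffGen (e : E) : CliffOp E :=
  (Complex.I • (1 : HilbertOp)) ⊗ₜ[ℝ] CliffordAlgebra.ι (negNormSq E) e

theorem star_cliffGen (e : E) : star (cliffGen e) = cliffGen e := by
  simp only [cliffGen, TensorProduct.star_tmul, star_smul, star_one, CliffordAlgebra.star_ι]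
  simp [TensorProduct.neg_tmul, TensorProduct.tmul_neg]

theorem cliffGen_mul_self (e : E) : cliffGen e * cliffGen e = ((‖e‖ ^ 2 : ℝ) : ℂ) • 1 := by
  simp only [cliffGen, Algebra.TensorProduct.tmul_mul_tmul, CliffordAlgebra.ι_sq_scalar,
    negNormSq_apply, Algebra.TensorProduct.one_def, TensorProduct.smul_tmul']
  rw [Algebra.algebraMap_eq_smul_one, ← TensorProduct.smul_tmul]
  congr 1
  ext1 v
  simp [smul_smul]
  norm_cast

namespace CStarSeminorm

variable (p : CStarSeminorm (CliffOp E))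

theorem apply_one_le : p 1 ≤ 1 := by
  have h := p.star_mul_self' 1
  rw [star_one, one_mul] at h
  nlinarith [p.nonneg 1]

theorem apply_tmul_one_le (b : HilbertOp) : p (b ⊗ₜ[ℝ] 1) ≤ ‖b‖ := by
  let φ : HilbertOp →⋆ₙₐ[ℂ] p.Completed :=
    { toFun := fun b => Completed.of p (b ⊗ₜ[ℝ] 1)
      map_smul' := fun c b => by
        rw [← TensorProduct.smul_tmul', Completed.of_smul]; rfl
      map_zero' := by rw [TensorProduct.zero_tmul, Completed.of_zero]
      map_add' := fun a b => by rw [TensorProduct.add_tmul, Completed.of_add]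
      map_mul' := fun a b => by
        rw [← Completed.of_mul, Algebra.TensorProduct.tmul_mul_tmul, one_mul]
      map_star' := fun a => by
        rw [← Completed.of_star, TensorProduct.star_tmul, star_one] }
  have h := NonUnitalStarAlgHom.norm_apply_le φ b
  rwa [show φ b = Completed.of p (b ⊗ₜ[ℝ] 1) from rfl, Completed.norm_of] at h

theorem apply_cliffGen_le (e : E) : p (cliffGen e) ≤ ‖e‖ := by
  have h := p.star_mul_self' (cliffGen e)
  rw [star_cliffGen, cliffGen_mul_self, p.smul', Complex.norm_real, Real.norm_of_nonneg
    (by positivity)] at h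
  have h1 := p.apply_one_le
  refine le_of_sq_le_sq ?_ (norm_nonneg e)
  nlinarith [sq_nonneg ‖e‖]

theorem exists_bound (a : CliffOp E) : ∃ C : ℝ, ∀ p : CStarSeminorm (CliffOp E), p a ≤ C := by
  have key : ∀ x : CliffordAlgebra (negNormSq E), ∃ C : ℝ, ∀ p : CStarSeminorm (CliffOp E),
      p ((1 : HilbertOp) ⊗ₜ[ℝ] x) ≤ C := by
    intro x
    induction x using CliffordAlgebra.induction with
    | algebraMap r =>
      refine ⟨‖r • (1 : HilbertOp)‖, fun p => ?_⟩
      rw [Algebra.algebraMap_eq_smul_one, ← TensorProduct.smul_tmul]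
      exact p.apply_tmul_one_le _
    | ι e =>
      refine ⟨‖e‖, fun p => ?_⟩
      have h : (1 : HilbertOp) ⊗ₜ[ℝ] CliffordAlgebra.ι (negNormSq E) e
          = (-Complex.I) • cliffGen e := by
        simp [cliffGen, TensorProduct.smul_tmul', smul_smul, TensorProduct.neg_tmul]
      rw [h, p.smul']
      simpa using p.apply_cliffGen_le e
    | mul x y hx hy =>
      obtain ⟨C, hC⟩ := hx
      obtain ⟨D, hD⟩ := hy
      refine ⟨C * D, fun p => ?_⟩
      have h := p.mul_le' ((1 : HilbertOp) ⊗ₜ[ℝ] x) ((1 : HilbertOp) ⊗ₜ[ℝ] y)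
      rw [Algebra.TensorProduct.tmul_mul_tmul, one_mul] at h
      exact h.trans (mul_le_mul (hC p) (hD p) (p.nonneg _) ((p.nonneg _).trans (hC p)))
    | add x y hx hy =>
      obtain ⟨C, hC⟩ := hx
      obtain ⟨D, hD⟩ := hy
      refine ⟨C + D, fun p => ?_⟩
      rw [TensorProduct.tmul_add]
      exact (p.add_le' _ _).trans (add_le_add (hC p) (hD p))
  induction a using TensorProduct.induction_on with
  | zero => exact ⟨0, fun p => p.map_zero.le⟩
  | tmul b x =>
    obtain ⟨C, hC⟩ := key x
    refine ⟨‖b‖ * C, fun p => ?_⟩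
    have h := p.mul_le' (b ⊗ₜ[ℝ] 1) ((1 : HilbertOp) ⊗ₜ[ℝ] x)
    rw [Algebra.TensorProduct.tmul_mul_tmul, one_mul, mul_one] at h
    exact h.trans (mul_le_mul (p.apply_tmul_one_le b) (hC p) (p.nonneg _) (norm_nonneg _))
  | add x y hx hy =>
    obtain ⟨C, hC⟩ := hx
    obtain ⟨D, hD⟩ := hy
    exact ⟨C + D, fun p => (p.add_le' _ _).trans (add_le_add (hC p) (hD p))⟩

end CStarSeminorm

/-- The zero seminorm. -/
instance : Inhabited (CStarSeminorm (CliffOp E)) :=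
  ⟨⟨fun _ => 0, by simp, by simp, by simp, by simp⟩⟩

/-- The largest `C⋆`-seminorm on `B(ℓ²) ⊗ Cliff_ℂ(E)`. As Clifford algebras are nuclear, it is the
unique `C⋆`-norm that extends the operator norm of `B(ℓ²)`. -/
def cliffSeminorm (E : Type*) [NormedAddCommGroup E] [InnerProductSpace ℝ E] :
    CStarSeminorm (CliffOp E) :=
  have hb : ∀ a : CliffOp E, BddAbove (Set.range fun p : CStarSeminorm (CliffOp E) => p a) :=
    fun a => by
      obtain ⟨C, hC⟩ := CStarSeminorm.exists_bound a
      exact ⟨C, by rintro _ ⟨p, rfl⟩; exact hC p⟩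
  { toFun := fun a => ⨆ p : CStarSeminorm (CliffOp E), p a
    add_le' := fun a b => ciSup_le fun p =>
      (p.add_le' a b).trans (add_le_add (le_ciSup (hb a) p) (le_ciSup (hb b) p))
    smul' := fun c a => by
      rw [Real.mul_iSup_of_nonneg (norm_nonneg c)]
      exact iSup_congr fun p => p.smul' c a
    mul_le' := fun a b => ciSup_le fun p =>
      (p.mul_le' a b).trans (mul_le_mul (le_ciSup (hb a) p) (le_ciSup (hb b) p) (p.nonneg b)
        ((p.nonneg a).trans (le_ciSup (hb a) p)))
    star_mul_self' := fun a => by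
      have h0 : 0 ≤ ⨆ p : CStarSeminorm (CliffOp E), p a := Real.iSup_nonneg fun p => p.nonneg a
      have h1 : 0 ≤ ⨆ p : CStarSeminorm (CliffOp E), p (star a * a) :=
        Real.iSup_nonneg fun p => p.nonneg _
      refine le_antisymm (ciSup_le fun p => ?_) ?_
      · rw [p.star_mul_self']
        exact mul_le_mul (le_ciSup (hb a) p) (le_ciSup (hb a) p) (p.nonneg a) h0
      · rw [← sq, ← Real.le_sqrt h0 h1]
        refine ciSup_le fun p => Real.le_sqrt_of_sq_le ?_
        rw [sq, ← p.star_mul_self']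
        exact le_ciSup (hb (star a * a)) p }

theorem le_cliffSeminorm (p : CStarSeminorm (CliffOp E)) (a : CliffOp E) :
    p a ≤ cliffSeminorm E a := by
  obtain ⟨C, hC⟩ := CStarSeminorm.exists_bound a
  exact le_ciSup (f := fun p : CStarSeminorm (CliffOp E) => p a)
    ⟨C, by rintro _ ⟨p, rfl⟩; exact hC p⟩ p

end coefficients

section functions

open scoped TensorProduct NNReal BoundedContinuousFunction ZeroAtInfty

namespace CStarSeminorm

/-- The pullback of a `C⋆`-seminorm under a `*`-homomorphism. -/
def comap {A B : Type*} [NonUnitalRing A] [StarRing A] [Module ℂ A] [NonUnitalRing B]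
    [StarRing B] [Module ℂ B] (q : CStarSeminorm B) (f : A →⋆ₙₐ[ℂ] B) : CStarSeminorm A where
  toFun a := q (f a)
  add_le' a b := by rw [_root_.map_add]; exact q.add_le' _ _
  smul' c a := by rw [_root_.map_smul]; exact q.smul' _ _
  mul_le' a b := by rw [_root_.map_mul]; exact q.mul_le' _ _
  star_mul_self' a := by rw [_root_.map_mul, StarHomClass.map_star]; exact q.star_mul_self' _

end CStarSeminorm

section cliffMap

variable {E : Type*} [NormedAddCommGroup E] [InnerProductSpace ℝ E]

/-- The `*`-endomorphism of `B(ℓ²) ⊗ Cliff(E)` induced by a linear isometry of `E`. -/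
def cliffMap (f : negNormSq E →qᵢ negNormSq E) : CliffOp E →⋆ₙₐ[ℂ] CliffOp E where
  toFun := Algebra.TensorProduct.map (AlgHom.id ℂ HilbertOp) (CliffordAlgebra.map f)
  map_smul' c a := _root_.map_smul
    (Algebra.TensorProduct.map (AlgHom.id ℂ HilbertOp) (CliffordAlgebra.map f)) c a
  map_zero' := _root_.map_zero _
  map_add' := _root_.map_add _
  map_mul' := _root_.map_mul _
  map_star' a := by
    induction a using TensorProduct.induction_on with
    | zero => simp
    | tmul b x =>
      simp only [TensorProduct.star_tmul, Algebra.TensorProduct.map_tmul, AlgHom.coe_id, id_eq]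
      congr 1
      induction x using CliffordAlgebra.induction with
      | algebraMap r => simp
      | ι e => simp
      | mul x y hx hy => simp [hx, hy]
      | add x y hx hy => simp [hx, hy]
    | add x y hx hy => simp only [star_add, _root_.map_add, hx, hy]

theorem cliffMap_tmul (f : negNormSq E →qᵢ negNormSq E) (b : HilbertOp)
    (x : CliffordAlgebra (negNormSq E)) :
    cliffMap f (b ⊗ₜ[ℝ] x) = b ⊗ₜ[ℝ] CliffordAlgebra.map f x := rfl

theorem cliffMap_comp (f g : negNormSq E →qᵢ negNormSq E) (a : CliffOp E) :
    cliffMap (f.comp g) a = cliffMap f (cliffMap g a) := by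
  induction a using TensorProduct.induction_on with
  | zero => simp only [_root_.map_zero]
  | tmul b x => rw [cliffMap_tmul, cliffMap_tmul, cliffMap_tmul, ← CliffordAlgebra.map_comp_map]; rfl
  | add x y hx hy => simp only [_root_.map_add, hx, hy]

theorem cliffMap_id (a : CliffOp E) :
    cliffMap (QuadraticMap.Isometry.id (negNormSq E)) a = a := by
  induction a using TensorProduct.induction_on with
  | zero => simp only [_root_.map_zero]
  | tmul b x => rw [cliffMap_tmul, CliffordAlgebra.map_id]; rfl
  | add x y hx hy => simp only [_root_.map_add, hx, hy]

theorem cliffMap_le (f : negNormSq E →qᵢ negNormSq E) (a : CliffOp E) :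
    cliffSeminorm E (cliffMap f a) ≤ cliffSeminorm E a :=
  le_cliffSeminorm ((cliffSeminorm E).comap (cliffMap f)) a

end cliffMap

variable (H : Type*) [NormedAddCommGroup H] [InnerProductSpace ℝ H]

/-- The Euclidean space `ℝ ⊕ H`. -/
abbrev CliffSpace : Type _ := WithLp 2 (ℝ × H)

/-- The `C⋆`-algebra `B(ℓ²) ⊗ Cliff_ℂ(ℝ ⊕ H)`. -/
def Coeff : Type _ := (cliffSeminorm (CliffSpace H)).Completed

instance : NonUnitalCStarAlgebra (Coeff H) :=
  inferInstanceAs (NonUnitalCStarAlgebra (cliffSeminorm (CliffSpace H)).Completed)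

/-- The bounded continuous functions on `ℝ₊ × H` with values in `B(ℓ²) ⊗ Cliff_ℂ(ℝ ⊕ H)`; they form
a `C⋆`-algebra under the pointwise operations and the supremum norm. -/
abbrev Fun : Type _ := (ℝ≥0 × H) →ᵇ Coeff H

instance : NonUnitalNormedRing (Fun H) := inferInstance
instance : StarRing (Fun H) := inferInstance
instance : NormedSpace ℂ (Fun H) := inferInstance
instance : StarModule ℂ (Fun H) := inferInstance
instance : IsScalarTower ℂ (Fun H) (Fun H) := inferInstance
instance : SMulCommClass ℂ (Fun H) (Fun H) := inferInstance
instance : CStarRing (Fun H) := inferInstance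

variable {H}

/-- The self-adjoint Clifford generator of `(s, v) ∈ ℝ ⊕ H`. -/
def Coeff.gen (s : ℝ) (v : H) : Coeff H :=
  CStarSeminorm.Completed.of (cliffSeminorm (CliffSpace H)) (cliffGen (WithLp.toLp 2 (s, v)))

/-- The element `b ⊗ 1`. -/
def Coeff.op (b : HilbertOp) : Coeff H :=
  CStarSeminorm.Completed.of (cliffSeminorm (CliffSpace H)) (b ⊗ₜ[ℝ] 1)

/-- The complex Clifford algebra `Cliff_ℂ(V⁰) ⊆ Cliff_ℂ(ℝ ⊕ H)` of a subspace `V⁰` of `H`. -/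
def Coeff.cliff (V₀ : Submodule ℝ H) : Submodule ℂ (Coeff H) :=
  Submodule.span ℂ {c | ∃ a ∈ Algebra.adjoin ℝ
      {b | ∃ v ∈ V₀, b = CliffordAlgebra.ι (negNormSq (CliffSpace H)) (WithLp.toLp 2 (0, v))},
    c = CStarSeminorm.Completed.of (cliffSeminorm (CliffSpace H)) ((1 : HilbertOp) ⊗ₜ[ℝ] a)}

/-- The isometry `1 ⊕ e` of `ℝ ⊕ H`. -/
def cliffIso (e : H ≃ₗᵢ[ℝ] H) : negNormSq (CliffSpace H) →qᵢ negNormSq (CliffSpace H) where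
  toFun x := WithLp.toLp 2 (x.fst, e x.snd)
  map_add' x y := congrArg (WithLp.toLp 2) (Prod.ext (by simp) (by simp))
  map_smul' c x := congrArg (WithLp.toLp 2) (Prod.ext (by simp) (by simp))
  map_app' x := by
    simp only [negNormSq_apply, WithLp.prod_norm_sq_eq_of_L2]
    simp

/-- The `*`-endomorphism of `B(ℓ²) ⊗ Cliff_ℂ(ℝ ⊕ H)` induced by `1 ⊕ e`. -/
def Coeff.map (e : H ≃ₗᵢ[ℝ] H) : Coeff H →⋆ₙₐ[ℂ] Coeff H :=
  CStarSeminorm.complMap (cliffMap (cliffIso e)) (cliffMap_le (cliffIso e))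

theorem Coeff.norm_map_le (e : H ≃ₗᵢ[ℝ] H) (a : Coeff H) : ‖Coeff.map e a‖ ≤ ‖a‖ :=
  NonUnitalStarAlgHom.norm_apply_le (Coeff.map e) a

theorem Coeff.continuous_map (e : H ≃ₗᵢ[ℝ] H) : Continuous (Coeff.map e) :=
  CStarSeminorm.continuous_complMap (cliffMap (cliffIso e)) (cliffMap_le (cliffIso e))

theorem Coeff.ind {P : Coeff H → Prop} (hc : IsClosed {x | P x})
    (h : ∀ a : CliffOp (CliffSpace H),
      P (CStarSeminorm.Completed.of (cliffSeminorm (CliffSpace H)) a)) (x : Coeff H) : P x :=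
  CStarSeminorm.Completed.ind (p := cliffSeminorm (CliffSpace H)) hc h x

theorem Coeff.map_of (e : H ≃ₗᵢ[ℝ] H) (a : CliffOp (CliffSpace H)) :
    Coeff.map e (CStarSeminorm.Completed.of (cliffSeminorm (CliffSpace H)) a)
      = CStarSeminorm.Completed.of (cliffSeminorm (CliffSpace H)) (cliffMap (cliffIso e) a) :=
  CStarSeminorm.complMap_of _ _ a

theorem Coeff.map_map (e e' : H ≃ₗᵢ[ℝ] H) (x : Coeff H) :
    Coeff.map e (Coeff.map e' x) = Coeff.map (e'.trans e) x := by
  induction x using Coeff.ind with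
  | hc =>
    exact isClosed_eq ((Coeff.continuous_map e).comp (Coeff.continuous_map e'))
      (Coeff.continuous_map _)
  | h a =>
    rw [Coeff.map_of, Coeff.map_of, Coeff.map_of, ← cliffMap_comp]
    rfl

theorem Coeff.map_refl (x : Coeff H) : Coeff.map (LinearIsometryEquiv.refl ℝ H) x = x := by
  induction x using Coeff.ind with
  | hc => exact isClosed_eq (Coeff.continuous_map _) continuous_id
  | h a =>
    rw [Coeff.map_of]
    exact congrArg _ (cliffMap_id a)

/-- The action `t_*` of an affine isometry `t` of `H` with linear part `t⁰` on functions: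
`(t_* F)(s, v) = Cliff(1 ⊕ t⁰) (F (s, t⁻¹ v))`. -/
def transport (t : H ≃ᵃⁱ[ℝ] H) : Fun H →⋆ₙₐ[ℂ] Fun H where
  toFun F := BoundedContinuousFunction.ofNormedAddCommGroup
    (fun p => Coeff.map t.linearIsometryEquiv (F (p.1, t.symm p.2)))
    ((Coeff.continuous_map _).comp (F.continuous.comp
      (continuous_fst.prodMk (t.symm.continuous.comp continuous_snd)))) ‖F‖
    (fun _ => (Coeff.norm_map_le _ _).trans (F.norm_coe_le_norm _))
  map_smul' c F := by ext p; exact _root_.map_smul (Coeff.map t.linearIsometryEquiv) c _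
  map_zero' := by ext p; exact _root_.map_zero (Coeff.map t.linearIsometryEquiv)
  map_add' F G := by ext p; exact _root_.map_add (Coeff.map t.linearIsometryEquiv) _ _
  map_mul' F G := by ext p; exact _root_.map_mul (Coeff.map t.linearIsometryEquiv) _ _
  map_star' F := by ext p; exact StarHomClass.map_star (Coeff.map t.linearIsometryEquiv) _

theorem transport_apply (t : H ≃ᵃⁱ[ℝ] H) (F : Fun H) (p : ℝ≥0 × H) :
    transport t F p = Coeff.map t.linearIsometryEquiv (F (p.1, t.symm p.2)) := rfl

theorem norm_transport_le (t : H ≃ᵃⁱ[ℝ] H) (F : Fun H) : ‖transport t F‖ ≤ ‖F‖ :=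
  (BoundedContinuousFunction.norm_le (norm_nonneg F)).2 fun _ =>
    (Coeff.norm_map_le _ _).trans (F.norm_coe_le_norm _)

theorem transport_transport (t t' : H ≃ᵃⁱ[ℝ] H) (F : Fun H) :
    transport t (transport t' F) = transport (t'.trans t) F := by
  ext p
  exact Coeff.map_map _ _ _

theorem transport_refl (F : Fun H) : transport (AffineIsometryEquiv.refl ℝ H) F = F := by
  ext p
  exact Coeff.map_refl _

end functions

section twisted

open scoped NNReal BoundedContinuousFunction ZeroAtInfty
open Filter Topology

/-- A sequence of metric spaces has uniformly bounded geometry. -/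
class UniformBoundedGeometry (X : ℕ → Type u) [∀ n, MetricSpace (X n)] : Prop where
  exists_bound : ∀ R : ℝ, ∃ N : ℕ, ∀ (n : ℕ) (x : X n),
    {y | dist y x ≤ R}.Finite ∧ {y | dist y x ≤ R}.ncard ≤ N

/-- A fibred coarse embedding of a sequence of metric spaces into the Hilbert space `H`. The
trivialisation `triv n x z` is only constrained and only used for `z` in the ball `B(x, l n)`. -/
structure FibredCoarseEmbedding (X : ℕ → Type u) [∀ n, MetricSpace (X n)] (H : Type v)
    [NormedAddCommGroup H] [InnerProductSpace ℝ H] where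
  fiber : ∀ n, X n → Type w
  [normed : ∀ n x, NormedAddCommGroup (fiber n x)]
  [inner : ∀ n x, InnerProductSpace ℝ (fiber n x)]
  [complete : ∀ n x, CompleteSpace (fiber n x)]
  sec : ∀ n (x : X n), fiber n x
  ρm : ℝ → ℝ
  ρp : ℝ → ℝ
  ρm_nonneg : ∀ t, 0 ≤ t → 0 ≤ ρm t
  ρp_nonneg : ∀ t, 0 ≤ t → 0 ≤ ρp t
  ρm_mono : MonotoneOn ρm (Set.Ici 0)
  ρp_mono : MonotoneOn ρp (Set.Ici 0)
  ρm_tendsto : Tendsto ρm atTop atTop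
  ρp_tendsto : Tendsto ρp atTop atTop
  l : ℕ → ℝ
  l_nonneg : 0 ≤ l 0
  l_mono : Monotone l
  l_tendsto : Tendsto l atTop atTop
  triv : ∀ n (_ z : X n), fiber n z ≃ᵃⁱ[ℝ] H
  le_dist : ∀ n (x z z' : X n), dist z x ≤ l n → dist z' x ≤ l n →
    ρm (dist z z') ≤ ‖triv n x z (sec n z) - triv n x z' (sec n z')‖
  dist_le : ∀ n (x z z' : X n), dist z x ≤ l n → dist z' x ≤ l n →
    ‖triv n x z (sec n z) - triv n x z' (sec n z')‖ ≤ ρp (dist z z')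
  compat : ∀ n (x y : X n), ∃ t : H ≃ᵃⁱ[ℝ] H, ∀ z : X n, dist z x ≤ l n → dist z y ≤ l n →
    triv n x z = (triv n y z).trans t

attribute [instance] FibredCoarseEmbedding.normed FibredCoarseEmbedding.inner
  FibredCoarseEmbedding.complete

variable {X : ℕ → Type u} [∀ n, MetricSpace (X n)] {H : Type v} [NormedAddCommGroup H]
  [InnerProductSpace ℝ H]

namespace FibredCoarseEmbedding

variable (𝔢 : FibredCoarseEmbedding.{u, v, w} X H)

/-- The affine isometry `t_{xy}` with `t_{xy} ∘ t_y(z) = t_x(z)` for `z ∈ B(x, l n) ∩ B(y, l n)`. -/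
def trans (n : ℕ) (x y : X n) : H ≃ᵃⁱ[ℝ] H := (𝔢.compat n x y).choose

theorem trans_spec (n : ℕ) {x y z : X n} (hx : dist z x ≤ 𝔢.l n) (hy : dist z y ≤ 𝔢.l n)
    (h : 𝔢.fiber n z) : 𝔢.trans n x y (𝔢.triv n y z h) = 𝔢.triv n x z h := by
  rw [(𝔢.compat n x y).choose_spec z hx hy]
  rfl

theorem l_nonneg' (n : ℕ) : 0 ≤ 𝔢.l n := 𝔢.l_nonneg.trans (𝔢.l_mono (Nat.zero_le n))

theorem trans_self (n : ℕ) (x : X n) : 𝔢.trans n x x = AffineIsometryEquiv.refl ℝ H := by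
  ext h
  have h0 : dist x x ≤ 𝔢.l n := by rw [dist_self]; exact 𝔢.l_nonneg' n
  have := 𝔢.trans_spec n h0 h0 ((𝔢.triv n x x).symm h)
  simpa using this

theorem trans_trans (n : ℕ) {x y z p : X n} (hx : dist p x ≤ 𝔢.l n) (hy : dist p y ≤ 𝔢.l n)
    (hz : dist p z ≤ 𝔢.l n) : (𝔢.trans n y z).trans (𝔢.trans n x y) = 𝔢.trans n x z := by
  ext h
  have h1 := 𝔢.trans_spec n hx hz ((𝔢.triv n z p).symm h)
  have h2 := 𝔢.trans_spec n hy hz ((𝔢.triv n z p).symm h)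
  have h3 := 𝔢.trans_spec n hx hy ((𝔢.triv n z p).symm h)
  rw [AffineIsometryEquiv.apply_symm_apply] at h1 h2
  rw [AffineIsometryEquiv.coe_trans, Function.comp_apply, h2, h3, h1]

/-- The point `t_x(z)(s(z))` of `H`. -/
def pt (n : ℕ) (x z : X n) : H := 𝔢.triv n x z (𝔢.sec n z)

/-- The affine subspace `V_n` of `H`. -/
def V (n : ℕ) : AffineSubspace ℝ H :=
  affineSpan ℝ {v | ∃ x z : X n, dist z x ≤ 𝔢.l n ∧ v = 𝔢.pt n x z}

/-- The affine subspace `W_k(x)` of `V_n`. -/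
def W (n : ℕ) (k : ℝ) (x : X n) : AffineSubspace ℝ H :=
  affineSpan ℝ {v | ∃ z : X n, dist z x ≤ 𝔢.l n ∧ dist z x ≤ k ∧ v = 𝔢.pt n x z}

end FibredCoarseEmbedding

/-! ### The coefficient algebras `A(V) ⊗ K` -/

/-- The elementary tensors of `S ⊗ C(V) ⊗ K`, as functions on `ℝ × V`. -/
def elementary (V : AffineSubspace ℝ H) : Set (ℝ × V → Coeff H) :=
  {F | ∃ (g : C₀(ℝ, ℂ)) (h : C₀(V, Coeff H)) (κ : HilbertOp),
    (∀ v, h v ∈ Coeff.cliff V.direction) ∧ IsCompactOperator κ ∧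
    F = fun p => g p.1 • (h p.2 * Coeff.op κ)}

/-- `G` is the image of `F` under the Bott map `β_{V,H}`: on `g ⊗ h ⊗ κ` it is
`g(X ⊗ 1 + 1 ⊗ C) h κ`. Here `X` is represented by multiplication by `s` times the first generator
of `Cliff_ℂ(ℝ ⊕ H)`, so `X ⊗ 1 + 1 ⊗ C` is at `(s, v + u)` (with `v ∈ V` and `u ⊥ V⁰`) the self-adjoint
Clifford generator of `(s, u)`, with square `τ² = s² + ‖u‖²`, and
`g(X ⊗ 1 + 1 ⊗ C) = (g(τ) + g(-τ)) / 2 + τ⁻¹ (X ⊗ 1 + 1 ⊗ C) (g(τ) - g(-τ)) / 2`. -/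
def IsBott (V : AffineSubspace ℝ H) (F : ℝ × V → Coeff H) (G : Fun H) : Prop :=
  ∀ (s : ℝ≥0) (v : V) (u : H), u ∈ V.directionᗮ →
    let τ : ℝ := √((s : ℝ) ^ 2 + ‖u‖ ^ 2)
    G (s, v + u) = (1 / 2 : ℂ) • (F (τ, v) + F (-τ, v))
      + Coeff.gen ((s : ℝ) / τ) (τ⁻¹ • u) * ((1 / 2 : ℂ) • (F (τ, v) - F (-τ, v)))

/-- The `C⋆`-algebra `A(V) ⊗ K = S ⊗ C(V) ⊗ K`, embedded into the functions on `ℝ₊ × H` by its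
Bott map. The Bott maps between these algebras become inclusions. -/
def coeffAlg (V : AffineSubspace ℝ H) : Set (Fun H) :=
  closure {G | ∃ F ∈ Submodule.span ℂ (elementary V), IsBott V F G}

/-- The support in `ℝ₊ × V` of an element of `A(V) ⊗ K`. -/
def coeffSupport (V : AffineSubspace ℝ H) (a : Fun H) : Set (ℝ≥0 × V) :=
  {p | ∀ g : C₀(ℝ≥0 × V, ℂ), g p ≠ 0 → ∃ q : ℝ≥0 × V, g q • a (q.1, (q.2 : H)) ≠ 0}

/-- The point `v + w` of `V`, for `w ∈ V⁰`. -/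
def shift (V : AffineSubspace ℝ H) (v : V) (w : V.direction) : V :=
  ⟨(w : H) +ᵥ (v : H), AffineSubspace.vadd_mem_of_mem_direction w.2 v.2⟩

/-- `D` is the derivative of `F` in the direction `(a, w)`. -/
def IsDirDeriv (V : AffineSubspace ℝ H) (F : ℝ × V → Coeff H) (a : ℝ) (w : V.direction)
    (D : ℝ × V → Coeff H) : Prop :=
  ∀ (s : ℝ) (v : V), HasDerivAt (fun h : ℝ => F (s + h * a, shift V v (h • w))) (D (s, v)) 0

/-! ### Sequences of matrices -/

variable (X H) in
/-- Sequences of matrices `X n × X n → A`, with `A` the bounded continuous functions on `ℝ₊ × H`. -/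
abbrev MatSeq : Type (max u v) := ∀ n, X n → X n → Fun H

namespace FibredCoarseEmbedding

variable (𝔢 : FibredCoarseEmbedding.{u, v, w} X H)

/-- The conditions on the sequences that represent the elements of the algebraic twisted Roe algebra at
infinity: uniform boundedness, locality (the entry at `(x, y)` comes from a finite sum `F` of elementary
tensors over `W_k(x)`) with uniformly bounded directional derivatives of `F` that exist in
`A(W_k(x)) ⊗ K`, finite propagation, and uniformly bounded supports. -/
structure Admissible (T : MatSeq X H) : Prop where
  bounded : ∃ C : ℝ, ∀ n (x y : X n), T n x y ∈ coeffAlg (𝔢.V n) ∧ ‖T n x y‖ ≤ C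
  local_smooth : ∃ k > 0, ∃ c > 0, ∀ n (x y : X n),
    ∃ F ∈ Submodule.span ℂ (elementary (𝔢.W n k x)), IsBott (𝔢.W n k x) F (T n x y) ∧
      ∀ (a : ℝ) (w : (𝔢.W n k x).direction), a ^ 2 + ‖w‖ ^ 2 ≤ 1 →
        ∃ D, IsDirDeriv (𝔢.W n k x) F a w D ∧
          ∃ G ∈ coeffAlg (𝔢.W n k x), IsBott (𝔢.W n k x) D G ∧ ‖G‖ ≤ c
  propagation : ∃ R : ℝ, ∀ n (x y : X n), R < dist x y → T n x y = 0
  support : ∃ r > 0, ∀ n (x y : X n), coeffSupport (𝔢.V n) (T n x y) ⊆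
    {p | (p.1 : ℝ) ^ 2 + ‖(p.2 : H) - 𝔢.pt n x x‖ ^ 2 < r ^ 2}

/-- The uniformly bounded sequences of matrices of uniformly finite propagation. -/
def Pre (_𝔢 : FibredCoarseEmbedding.{u, v, w} X H) : Submodule ℂ (MatSeq X H) where
  carrier := {T | (∃ C : ℝ, ∀ n (x y : X n), ‖T n x y‖ ≤ C) ∧
    ∃ R : ℝ, ∀ n (x y : X n), R < dist x y → T n x y = 0}
  zero_mem' := ⟨⟨0, fun n x y => by simp⟩, ⟨0, fun n x y _ => rfl⟩⟩
  add_mem' := by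
    rintro S T ⟨⟨C, hC⟩, ⟨R, hR⟩⟩ ⟨⟨C', hC'⟩, ⟨R', hR'⟩⟩
    refine ⟨⟨C + C', fun n x y => (norm_add_le _ _).trans (add_le_add (hC n x y) (hC' n x y))⟩,
      ⟨max R R', fun n x y h => ?_⟩⟩
    change S n x y + T n x y = 0
    rw [hR n x y ((le_max_left _ _).trans_lt h), hR' n x y ((le_max_right _ _).trans_lt h), add_zero]
  smul_mem' := by
    rintro c T ⟨⟨C, hC⟩, ⟨R, hR⟩⟩
    refine ⟨⟨‖c‖ * C, fun n x y => ?_⟩, ⟨R, fun n x y h => ?_⟩⟩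
    · exact (norm_smul_le c (T n x y)).trans (mul_le_mul_of_nonneg_left (hC n x y) (norm_nonneg c))
    · change c • T n x y = 0
      rw [hR n x y h, smul_zero]

/-- The sequences that are equivalent to zero. -/
def Null (𝔢 : FibredCoarseEmbedding.{u, v, w} X H) : Submodule ℂ 𝔢.Pre where
  carrier := {T | ∀ ε > 0, ∀ᶠ n in atTop, ∀ x y : X n, ‖T.1 n x y‖ ≤ ε}
  zero_mem' := fun ε hε => Eventually.of_forall fun n x y => by simpa using hε.le
  add_mem' := by
    intro S T hS hT ε hε
    filter_upwards [hS (ε / 2) (by positivity), hT (ε / 2) (by positivity)] with n h1 h2 x y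
    exact (norm_add_le _ _).trans (by linarith [h1 x y, h2 x y])
  smul_mem' := by
    intro c T hT ε hε
    filter_upwards [hT (ε / (‖c‖ + 1)) (by positivity)] with n h x y
    refine (norm_smul_le c (T.1 n x y)).trans ?_
    calc ‖c‖ * ‖T.1 n x y‖ ≤ (‖c‖ + 1) * (ε / (‖c‖ + 1)) :=
          mul_le_mul (by linarith) (h x y) (norm_nonneg _) (by positivity)
      _ = ε := by field_simp

/-- Sequences of matrices up to equivalence. -/
def Ambient (𝔢 : FibredCoarseEmbedding.{u, v, w} X H) : Type (max u v) := 𝔢.Pre ⧸ 𝔢.Null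

instance : AddCommGroup 𝔢.Ambient := inferInstanceAs (AddCommGroup (𝔢.Pre ⧸ 𝔢.Null))
instance : Module ℂ 𝔢.Ambient := inferInstanceAs (Module ℂ (𝔢.Pre ⧸ 𝔢.Null))

/-- The class of a sequence of matrices. -/
def cls (T : 𝔢.Pre) : 𝔢.Ambient := Submodule.Quotient.mk T

variable {𝔢}

theorem cls_surjective : Function.Surjective 𝔢.cls := Submodule.Quotient.mk_surjective _

theorem cls_add (S T : 𝔢.Pre) : 𝔢.cls (S + T) = 𝔢.cls S + 𝔢.cls T := rfl
theorem cls_smul (c : ℂ) (T : 𝔢.Pre) : 𝔢.cls (c • T) = c • 𝔢.cls T := rfl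
theorem cls_zero : 𝔢.cls 0 = 0 := rfl

theorem cls_eq {S T : 𝔢.Pre} : 𝔢.cls S = 𝔢.cls T ↔ S - T ∈ 𝔢.Null := Submodule.Quotient.eq _

theorem cls_eq_of_eventually {S T : 𝔢.Pre} (h : ∀ᶠ n in atTop, ∀ x y : X n, S.1 n x y = T.1 n x y) :
    𝔢.cls S = 𝔢.cls T := by
  rw [cls_eq]
  intro ε hε
  filter_upwards [h] with n h x y
  change ‖S.1 n x y - T.1 n x y‖ ≤ ε
  rw [h, sub_self, norm_zero]
  exact hε.le

theorem eventually_le (𝔢 : FibredCoarseEmbedding.{u, v, w} X H) (R : ℝ) :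
    ∀ᶠ n in atTop, R ≤ 𝔢.l n := 𝔢.l_tendsto.eventually_ge_atTop R

theorem norm_sum_le [∀ n, Fintype (X n)] {n : ℕ} {x : X n} {R C : ℝ} {N : ℕ}
    (hN : {y : X n | dist y x ≤ R}.ncard ≤ N) (hC : 0 ≤ C) (f : X n → Fun H)
    (hf : ∀ z, R < dist x z → f z = 0) (hfC : ∀ z, ‖f z‖ ≤ C) : ‖∑ z, f z‖ ≤ N * C := by
  classical
  have h1 : ∑ z, f z = ∑ z ∈ Finset.univ.filter (fun z => dist z x ≤ R), f z := by
    symm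
    apply Finset.sum_subset (Finset.subset_univ _)
    intro z _ hz
    apply hf
    simpa [dist_comm] using hz
  have h2 : (Finset.univ.filter (fun z => dist z x ≤ R)).card ≤ N := by
    rw [← Set.ncard_coe_finset]
    simpa using hN
  rw [h1]
  refine (_root_.norm_sum_le_of_le _ fun z _ => hfC z).trans ?_
  rw [Finset.sum_const, nsmul_eq_mul]
  exact mul_le_mul_of_nonneg_right (by exact_mod_cast h2) hC

variable [∀ n, Fintype (X n)]

/-- The product of sequences of matrices:
`(TS)(x, y) = ∑_z T(x, z) (t_{xz})_* (S(z, y))`. -/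
def mulSeq (𝔢 : FibredCoarseEmbedding.{u, v, w} X H) (T S : MatSeq X H) : MatSeq X H :=
  fun n x y => ∑ z, T n x z * transport (𝔢.trans n x z) (S n z y)

/-- The involution of sequences of matrices: `T*(x, y) = (t_{xy})_* (T(y, x)*)`. -/
def starSeq (𝔢 : FibredCoarseEmbedding.{u, v, w} X H) (T : MatSeq X H) : MatSeq X H :=
  fun n x y => transport (𝔢.trans n x y) (star (T n y x))

theorem norm_mul_transport_le {a b : Fun H} {C D : ℝ} (t : H ≃ᵃⁱ[ℝ] H) (ha : ‖a‖ ≤ C)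
    (hb : ‖b‖ ≤ D) : ‖a * transport t b‖ ≤ C * D :=
  (norm_mul_le _ _).trans (mul_le_mul ha ((norm_transport_le t b).trans hb) (norm_nonneg _)
    ((norm_nonneg _).trans ha))

theorem starSeq_mem (T : 𝔢.Pre) : 𝔢.starSeq T.1 ∈ 𝔢.Pre := by
  obtain ⟨T, ⟨C, hC⟩, ⟨R, hR⟩⟩ := T
  refine ⟨⟨C, fun n x y => ?_⟩, ⟨R, fun n x y h => ?_⟩⟩
  · refine (norm_transport_le _ _).trans ?_
    rw [norm_star]
    exact hC n y x
  · change transport _ (star (T n y x)) = 0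
    rw [hR n y x (by rwa [dist_comm]), star_zero, map_zero]

/-! ### The Hilbert modules `E_n` -/

/-- The elements of the Hilbert module `E_n` over `A(V_n) ⊗ K`. -/
def InModule (𝔢 : FibredCoarseEmbedding.{u, v, w} X H) (n : ℕ) (f : X n → X n → Fun H) : Prop :=
  (∀ x y, f x y ∈ coeffAlg (𝔢.V n)) ∧ ∀ x y, 𝔢.l n / 2 < dist y x → f x y = 0

/-- The norm `‖⟨f, f⟩‖^{1/2}` of `E_n`. -/
def modNorm {n : ℕ} (f : X n → X n → Fun H) : ℝ := √‖∑ x, ∑ y, star (f x y) * f x y‖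

/-- The action of a matrix on `E_n`: `(S f)(x)(y) = ∑_z (t_{yx})_* (S(x, z)) f(z)(y)`, for
`y ∈ B(x, l n / 2)`; the entries outside this support, on which `f` itself vanishes, are cut off, so that
`E_n` is preserved. -/
def act (𝔢 : FibredCoarseEmbedding.{u, v, w} X H) (n : ℕ) (S f : X n → X n → Fun H) : X n → X n → Fun H := fun x y =>
  if dist y x ≤ 𝔢.l n / 2 then ∑ z, transport (𝔢.trans n y x) (S x z) * f z y else 0

/-- The operator norm of the matrix `S` on `E_n` is at most `r`. -/
def OpBound (𝔢 : FibredCoarseEmbedding.{u, v, w} X H) (n : ℕ) (S : X n → X n → Fun H) (r : ℝ) : Prop :=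
  ∀ f, 𝔢.InModule n f → modNorm (𝔢.act n S f) ≤ r * modNorm f

/-! ### The algebra structure -/

variable [UniformBoundedGeometry X]

theorem mulSeq_mem (T S : 𝔢.Pre) : 𝔢.mulSeq T.1 S.1 ∈ 𝔢.Pre := by
  obtain ⟨⟨C, hC⟩, ⟨R, hR⟩⟩ := T.2
  obtain ⟨⟨D, hD⟩, ⟨R', hR'⟩⟩ := S.2
  obtain ⟨N, hN⟩ := UniformBoundedGeometry.exists_bound (X := X) R
  refine ⟨⟨N * (|C| * |D|), fun n x y => ?_⟩, ⟨R + R', fun n x y h => ?_⟩⟩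
  · refine norm_sum_le (hN n x).2 (by positivity) _ (fun z hz => ?_) (fun z => ?_)
    · rw [hR n x z hz, zero_mul]
    · exact norm_mul_transport_le _ ((hC n x z).trans (le_abs_self C))
        ((hD n z y).trans (le_abs_self D))
  · refine Finset.sum_eq_zero fun z _ => ?_
    by_cases hz : R < dist x z
    · rw [hR n x z hz, zero_mul]
    · rw [hR' n z y (by linarith [dist_triangle x z y]), map_zero, mul_zero]

/-- The product of two sequences of `Pre`. -/
def mulPre (T S : 𝔢.Pre) : 𝔢.Pre := ⟨𝔢.mulSeq T.1 S.1, mulSeq_mem T S⟩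

/-- The adjoint of a sequence of `Pre`. -/
def starPre (T : 𝔢.Pre) : 𝔢.Pre := ⟨𝔢.starSeq T.1, starSeq_mem T⟩

theorem mulPre_sub_left (T T' S : 𝔢.Pre) : mulPre (T - T') S = mulPre T S - mulPre T' S := by
  apply Subtype.ext
  funext n x y
  change ∑ z, (T.1 n x z - T'.1 n x z) * _ = ∑ z, _ - ∑ z, _
  simp only [sub_mul, Finset.sum_sub_distrib]

theorem mulPre_sub_right (T S S' : 𝔢.Pre) : mulPre T (S - S') = mulPre T S - mulPre T S' := by
  apply Subtype.ext
  funext n x y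
  change ∑ z, T.1 n x z * transport _ (S.1 n z y - S'.1 n z y) = ∑ z, _ - ∑ z, _
  simp only [map_sub, mul_sub, Finset.sum_sub_distrib]

theorem mulPre_null_left {T : 𝔢.Pre} (hT : T ∈ 𝔢.Null) (S : 𝔢.Pre) : mulPre T S ∈ 𝔢.Null := by
  intro ε hε
  obtain ⟨R, hR⟩ := T.2.2
  obtain ⟨D, hD⟩ := S.2.1
  obtain ⟨N, hN⟩ := UniformBoundedGeometry.exists_bound (X := X) R
  filter_upwards [hT (ε / (N * |D| + 1)) (by positivity)] with n h x y
  refine (norm_sum_le (C := ε / (N * |D| + 1) * |D|) (hN n x).2 (by positivity) _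
    (fun z hz => ?_) (fun z => ?_)).trans ?_
  · rw [hR n x z hz, zero_mul]
  · exact norm_mul_transport_le _ (h x z) ((hD n z y).trans (le_abs_self D))
  · rw [div_mul_eq_mul_div, mul_div_assoc', div_le_iff₀ (by positivity)]
    nlinarith [abs_nonneg D]

theorem mulPre_null_right (T : 𝔢.Pre) {S : 𝔢.Pre} (hS : S ∈ 𝔢.Null) : mulPre T S ∈ 𝔢.Null := by
  intro ε hε
  obtain ⟨R, hR⟩ := T.2.2
  obtain ⟨D, hD⟩ := T.2.1
  obtain ⟨N, hN⟩ := UniformBoundedGeometry.exists_bound (X := X) R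
  filter_upwards [hS (ε / (N * |D| + 1)) (by positivity)] with n h x y
  refine (norm_sum_le (C := |D| * (ε / (N * |D| + 1))) (hN n x).2 (by positivity) _
    (fun z hz => ?_) (fun z => ?_)).trans ?_
  · rw [hR n x z hz, zero_mul]
  · exact norm_mul_transport_le _ ((hD n x z).trans (le_abs_self D)) (h z y)
  · rw [mul_div_assoc', mul_div_assoc', div_le_iff₀ (by positivity)]
    nlinarith [abs_nonneg D]

instance : Mul 𝔢.Ambient :=
  ⟨Quotient.map₂ mulPre (by
    intro T T' hT S S' hS
    rw [← Quotient.eq_iff_equiv] at hT hS ⊢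
    have hT1 : T - T' ∈ 𝔢.Null := cls_eq.1 hT
    have hS1 : S - S' ∈ 𝔢.Null := cls_eq.1 hS
    refine cls_eq.2 ?_
    have : mulPre T S - mulPre T' S' = mulPre (T - T') S + mulPre T' (S - S') := by
      rw [mulPre_sub_left, mulPre_sub_right]; abel
    rw [this]
    exact 𝔢.Null.add_mem (mulPre_null_left hT1 S) (mulPre_null_right T' hS1))⟩

theorem cls_mul (T S : 𝔢.Pre) : 𝔢.cls (mulPre T S) = 𝔢.cls T * 𝔢.cls S := rfl

theorem starPre_sub (T S : 𝔢.Pre) : starPre (T - S) = starPre T - starPre S := by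
  apply Subtype.ext
  funext n x y
  change transport _ (star (T.1 n y x - S.1 n y x)) = _ - _
  rw [star_sub, map_sub]
  rfl

theorem starPre_null {T : 𝔢.Pre} (hT : T ∈ 𝔢.Null) : starPre T ∈ 𝔢.Null := by
  intro ε hε
  filter_upwards [hT ε hε] with n h x y
  refine (norm_transport_le _ _).trans ?_
  rw [norm_star]
  exact h y x

instance : Star 𝔢.Ambient :=
  ⟨Quotient.map starPre (by
    intro T T' hT
    rw [← Quotient.eq_iff_equiv] at hT ⊢
    have hT1 : T - T' ∈ 𝔢.Null := cls_eq.1 hT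
    refine cls_eq.2 ?_
    rw [← starPre_sub]
    exact starPre_null hT1)⟩

theorem cls_star (T : 𝔢.Pre) : 𝔢.cls (starPre T) = star (𝔢.cls T) := rfl

theorem mul_assoc_ambient (a b c : 𝔢.Ambient) : a * b * c = a * (b * c) := by
  obtain ⟨T, rfl⟩ := cls_surjective a
  obtain ⟨S, rfl⟩ := cls_surjective b
  obtain ⟨U, rfl⟩ := cls_surjective c
  rw [← cls_mul, ← cls_mul, ← cls_mul, ← cls_mul]
  obtain ⟨R, hR⟩ := T.2.2
  obtain ⟨R', hR'⟩ := S.2.2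
  apply cls_eq_of_eventually
  filter_upwards [𝔢.eventually_le R, 𝔢.eventually_le R'] with n h h' x y
  change ∑ w, (∑ z, T.1 n x z * transport (𝔢.trans n x z) (S.1 n z w))
      * transport (𝔢.trans n x w) (U.1 n w y)
    = ∑ z, T.1 n x z * transport (𝔢.trans n x z)
      (∑ w, S.1 n z w * transport (𝔢.trans n z w) (U.1 n w y))
  simp only [Finset.sum_mul, Finset.mul_sum, map_sum, map_mul]
  rw [Finset.sum_comm]
  refine Finset.sum_congr rfl fun z _ => Finset.sum_congr rfl fun w _ => ?_
  rw [mul_assoc]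
  by_cases hz : R < dist x z
  · rw [hR n x z hz, zero_mul, zero_mul]
  by_cases hw : R' < dist z w
  · rw [hR' n z w hw, map_zero, zero_mul, zero_mul]
  rw [transport_transport, 𝔢.trans_trans n (p := z)]
  · rw [dist_comm]; linarith
  · rw [dist_self]; exact 𝔢.l_nonneg' n
  · linarith

theorem left_distrib_ambient (a b c : 𝔢.Ambient) : a * (b + c) = a * b + a * c := by
  obtain ⟨T, rfl⟩ := cls_surjective a
  obtain ⟨S, rfl⟩ := cls_surjective b
  obtain ⟨U, rfl⟩ := cls_surjective c
  rw [← cls_add, ← cls_mul, ← cls_mul, ← cls_mul, ← cls_add]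
  congr 1
  apply Subtype.ext
  funext n x y
  change ∑ z, T.1 n x z * transport _ (S.1 n z y + U.1 n z y) = ∑ z, _ + ∑ z, _
  simp only [map_add, mul_add, Finset.sum_add_distrib]

theorem right_distrib_ambient (a b c : 𝔢.Ambient) : (a + b) * c = a * c + b * c := by
  obtain ⟨T, rfl⟩ := cls_surjective a
  obtain ⟨S, rfl⟩ := cls_surjective b
  obtain ⟨U, rfl⟩ := cls_surjective c
  rw [← cls_add, ← cls_mul, ← cls_mul, ← cls_mul, ← cls_add]
  congr 1
  apply Subtype.ext
  funext n x y
  change ∑ z, (T.1 n x z + S.1 n x z) * _ = ∑ z, _ + ∑ z, _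
  simp only [add_mul, Finset.sum_add_distrib]

theorem smul_mul_ambient (c : ℂ) (a b : 𝔢.Ambient) : c • a * b = c • (a * b) := by
  obtain ⟨T, rfl⟩ := cls_surjective a
  obtain ⟨S, rfl⟩ := cls_surjective b
  rw [← cls_smul, ← cls_mul, ← cls_mul, ← cls_smul]
  congr 1
  apply Subtype.ext
  funext n x y
  change ∑ z, c • T.1 n x z * _ = c • ∑ z, _
  simp only [smul_mul_assoc, Finset.smul_sum]

theorem mul_smul_ambient (c : ℂ) (a b : 𝔢.Ambient) : a * c • b = c • (a * b) := by
  obtain ⟨T, rfl⟩ := cls_surjective a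
  obtain ⟨S, rfl⟩ := cls_surjective b
  rw [← cls_smul, ← cls_mul, ← cls_mul, ← cls_smul]
  congr 1
  apply Subtype.ext
  funext n x y
  change ∑ z, T.1 n x z * transport _ (c • S.1 n z y) = c • ∑ z, _
  simp only [map_smul, mul_smul_comm, Finset.smul_sum]

theorem star_star_ambient (a : 𝔢.Ambient) : star (star a) = a := by
  obtain ⟨T, rfl⟩ := cls_surjective a
  rw [← cls_star, ← cls_star]
  obtain ⟨R, hR⟩ := T.2.2
  apply cls_eq_of_eventually
  filter_upwards [𝔢.eventually_le R] with n h x y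
  change transport (𝔢.trans n x y) (star (transport (𝔢.trans n y x) (star (T.1 n x y)))) = T.1 n x y
  rw [← map_star, star_star, transport_transport]
  by_cases hxy : R < dist x y
  · rw [hR n x y hxy, map_zero]
  have h0 : dist x x ≤ 𝔢.l n := by rw [dist_self]; exact 𝔢.l_nonneg' n
  rw [𝔢.trans_trans n (p := x) h0 (by linarith) h0, trans_self, transport_refl]

theorem star_mul_ambient (a b : 𝔢.Ambient) : star (a * b) = star b * star a := by
  obtain ⟨T, rfl⟩ := cls_surjective a
  obtain ⟨S, rfl⟩ := cls_surjective b
  rw [← cls_star, ← cls_star, ← cls_mul, ← cls_mul, ← cls_star]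
  obtain ⟨R, hR⟩ := T.2.2
  obtain ⟨R', hR'⟩ := S.2.2
  apply cls_eq_of_eventually
  filter_upwards [𝔢.eventually_le R, 𝔢.eventually_le R'] with n h h' x y
  change transport (𝔢.trans n x y)
      (star (∑ z, T.1 n y z * transport (𝔢.trans n y z) (S.1 n z x)))
    = ∑ z, transport (𝔢.trans n x z) (star (S.1 n z x)) *
      transport (𝔢.trans n x z) (transport (𝔢.trans n z y) (star (T.1 n y z)))
  simp only [star_sum, map_sum, star_mul, map_mul, ← map_star]
  refine Finset.sum_congr rfl fun z _ => ?_
  by_cases hz : R < dist y z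
  · rw [hR n y z hz, star_zero]; simp only [map_zero, mul_zero]
  by_cases hw : R' < dist z x
  · rw [hR' n z x hw, star_zero]; simp only [map_zero, zero_mul]
  have h0 : dist z z ≤ 𝔢.l n := by rw [dist_self]; exact 𝔢.l_nonneg' n
  have hx : dist z x ≤ 𝔢.l n := by linarith
  have hy : dist z y ≤ 𝔢.l n := by rw [dist_comm]; linarith
  rw [transport_transport, transport_transport, 𝔢.trans_trans n hx hy h0,
    𝔢.trans_trans n hx h0 hy]

theorem star_add_ambient (a b : 𝔢.Ambient) : star (a + b) = star a + star b := by
  obtain ⟨T, rfl⟩ := cls_surjective a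
  obtain ⟨S, rfl⟩ := cls_surjective b
  rw [← cls_add, ← cls_star, ← cls_star, ← cls_star, ← cls_add]
  congr 1
  apply Subtype.ext
  funext n x y
  change transport _ (star (T.1 n y x + S.1 n y x)) = _ + _
  rw [star_add, map_add]
  rfl

theorem star_smul_ambient (c : ℂ) (a : 𝔢.Ambient) : star (c • a) = star c • star a := by
  obtain ⟨T, rfl⟩ := cls_surjective a
  rw [← cls_smul, ← cls_star, ← cls_star, ← cls_smul]
  congr 1
  apply Subtype.ext
  funext n x y
  change transport _ (star (c • T.1 n y x)) = star c • _
  rw [star_smul, map_smul]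
  rfl

instance : NonUnitalRing 𝔢.Ambient where
  __ := (inferInstance : AddCommGroup 𝔢.Ambient)
  left_distrib := left_distrib_ambient
  right_distrib := right_distrib_ambient
  zero_mul a := by
    have h := right_distrib_ambient 0 0 a
    rw [add_zero] at h
    exact left_eq_add.1 h
  mul_zero a := by
    have h := left_distrib_ambient a 0 0
    rw [add_zero] at h
    exact left_eq_add.1 h
  mul_assoc := mul_assoc_ambient

instance : StarRing 𝔢.Ambient where
  star_involutive := star_star_ambient
  star_mul := star_mul_ambient
  star_add := star_add_ambient

instance : IsScalarTower ℂ 𝔢.Ambient 𝔢.Ambient := ⟨smul_mul_ambient⟩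
instance : SMulCommClass ℂ 𝔢.Ambient 𝔢.Ambient := ⟨fun c a b => (mul_smul_ambient c a b).symm⟩
instance : StarModule ℂ 𝔢.Ambient := ⟨star_smul_ambient⟩

variable (𝔢)

/-- The algebraic twisted Roe algebra at infinity: the `*`-algebra of the classes of the sequences
that satisfy these conditions. (Up to equivalence, this set of classes is closed under the
operations. We take the `*`-subalgebra that it generates.) -/
def twistedAlgebra : NonUnitalStarSubalgebra ℂ 𝔢.Ambient :=
  NonUnitalStarAlgebra.adjoin ℂ {c | ∃ T : 𝔢.Pre, 𝔢.Admissible T.1 ∧ 𝔢.cls T = c}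

/-! ### The two norms -/

/-- The sequences of matrices, with entries in the algebras `A(V_n) ⊗ K`, that represent the elements
of the completion of the algebraic twisted Roe algebra in the norm `limsup_n ‖T⁽ⁿ⁾‖_{E_n}`. -/
def InB (S : MatSeq X H) : Prop :=
  (∀ n x y, S n x y ∈ coeffAlg (𝔢.V n)) ∧
    ∀ ε > 0, ∃ T : 𝔢.Pre, 𝔢.cls T ∈ 𝔢.twistedAlgebra ∧
      ∀ᶠ n in atTop, 𝔢.OpBound n (S n - T.1 n) ε

/-- The ghost elements. -/
def IsGhost (S : MatSeq X H) : Prop :=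
  𝔢.InB S ∧ ∀ R > 0, ∀ ε > 0, ∀ᶠ n in atTop, ∀ x y : X n,
    𝔢.OpBound n (fun a b => if dist a x ≤ R ∧ dist b y ≤ R then S n a b else 0) ε

/-- The upper bounds of `sup_n ‖T⁽ⁿ⁾ + S⁽ⁿ⁾‖_{E_n}`, for the representatives `(T⁽ⁿ⁾)` of `c` and the
ghosts `(S⁽ⁿ⁾)`. The reduced norm of `c` is their infimum. -/
def reducedNormSet (c : 𝔢.twistedAlgebra) : Set ℝ :=
  {r | 0 ≤ r ∧ ∃ T : 𝔢.Pre, 𝔢.cls T = c ∧ ∃ S, 𝔢.IsGhost S ∧ ∀ n, 𝔢.OpBound n (T.1 n + S n) r}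

/-- The norms `‖φ(c)‖`, for the `*`-representations `φ` of the algebraic twisted Roe algebra on
Hilbert spaces. The maximal norm of `c` is their supremum. -/
def maxNormSet (c : 𝔢.twistedAlgebra) : Set ℝ :=
  {r | ∃ (K : Type (max u v)) (_ : NormedAddCommGroup K) (_ : InnerProductSpace ℂ K)
    (_ : CompleteSpace K) (φ : 𝔢.twistedAlgebra →⋆ₙₐ[ℂ] (K →L[ℂ] K)), r = ‖φ c‖}

variable {𝔢} in
/-- The canonical quotient map between the completions of the algebraic twisted Roe algebra, which
extends its identity map. -/
def canonicalQuotient (pmax pred : CStarSeminorm 𝔢.twistedAlgebra) (hle : ∀ c, pred c ≤ pmax c) :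
    pmax.Completed →⋆ₙₐ[ℂ] pred.Completed :=
  CStarSeminorm.complMap (NonUnitalStarAlgHom.id ℂ 𝔢.twistedAlgebra) hle

end FibredCoarseEmbedding

end twisted

end

/-! Both norms turn out to be one and the same C⋆-seminorm `locNorm`, and the canonical quotient is
then the identity of a single completion. For a sequence T, a ball B(y, L) and a point p of ℝ₊ × H,
the matrix `loc` collects the entries of T over the ball, moved into the trivialisation at y and
evaluated at p. It is a finite matrix over the C⋆-algebra `Coeff H`. The seminorm is the least
asymptotic bound for these matrices: L is fixed, and then n is large. On a fixed ball the isometries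
t_{xy} compose for large n, so products and adjoints of sequences become products and adjoints of
matrices up to a cut-off at the boundary of the ball, and the C⋆-identity is inherited.

The mechanism behind everything is a support argument. The entries of row x are supported within r
of t_x(x)(s(x)). If rows x and x' are both nonzero at p in the trivialisation at y, then
t_y(x)(s(x)) and t_y(x')(s(x')) are less than 2r apart, and since ρ₋ tends to infinity, d(x, x') is
at most a constant D (`dist_le_of_norm_sub_pt_lt`). At each point T is therefore a matrix with all
nonzero rows in one ball of radius D, and with R its propagation its norm over any ball of radius at
most l_n is controlled by norms over balls of radius D + R (`TameAt.exists_norm_loc_le`).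

Reduced norm: the part of E_n with second variable y is a column on which T acts by `loc` over B(y,
l_n/2). Thus bounds on `loc` are bounds on E_n (`opBound_of_norm_loc_le`), with the zero ghost.
Conversely a ghost is small over balls of fixed radius and cannot lower the norms there, and columns
over A(V_n) ⊗ K are enough to detect the pointwise norm (`norm_evalMatrix_le`).

Maximal norm: the algebraic algebra itself, without completion, contains quasi-inverses. If `locNorm
a < 1`, then b = a + ab has a solution (`exists_eq_add_mul`). Row x of b is row x of a geometric
series formed pointwise in the trivialisation at x from the rows over B(x, D). By the support
argument these local series fit together (`geomSum_transport_apply`), and propagation, locality,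
support and Lipschitz constants stay bounded however long the partial sums are. Hence every
representation is contractive for `locNorm`. The GNS construction on the completion gives the
opposite inequality.

For this the algebra needs a description that survives such series. It consists of the classes of
`Tame` sequences (`mem_twistedAlgebra_iff`), whose entries are uniformly Lipschitz, of bounded
support, and satisfy `MemCoeff`, an equivariance condition that characterises Bott images. Bounded
derivatives give Lipschitz bounds by the mean value inequality. Conversely a Lipschitz entry is
approximated by finite sums of elementary tensors through a smooth lattice partition of unity, with
a derivative bound that depends only on the dimension and the Lipschitz constant
(`MemCoeff.exists_approximation`); bounded geometry bounds the dimension. -/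

noncomputable section

set_option linter.unusedSectionVars false

/-! ### Matrices over a C⋆-algebra: cut-offs and columns -/

namespace CStarMatrix

variable {ι A : Type*} [Fintype ι] [NonUnitalCStarAlgebra A] [PartialOrder A] [StarOrderedRing A]

theorem norm_le_sum_norm (M : CStarMatrix ι ι A) : ‖M‖ ≤ ∑ j, ∑ i, ‖M i j‖ := by
  rw [norm_def]
  refine (toCLM M).opNorm_le_bound (by positivity) fun v => ?_
  simp only [toCLM_apply_eq_sum, Finset.sum_mul]
  refine (WithCStarModule.pi_norm_le_sum_norm _).trans ?_
  gcongr with i _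
  refine (norm_sum_le _ _).trans ?_
  gcongr with j _
  refine (norm_mul_le _ _).trans ?_
  rw [mul_comm]
  gcongr
  exact WithCStarModule.norm_apply_le_norm v j

/-- The matrix `M` with the columns outside `Q` replaced by zero. -/
def colCut (Q : ι → Prop) [DecidablePred Q] (M : CStarMatrix ι ι A) : CStarMatrix ι ι A :=
  ofMatrix fun i j => if Q j then M i j else 0

/-- The matrix `M` with the rows outside `P` replaced by zero. -/
def rowCut (P : ι → Prop) [DecidablePred P] (M : CStarMatrix ι ι A) : CStarMatrix ι ι A :=
  ofMatrix fun i j => if P i then M i j else 0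

theorem colCut_apply (Q : ι → Prop) [DecidablePred Q] (M : CStarMatrix ι ι A) (i j : ι) :
    colCut Q M i j = if Q j then M i j else 0 := rfl

theorem rowCut_apply (P : ι → Prop) [DecidablePred P] (M : CStarMatrix ι ι A) (i j : ι) :
    rowCut P M i j = if P i then M i j else 0 := rfl

/-- M M* is the sum of the two positive contributions of the kept and of the removed columns, and
dropping a positive summand does not raise the norm. -/
theorem norm_colCut_le (Q : ι → Prop) [DecidablePred Q] (M : CStarMatrix ι ι A) :
    ‖colCut Q M‖ ≤ ‖M‖ := by
  have h : M * star M = colCut Q M * star (colCut Q M)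
      + colCut (fun j => ¬ Q j) M * star (colCut (fun j => ¬ Q j) M) := by
    ext i j
    simp only [add_apply, mul_apply, star_apply, colCut_apply, ← Finset.sum_add_distrib]
    refine Finset.sum_congr rfl fun k _ => ?_
    by_cases hk : Q k <;> simp [hk]
  have h2 : ‖colCut Q M * star (colCut Q M)‖ ≤ ‖M * star M‖ := by
    refine CStarAlgebra.norm_le_norm_of_nonneg_of_le (mul_star_self_nonneg _) ?_
    rw [h]
    exact le_add_of_nonneg_right (mul_star_self_nonneg _)
  rw [CStarRing.norm_self_mul_star, CStarRing.norm_self_mul_star] at h2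
  exact le_of_sq_le_sq (by rwa [sq, sq]) (norm_nonneg _)

theorem star_rowCut (P : ι → Prop) [DecidablePred P] (M : CStarMatrix ι ι A) :
    star (rowCut P M) = colCut P (star M) := by
  ext i j
  simp only [star_apply, rowCut_apply, colCut_apply]
  split_ifs <;> simp

theorem norm_rowCut_le (P : ι → Prop) [DecidablePred P] (M : CStarMatrix ι ι A) :
    ‖rowCut P M‖ ≤ ‖M‖ := by
  rw [← norm_star, star_rowCut, ← norm_star M]
  exact norm_colCut_le P _

variable {B : Type*} [NonUnitalCStarAlgebra B] [PartialOrder B] [StarOrderedRing B]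

theorem norm_map_le (f : A →⋆ₙₐ[ℂ] B) (M : CStarMatrix ι ι A) : ‖M.map f‖ ≤ ‖M‖ :=
  NonUnitalStarAlgHom.norm_apply_le (mapₙₐ (n := ι) f) M

/-- A positive matrix is a sum of matrices N* N, whose diagonal entries are sums of squares. This
allows inequalities between matrices to be read off on the diagonal. -/
theorem apply_nonneg {M : CStarMatrix ι ι A} (hM : 0 ≤ M) (i : ι) : 0 ≤ M i i := by
  rw [StarOrderedRing.nonneg_iff] at hM
  induction hM using AddSubmonoid.closure_induction with
  | mem M hM =>
    obtain ⟨N, rfl⟩ := hM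
    simp only [mul_apply, star_apply]
    exact Finset.sum_nonneg fun j _ => star_mul_self_nonneg _
  | zero => exact le_rfl
  | add M N _ _ hM hN => exact add_nonneg hM hN

/-- The matrix with the column `g` at the place `j` and zero elsewhere. -/
def ofCol [DecidableEq ι] (j : ι) (g : ι → A) : CStarMatrix ι ι A :=
  ofMatrix fun i k => if k = j then g i else 0

theorem ofCol_apply [DecidableEq ι] (j : ι) (g : ι → A) (i k : ι) :
    ofCol j g i k = if k = j then g i else 0 := rfl

theorem mul_ofCol [DecidableEq ι] (M : CStarMatrix ι ι A) (j : ι) (g : ι → A) :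
    M * ofCol j g = ofCol j fun i => ∑ z, M i z * g z := by
  ext i k
  rw [mul_apply, ofCol_apply]
  split_ifs with h <;> simp [ofCol_apply, h]

theorem star_ofCol_mul_ofCol_apply [DecidableEq ι] (j : ι) (g : ι → A) :
    (star (ofCol j g) * ofCol j g) j j = ∑ i, star (g i) * g i := by
  rw [mul_apply]
  simp [star_apply, ofCol_apply]

theorem norm_ofCol_sq [DecidableEq ι] (j : ι) (g : ι → A) :
    ‖ofCol j g‖ ^ 2 = ‖∑ i, star (g i) * g i‖ := by
  rw [sq, ← CStarRing.norm_star_mul_self]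
  apply le_antisymm
  · refine (norm_le_sum_norm _).trans ?_
    rw [Finset.sum_eq_single j, Finset.sum_eq_single j, star_ofCol_mul_ofCol_apply]
    · intro i _ hi
      rw [mul_apply, norm_eq_zero]
      exact Finset.sum_eq_zero fun k _ => by simp [star_apply, ofCol_apply, hi]
    · simp
    · intro i _ hi
      refine Finset.sum_eq_zero fun k _ => ?_
      rw [mul_apply, norm_eq_zero]
      exact Finset.sum_eq_zero fun k _ => by simp [ofCol_apply, hi]
    · simp
  · rw [← star_ofCol_mul_ofCol_apply j]
    exact norm_entry_le_norm

/-- With g placed in a single column N, this is a diagonal entry of N* M* M N ≤ ‖M* M‖ N* N. Being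
an inequality of algebra elements rather than of norms, it can later be summed over many columns. -/
theorem sum_star_mul_le (M : CStarMatrix ι ι A) {r : ℝ} (hr : ‖M‖ ≤ r) (g : ι → A) :
    ∑ i, star (∑ z, M i z * g z) * (∑ z, M i z * g z) ≤ r ^ 2 • ∑ i, star (g i) * g i := by
  classical
  rcases isEmpty_or_nonempty ι with h | ⟨⟨j⟩⟩
  · simp
  have h1 : star (M * ofCol j g) * (M * ofCol j g)
      ≤ ‖star M * M‖ • (star (ofCol j g) * ofCol j g) := by
    rw [star_mul, mul_assoc, ← mul_assoc (star M), ← mul_assoc]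
    exact CStarAlgebra.star_left_conjugate_le_norm_smul
  have h2 := apply_nonneg (sub_nonneg.2 h1) j
  rw [sub_apply, smul_apply, star_ofCol_mul_ofCol_apply, mul_ofCol, star_ofCol_mul_ofCol_apply,
    sub_nonneg, CStarRing.norm_star_mul_self] at h2
  refine h2.trans (smul_le_smul_of_nonneg_right ?_ ?_)
  · nlinarith [norm_nonneg M]
  · exact Finset.sum_nonneg fun i _ => star_mul_self_nonneg _

end CStarMatrix

/-! ### Norm-attaining states and representations -/

section representations

open scoped ComplexOrder

/-- A state of a unital C⋆-algebra that attains the norm of a nonnegative element. -/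
theorem CStarAlgebra.exists_positiveLinearMap_eq_norm {A : Type*} [CStarAlgebra A] [PartialOrder A]
    [StarOrderedRing A] [Nontrivial A] {x : A} (hx : 0 ≤ x) :
    ∃ f : A →ₚ[ℂ] ℂ, f 1 = 1 ∧ f x = (‖x‖ : ℂ) := by
  have hn : IsStarNormal x := (IsSelfAdjoint.of_nonneg hx).isStarNormal
  -- On the commutative algebra generated by x the required state is the character at the spectral
  -- point ‖x‖. Its real part is extended to all of A by the M. Riesz extension theorem.
  let C := StarAlgebra.elemental ℂ x
  have hC : IsClosed (C : Set A) := StarAlgebra.elemental.isClosed ℂ x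
  let x' : C := ⟨x, StarAlgebra.elemental.self_mem ℂ x⟩
  have hspec : (‖x‖ : ℂ) ∈ spectrum ℂ x' := by
    rw [StarSubalgebra.mem_spectrum_iff]
    exact spectrum.algebraMap_mem ℂ (norm_mem_spectrum_of_nonneg hx)
  obtain ⟨χ, hχ⟩ := WeakDual.CharacterSpace.mem_spectrum_iff_exists.1 hspec
  -- The cone is defined by the real part only. It contains every skew-adjoint element together with
  -- its negative, so that the extension vanishes on skew-adjoint elements.
  let s : PointedCone ℝ A :=
    { carrier := {y | 0 ≤ y + star y}
      add_mem' := fun {a b} ha hb => by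
        have : a + b + star (a + b) = (a + star a) + (b + star b) := by rw [star_add]; abel
        simp only [Set.mem_ofPred_eq] at ha hb ⊢
        rw [this]; exact add_nonneg ha hb
      zero_mem' := by simp
      smul_mem' := fun c a ha => by
        simp only [Set.mem_ofPred_eq] at ha ⊢
        have : c • a + star (c • a) = (c : ℝ) • (a + star a) := by
          have h : c • a = (c : ℝ) • a := rfl
          rw [h, star_smul, smul_add]; simp
        rw [this]
        exact smul_nonneg c.2 ha }
  let f0 : A →ₗ.[ℝ] ℝ :=
    { domain := (C.toSubalgebra.toSubmodule).restrictScalars ℝ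
      toFun := { toFun := fun y => (χ (⟨y.1, y.2⟩ : C)).re
                 map_add' := fun a b => by
                  rw [← Complex.add_re, ← map_add]; rfl
                 map_smul' := fun c a => by
                  have h : (⟨(c • a).1, (c • a).2⟩ : C) = (c : ℂ) • (⟨a.1, a.2⟩ : C) := by
                    apply Subtype.ext
                    change c • a.1 = (c : ℂ) • a.1
                    simp
                  rw [h, map_smul]; simp } }
  have hχpos : ∀ y : C, 0 ≤ (y : A) → 0 ≤ (χ y).re := by
    intro y hy
    have h1 : χ y ∈ spectrum ℂ y := AlgHom.apply_mem_spectrum χ y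
    rw [StarSubalgebra.mem_spectrum_iff] at h1
    exact (Complex.nonneg_iff.1 (spectrum_nonneg_of_nonneg hy h1)).1
  obtain ⟨g, hg, hgs⟩ := riesz_extension s f0 (by
    rintro ⟨y, hy⟩ hys
    change 0 ≤ (χ (⟨y, hy⟩ : C)).re
    have h1 := hχpos ((⟨y, hy⟩ : C) + star (⟨y, hy⟩ : C)) hys
    rw [map_add, map_star] at h1
    simp at h1
    linarith) (by
    intro y
    -- Scalars move any y into the cone, because y + y* ≥ -2‖y‖.
    refine ⟨⟨algebraMap ℂ A ‖y‖, C.algebraMap_mem _⟩, ?_⟩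
    change 0 ≤ (algebraMap ℂ A ‖y‖ + y) + star (algebraMap ℂ A ‖y‖ + y)
    have h1 := IsSelfAdjoint.neg_algebraMap_norm_le_self (IsSelfAdjoint.add_star_self y)
    have h2 : ‖y + star y‖ ≤ 2 * ‖y‖ := (norm_add_le _ _).trans (by rw [norm_star]; linarith)
    have h3 : algebraMap ℝ A ‖y + star y‖ ≤ algebraMap ℝ A (2 * ‖y‖) := by
      simpa using algebraMap_mono A h2
    have h4 : algebraMap ℂ A ‖y‖ = algebraMap ℝ A ‖y‖ := by
      rw [Algebra.algebraMap_eq_smul_one, Algebra.algebraMap_eq_smul_one]; simp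
    have h5 : (algebraMap ℝ A ‖y‖ + y) + star (algebraMap ℝ A ‖y‖ + y)
        = algebraMap ℝ A (2 * ‖y‖) + (y + star y) := by
      rw [star_add, two_mul, map_add]
      have : star (algebraMap ℝ A ‖y‖) = algebraMap ℝ A ‖y‖ := by
        rw [← algebraMap_star_comm]; simp
      rw [this]; abel
    rw [h4, h5]
    have h6 := add_le_add h3 h1
    rw [add_neg_cancel] at h6
    exact h6)
  have hskew : ∀ y : A, star y = -y → g y = 0 := by
    intro y hy
    refine le_antisymm ?_ (hgs y ?_)
    · have := hgs (-y) (by change 0 ≤ -y + star (-y); simp [hy])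
      rw [map_neg] at this
      linarith
    · change 0 ≤ y + star y; simp [hy]
  have hsa : ∀ y : A, star y = y → g (Complex.I • y) = 0 := fun y hy =>
    hskew _ (by rw [star_smul, hy]; simp)
  -- The complex-linear functional with real part g; on self-adjoint elements it equals g.
  let F : A →ₗ[ℂ] ℂ :=
    { toFun := fun y => (g y : ℂ) - Complex.I * (g (Complex.I • y) : ℂ)
      map_add' := fun a b => by rw [smul_add, map_add, map_add]; push_cast; ring
      map_smul' := fun c a => by
        have h1 : ∀ z : A, ∀ c : ℂ, g (c • z) = c.re * g z + c.im * g (Complex.I • z) := by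
          intro z c
          have : c • z = c.re • z + c.im • (Complex.I • z) := by
            conv_lhs => rw [← Complex.re_add_im c, add_smul, mul_smul]
            simp
          rw [this, map_add, map_smul, map_smul]; simp
        have h2 : g (Complex.I • c • a) = c.re * g (Complex.I • a) - c.im * g a := by
          rw [smul_smul, h1]; simp; ring
        rw [h2, h1 a c]
        apply Complex.ext
        · simp
        · simp; ring }
  have hF : ∀ y : A, star y = y → F y = (g y : ℂ) := by
    intro y hy
    change (g y : ℂ) - Complex.I * (g (Complex.I • y) : ℂ) = _
    rw [hsa y hy]; simp
  refine ⟨PositiveLinearMap.mk₀ F ?_, ?_, ?_⟩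
  · intro y hy
    rw [hF y (IsSelfAdjoint.of_nonneg hy)]
    have : 0 ≤ g y := hgs y (by
      change 0 ≤ y + star y
      rw [(IsSelfAdjoint.of_nonneg hy).star_eq]; exact add_nonneg hy hy)
    exact_mod_cast this
  · change F 1 = 1
    rw [hF 1 (star_one _)]
    have h1 := hg ⟨1, C.one_mem⟩
    have h2 : f0 ⟨1, C.one_mem⟩ = (χ (1 : C)).re := rfl
    have h3 : g 1 = 1 := by
      rw [h2] at h1
      refine h1.trans ?_
      rw [map_one χ, Complex.one_re]
    simp [h3]
  · change F x = _
    rw [hF x (IsSelfAdjoint.of_nonneg hx)]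
    have h1 := hg ⟨x, x'.2⟩
    have h2 : f0 ⟨x, x'.2⟩ = (χ x').re := rfl
    rw [h2, hχ] at h1
    have h3 : g x = ‖x‖ := by simpa using h1
    simp [h3]

/-- Every element of a C⋆-algebra has a representation on a Hilbert space which preserves its norm. -/
theorem NonUnitalCStarAlgebra.exists_representation_norm_eq (A : Type u) [NonUnitalCStarAlgebra A]
    (a : A) : ∃ (K : Type u) (_ : NormedAddCommGroup K) (_ : InnerProductSpace ℂ K)
      (_ : CompleteSpace K) (φ : A →⋆ₙₐ[ℂ] (K →L[ℂ] K)), ‖φ a‖ = ‖a‖ := by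
  let U := Unitization ℂ A
  let _ : PartialOrder U := CStarAlgebra.spectralOrder U
  have : StarOrderedRing U := CStarAlgebra.spectralOrderedRing U
  -- With f a state attaining the norm of a* a, the GNS vector of 1 is a unit vector that a sends to
  -- a vector of squared norm f(a* a) = ‖a‖².
  obtain ⟨f, hf1, hfx⟩ := CStarAlgebra.exists_positiveLinearMap_eq_norm
    (star_mul_self_nonneg (a : U))
  refine ⟨f.GNS, inferInstance, inferInstance, inferInstance,
    f.gnsNonUnitalStarAlgHom.comp (Unitization.inrNonUnitalStarAlgHom ℂ A), ?_⟩
  refine le_antisymm (NonUnitalStarAlgHom.norm_apply_le _ a) ?_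
  have h1 : ‖f.toPreGNS (1 : U)‖ = 1 := by
    have h := f.preGNS_norm_sq (f.toPreGNS (1 : U))
    simp only [f.ofPreGNS_toPreGNS, star_one, mul_one, hf1] at h
    have h' : ‖f.toPreGNS (1 : U)‖ ^ 2 = 1 := by exact_mod_cast h
    nlinarith [norm_nonneg (f.toPreGNS (1 : U))]
  have h2 : ‖f.leftMulMapPreGNS (a : U) (f.toPreGNS 1)‖ = ‖a‖ := by
    have h := f.preGNS_norm_sq (f.leftMulMapPreGNS (a : U) (f.toPreGNS 1))
    simp only [f.leftMulMapPreGNS_apply, f.ofPreGNS_toPreGNS, mul_one, hfx] at h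
    have h' : ‖f.toPreGNS (a : U)‖ ^ 2 = ‖star (a : U) * (a : U)‖ := by exact_mod_cast h
    rw [CStarRing.norm_star_mul_self, Unitization.norm_inr] at h'
    have h3 : ‖f.toPreGNS (a : U)‖ = ‖a‖ := by
      nlinarith [norm_nonneg (f.toPreGNS (a : U)), norm_nonneg a]
    simpa using h3
  have h3 := (f.gnsNonUnitalStarAlgHom (a : U)).le_opNorm ((f.toPreGNS 1 : f.PreGNS) : f.GNS)
  rw [f.gnsNonUnitalStarAlgHom_apply_coe, Completion.norm_coe, Completion.norm_coe, h1, h2,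
    mul_one] at h3
  exact h3

end representations

end

noncomputable section

set_option linter.unusedSectionVars false

/-- The adjoint of a compact operator on a Hilbert space is compact. -/
protected theorem IsCompactOperator.star {K : Type*} [NormedAddCommGroup K] [InnerProductSpace ℂ K]
    [CompleteSpace K] {T : K →L[ℂ] K} (hT : IsCompactOperator T) :
    IsCompactOperator (Star.star T : K →L[ℂ] K) := by
  have hTT : IsCompactOperator (T * Star.star T : K →L[ℂ] K) := hT.comp_clm (Star.star T)
  refine (isCompactOperator_iff_isCompact_closure_image_closedBall
    (Star.star T : K →L[ℂ] K).toLinearMap one_pos).2 ?_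
  refine (TotallyBounded.closure ?_).isCompact_of_isClosed isClosed_closure
  have h1 : TotallyBounded ((T * Star.star T : K →L[ℂ] K) '' Metric.closedBall 0 1) :=
    ((hTT.isCompact_closure_image_closedBall (f := (T * Star.star T : K →L[ℂ] K).toLinearMap)
      1).totallyBounded).subset subset_closure
  rw [Metric.totallyBounded_iff]
  intro ε hε
  -- From ‖T* z‖² ≤ ‖T T* z‖ ‖z‖ and ‖z‖ ≤ 2 for differences z of points in the unit ball, an
  -- ε²/2-net for the image under T T* yields an ε-net for the image under T*.
  obtain ⟨t, ht, htf, hcov⟩ := Metric.finite_approx_of_totallyBounded h1 (ε ^ 2 / 2) (by positivity)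
  obtain ⟨t', ht', htf', rfl⟩ := Set.exists_subset_image_finite_and.1 ⟨t, ht, htf, rfl⟩
  refine ⟨(Star.star T : K →L[ℂ] K) '' t', htf'.image _, ?_⟩
  rintro _ ⟨x, hx, rfl⟩
  obtain ⟨_, ⟨y, hy, rfl⟩, hxy⟩ := Set.mem_iUnion₂.1 (hcov ⟨x, hx, rfl⟩)
  refine Set.mem_iUnion₂.2 ⟨_, ⟨y, hy, rfl⟩, ?_⟩
  rw [Metric.mem_ball, dist_eq_norm, ← map_sub] at hxy
  change dist ((Star.star T : K →L[ℂ] K) x) ((Star.star T : K →L[ℂ] K) y) < ε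
  rw [dist_eq_norm, ← map_sub]
  have h2 : ‖(Star.star T : K →L[ℂ] K) (x - y)‖ ^ 2 ≤ ‖(T * Star.star T : K →L[ℂ] K) (x - y)‖ * ‖x - y‖ := by
    have h3 : inner ℂ ((T * Star.star T : K →L[ℂ] K) (x - y)) (x - y)
        = ((‖(Star.star T : K →L[ℂ] K) (x - y)‖ : ℂ)) ^ 2 := by
      have h := inner_self_eq_norm_sq_to_K (𝕜 := ℂ) ((Star.star T : K →L[ℂ] K) (x - y))
      exact (ContinuousLinearMap.adjoint_inner_right T _ _).symm.trans h
    have h4 := norm_inner_le_norm (𝕜 := ℂ) ((T * Star.star T : K →L[ℂ] K) (x - y)) (x - y)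
    rw [h3] at h4
    simpa using h4
  have h5 : ‖x - y‖ ≤ 2 := by
    have hx' : ‖x‖ ≤ 1 := by simpa using hx
    have hy' : ‖y‖ ≤ 1 := by simpa using ht' hy
    linarith [norm_sub_le x y]
  refine lt_of_pow_lt_pow_left₀ 2 hε.le (h2.trans_lt ?_)
  have h6 : ‖(T * Star.star T : K →L[ℂ] K) (x - y)‖ * ‖x - y‖
      ≤ ‖(T * Star.star T : K →L[ℂ] K) (x - y)‖ * 2 := by gcongr
  linarith

/-! ### The coefficient algebra: Clifford generators and compact operators -/

namespace Coeff

open scoped TensorProduct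

variable {H : Type*} [NormedAddCommGroup H] [InnerProductSpace ℝ H]

instance : PartialOrder (Coeff H) := CStarAlgebra.spectralOrder _
instance : StarOrderedRing (Coeff H) := CStarAlgebra.spectralOrderedRing _

/-- The canonical map of `B(ℓ²) ⊗ Cliff_ℂ(ℝ ⊕ H)` into its completion. -/
def ofAlg (a : CliffOp (CliffSpace H)) : Coeff H :=
  CStarSeminorm.Completed.of (cliffSeminorm (CliffSpace H)) a

theorem ofAlg_add (a b : CliffOp (CliffSpace H)) : ofAlg (a + b) = ofAlg a + ofAlg b :=
  CStarSeminorm.Completed.of_add a b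
theorem ofAlg_smul (c : ℂ) (a : CliffOp (CliffSpace H)) : ofAlg (c • a) = c • ofAlg a :=
  CStarSeminorm.Completed.of_smul c a
theorem ofAlg_mul (a b : CliffOp (CliffSpace H)) : ofAlg (a * b) = ofAlg a * ofAlg b :=
  CStarSeminorm.Completed.of_mul a b
theorem ofAlg_star (a : CliffOp (CliffSpace H)) : ofAlg (star a) = star (ofAlg a) :=
  CStarSeminorm.Completed.of_star a

theorem ofAlg_one_mul (x : Coeff H) : ofAlg 1 * x = x := by
  induction x using Coeff.ind with
  | hc => exact isClosed_eq (continuous_const.mul continuous_id) continuous_id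
  | h a =>
    change ofAlg 1 * ofAlg a = ofAlg a
    rw [← ofAlg_mul, one_mul]

theorem mul_ofAlg_one (x : Coeff H) : x * ofAlg 1 = x := by
  induction x using Coeff.ind with
  | hc => exact isClosed_eq (continuous_id.mul continuous_const) continuous_id
  | h a =>
    change ofAlg a * ofAlg 1 = ofAlg a
    rw [← ofAlg_mul, mul_one]

theorem op_eq (b : HilbertOp) : (op b : Coeff H) = ofAlg (b ⊗ₜ[ℝ] 1) := rfl

theorem op_mul (b b' : HilbertOp) : (op (b * b') : Coeff H) = op b * op b' := by
  rw [op_eq, op_eq, op_eq, ← ofAlg_mul, Algebra.TensorProduct.tmul_mul_tmul, one_mul]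

theorem star_op (b : HilbertOp) : star (op b : Coeff H) = op (star b) := by
  rw [op_eq, op_eq, ← ofAlg_star, TensorProduct.star_tmul, star_one]

theorem commute_op_ofAlg (b : HilbertOp) (a : CliffordAlgebra (negNormSq (CliffSpace H))) :
    op b * ofAlg (1 ⊗ₜ[ℝ] a) = ofAlg (1 ⊗ₜ[ℝ] a) * op b := by
  rw [op_eq, ← ofAlg_mul, ← ofAlg_mul, Algebra.TensorProduct.tmul_mul_tmul,
    Algebra.TensorProduct.tmul_mul_tmul]
  simp

/-! ### Isometries -/

/-- The isometries of `ℝ ⊕ H`. -/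
abbrev Isom (H : Type*) [NormedAddCommGroup H] [InnerProductSpace ℝ H] : Type _ :=
  negNormSq (CliffSpace H) →qᵢ negNormSq (CliffSpace H)

/-- The `*`-endomorphism induced by an isometry of `ℝ ⊕ H`. -/
def lin (A : Isom H) : Coeff H →⋆ₙₐ[ℂ] Coeff H :=
  CStarSeminorm.complMap (cliffMap A) (cliffMap_le A)

theorem map_eq_lin (e : H ≃ₗᵢ[ℝ] H) : Coeff.map e = lin (cliffIso e) := rfl

theorem lin_ofAlg (A : Isom H) (a : CliffOp (CliffSpace H)) :
    lin A (ofAlg a) = ofAlg (cliffMap A a) := CStarSeminorm.complMap_of _ _ a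

theorem continuous_lin (A : Isom H) : Continuous (lin A) :=
  CStarSeminorm.continuous_complMap (cliffMap A) (cliffMap_le A)

theorem norm_lin_le (A : Isom H) (a : Coeff H) : ‖lin A a‖ ≤ ‖a‖ :=
  NonUnitalStarAlgHom.norm_apply_le (lin A) a

theorem lin_lin (A B : Isom H) (x : Coeff H) : lin A (lin B x) = lin (A.comp B) x := by
  induction x using Coeff.ind with
  | hc =>
    exact isClosed_eq ((continuous_lin A).comp (continuous_lin B)) (continuous_lin _)
  | h a =>
    change lin A (lin B (ofAlg a)) = lin _ (ofAlg a)
    rw [lin_ofAlg, lin_ofAlg, lin_ofAlg, ← cliffMap_comp]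

theorem norm_isom (A : Isom H) (x : CliffSpace H) : ‖A x‖ = ‖x‖ := by
  have h := A.map_app x
  rw [negNormSq_apply, negNormSq_apply, neg_inj] at h
  exact (sq_eq_sq₀ (norm_nonneg _) (norm_nonneg _)).1 h

/-- The isometry of `ℝ ⊕ H` underlying a linear isometry. -/
def isomOf (f : CliffSpace H →ₗᵢ[ℝ] CliffSpace H) : Isom H where
  __ := f.toLinearMap
  map_app' x := by
    rw [negNormSq_apply, negNormSq_apply]
    exact congrArg (fun t : ℝ => -t ^ 2) (f.norm_map x)

theorem isomOf_apply (f : CliffSpace H →ₗᵢ[ℝ] CliffSpace H) (x : CliffSpace H) :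
    isomOf f x = f x := rfl

/-! ### Clifford generators -/

/-- The self-adjoint Clifford generator of a vector of `ℝ ⊕ H`. -/
def cgen (x : CliffSpace H) : Coeff H := ofAlg (cliffGen x)

theorem cgen_add (x y : CliffSpace H) : cgen (x + y) = cgen x + cgen y := by
  rw [cgen, cgen, cgen, ← ofAlg_add, cliffGen, map_add, TensorProduct.tmul_add]; rfl

theorem cgen_smul (r : ℝ) (x : CliffSpace H) : cgen (r • x) = (r : ℂ) • cgen x := by
  rw [cgen, cgen, ← ofAlg_smul, cliffGen, map_smul, TensorProduct.tmul_smul,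
    TensorProduct.smul_tmul', cliffGen, TensorProduct.smul_tmul']
  rfl

theorem cgen_sub (x y : CliffSpace H) : cgen (x - y) = cgen x - cgen y := by
  rw [sub_eq_add_neg, cgen_add, ← neg_one_smul ℝ y, cgen_smul]
  simp [sub_eq_add_neg]

theorem star_cgen (x : CliffSpace H) : star (cgen x) = cgen x := by
  rw [cgen, ← ofAlg_star, star_cliffGen]

theorem norm_cgen_le (x : CliffSpace H) : ‖cgen x‖ ≤ ‖x‖ :=
  (CStarSeminorm.Completed.norm_of (p := cliffSeminorm (CliffSpace H)) _).trans_le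
    ((cliffSeminorm (CliffSpace H)).apply_cliffGen_le x)

theorem cgen_mul_cgen_mul (x : CliffSpace H) (a : Coeff H) :
    cgen x * (cgen x * a) = ((‖x‖ ^ 2 : ℝ) : ℂ) • a := by
  rw [← mul_assoc, cgen, ← ofAlg_mul, cliffGen_mul_self, ofAlg_smul, smul_mul_assoc, ofAlg_one_mul]

theorem mul_cgen_mul_cgen (x : CliffSpace H) (a : Coeff H) :
    a * cgen x * cgen x = ((‖x‖ ^ 2 : ℝ) : ℂ) • a := by
  rw [mul_assoc, cgen, ← ofAlg_mul, cliffGen_mul_self, ofAlg_smul, mul_smul_comm, mul_ofAlg_one]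

theorem lin_cgen (A : Isom H) (x : CliffSpace H) : lin A (cgen x) = cgen (A x) := by
  rw [cgen, lin_ofAlg, cliffGen, cliffMap_tmul, CliffordAlgebra.map_apply_ι]; rfl

theorem lin_op (A : Isom H) (b : HilbertOp) : lin A (op b) = op b := by
  rw [op_eq, lin_ofAlg, cliffMap_tmul, map_one]

theorem continuous_cgen : Continuous (cgen : CliffSpace H → Coeff H) :=
  (LipschitzWith.of_dist_le_mul (K := 1) fun x y => by
    rw [dist_eq_norm, dist_eq_norm, ← cgen_sub, NNReal.coe_one, one_mul]
    exact norm_cgen_le _).continuous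

theorem commute_op_cgen (b : HilbertOp) (x : CliffSpace H) : op b * cgen x = cgen x * op b := by
  have : cgen x = Complex.I • ofAlg ((1 : HilbertOp) ⊗ₜ[ℝ] CliffordAlgebra.ι (negNormSq _) x) := by
    rw [← ofAlg_smul, TensorProduct.smul_tmul']; rfl
  rw [this, mul_smul_comm, smul_mul_assoc, commute_op_ofAlg]

/-! ### The algebras `K ⊗ Cliff_ℂ(V⁰)` -/

/-- The real Clifford algebra of a subspace of `H`. -/
def cliffR (V₀ : Submodule ℝ H) : Subalgebra ℝ (CliffordAlgebra (negNormSq (CliffSpace H))) :=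
  Algebra.adjoin ℝ
    {b | ∃ v ∈ V₀, b = CliffordAlgebra.ι (negNormSq (CliffSpace H)) (WithLp.toLp 2 (0, v))}

theorem cliff_eq (V₀ : Submodule ℝ H) :
    cliff V₀ = Submodule.span ℂ {c | ∃ a ∈ cliffR V₀, c = ofAlg ((1 : HilbertOp) ⊗ₜ[ℝ] a)} := rfl

theorem mem_cliff {V₀ : Submodule ℝ H} {a : CliffordAlgebra (negNormSq (CliffSpace H))}
    (ha : a ∈ cliffR V₀) : ofAlg ((1 : HilbertOp) ⊗ₜ[ℝ] a) ∈ cliff V₀ :=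
  Submodule.subset_span ⟨a, ha, rfl⟩

theorem cliff_induction {V₀ : Submodule ℝ H} {P : ∀ x : Coeff H, x ∈ cliff V₀ → Prop}
    (h : ∀ a (ha : a ∈ cliffR V₀), P (ofAlg ((1 : HilbertOp) ⊗ₜ[ℝ] a)) (mem_cliff ha))
    (h0 : P 0 (zero_mem _)) (hadd : ∀ x y hx hy, P x hx → P y hy → P (x + y) (add_mem hx hy))
    (hsmul : ∀ (c : ℂ) x hx, P x hx → P (c • x) (Submodule.smul_mem _ c hx)) {x : Coeff H}
    (hx : x ∈ cliff V₀) : P x hx := by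
  induction hx using Submodule.span_induction with
  | mem x hx => obtain ⟨a, ha, rfl⟩ := hx; exact h a ha
  | zero => exact h0
  | add x y _ _ hx hy => exact hadd _ _ _ _ hx hy
  | smul c x _ hx => exact hsmul _ _ _ hx

theorem cliff_mul_mem {V₀ : Submodule ℝ H} {x y : Coeff H} (hx : x ∈ cliff V₀) (hy : y ∈ cliff V₀) :
    x * y ∈ cliff V₀ := by
  induction hx using cliff_induction with
  | h a ha =>
    induction hy using cliff_induction with
    | h b hb =>
      rw [← ofAlg_mul, Algebra.TensorProduct.tmul_mul_tmul, one_mul]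
      exact mem_cliff (mul_mem ha hb)
    | h0 => simp
    | hadd x y _ _ hx hy => rw [mul_add]; exact add_mem hx hy
    | hsmul c x _ hx => rw [mul_smul_comm]; exact Submodule.smul_mem _ _ hx
  | h0 => simp
  | hadd x y _ _ hx hy => rw [add_mul]; exact add_mem hx hy
  | hsmul c x _ hx => rw [smul_mul_assoc]; exact Submodule.smul_mem _ _ hx

theorem cliffR_star_mem {V₀ : Submodule ℝ H} {a : CliffordAlgebra (negNormSq (CliffSpace H))}
    (ha : a ∈ cliffR V₀) : star a ∈ cliffR V₀ := by
  induction ha using Algebra.adjoin_induction with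
  | mem x hx =>
    obtain ⟨v, hv, rfl⟩ := hx
    rw [CliffordAlgebra.star_ι]
    exact neg_mem (Algebra.subset_adjoin ⟨v, hv, rfl⟩)
  | algebraMap r => rw [CliffordAlgebra.star_algebraMap]; exact Subalgebra.algebraMap_mem _ r
  | add x y _ _ hx hy => rw [star_add]; exact add_mem hx hy
  | mul x y _ _ hx hy => rw [star_mul]; exact mul_mem hy hx

theorem cliff_star_mem {V₀ : Submodule ℝ H} {x : Coeff H} (hx : x ∈ cliff V₀) :
    star x ∈ cliff V₀ := by
  induction hx using cliff_induction with
  | h a ha =>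
    rw [← ofAlg_star, TensorProduct.star_tmul, star_one]
    exact mem_cliff (cliffR_star_mem ha)
  | h0 => simp
  | hadd x y _ _ hx hy => rw [star_add]; exact add_mem hx hy
  | hsmul c x _ hx => rw [star_smul]; exact Submodule.smul_mem _ _ hx

theorem cliff_mono {V₀ W₀ : Submodule ℝ H} (h : V₀ ≤ W₀) : cliff V₀ ≤ cliff W₀ := by
  rw [cliff_eq, cliff_eq]
  refine Submodule.span_mono ?_
  rintro _ ⟨a, ha, rfl⟩
  refine ⟨a, Algebra.adjoin_mono ?_ ha, rfl⟩
  rintro _ ⟨v, hv, rfl⟩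
  exact ⟨v, h hv, rfl⟩

theorem cliff_commute_op {V₀ : Submodule ℝ H} {x : Coeff H} (hx : x ∈ cliff V₀) (b : HilbertOp) :
    op b * x = x * op b := by
  induction hx using cliff_induction with
  | h a ha => exact commute_op_ofAlg b a
  | h0 => simp
  | hadd x y _ _ hx hy => rw [add_mul, mul_add, hx, hy]
  | hsmul c x _ hx => rw [smul_mul_assoc, mul_smul_comm, hx]

theorem cgen_mem_cliff {V₀ : Submodule ℝ H} {u : H} (hu : u ∈ V₀) :
    gen 0 u ∈ cliff V₀ := by
  have : gen 0 u = Complex.I • ofAlg ((1 : HilbertOp) ⊗ₜ[ℝ]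
      CliffordAlgebra.ι (negNormSq (CliffSpace H)) (WithLp.toLp 2 (0, u))) := by
    rw [← ofAlg_smul, TensorProduct.smul_tmul']; rfl
  rw [this]
  exact Submodule.smul_mem _ _ (mem_cliff (Algebra.subset_adjoin ⟨u, hu, rfl⟩))

theorem cliff_lin_mem {V₀ W₀ : Submodule ℝ H} (A : Isom H)
    (hA : ∀ v ∈ V₀, ∃ w ∈ W₀, A (WithLp.toLp 2 (0, v)) = WithLp.toLp 2 (0, w)) {x : Coeff H}
    (hx : x ∈ cliff V₀) : lin A x ∈ cliff W₀ := by
  induction hx using cliff_induction with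
  | h a ha =>
    rw [lin_ofAlg, cliffMap_tmul]
    apply mem_cliff
    induction ha using Algebra.adjoin_induction with
    | mem x hx =>
      obtain ⟨v, hv, rfl⟩ := hx
      obtain ⟨w, hw, h⟩ := hA v hv
      rw [CliffordAlgebra.map_apply_ι, h]
      exact Algebra.subset_adjoin ⟨w, hw, rfl⟩
    | algebraMap r => rw [AlgHom.commutes]; exact Subalgebra.algebraMap_mem _ r
    | add x y _ _ hx hy => rw [map_add]; exact add_mem hx hy
    | mul x y _ _ hx hy => rw [map_mul]; exact mul_mem hx hy
  | h0 => simp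
  | hadd x y _ _ hx hy => rw [map_add]; exact add_mem hx hy
  | hsmul c x _ hx => rw [map_smul]; exact Submodule.smul_mem _ _ hx

/-- The isometry fixes the generators. Values in Cliff(V⁰) are thus invisible to isometries fixing
V⁰, which is the source of the equivariance of Bott images. -/
theorem cliff_lin_eq {V₀ : Submodule ℝ H} (A : Isom H)
    (hA : ∀ v ∈ V₀, A (WithLp.toLp 2 (0, v)) = WithLp.toLp 2 (0, v)) {x : Coeff H}
    (hx : x ∈ cliff V₀) : lin A x = x := by
  induction hx using cliff_induction with
  | h a ha =>
    rw [lin_ofAlg, cliffMap_tmul]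
    congr 2
    induction ha using Algebra.adjoin_induction with
    | mem x hx =>
      obtain ⟨v, hv, rfl⟩ := hx
      rw [CliffordAlgebra.map_apply_ι, hA v hv]
    | algebraMap r => rw [AlgHom.commutes]
    | add x y _ _ hx hy => rw [map_add, hx, hy]
    | mul x y _ _ hx hy => rw [map_mul, hx, hy]
  | h0 => simp
  | hadd x y _ _ hx hy => rw [map_add, hx, hy]
  | hsmul c x _ hx => rw [map_smul, hx]

/-- The first generator, `c(1, 0)`. -/
def γ : Coeff H := cgen (WithLp.toLp 2 (1, 0))

theorem norm_unit : ‖(WithLp.toLp 2 ((1 : ℝ), (0 : H)) : CliffSpace H)‖ = 1 := by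
  rw [← sq_eq_sq₀ (norm_nonneg _) zero_le_one, WithLp.prod_norm_sq_eq_of_L2]
  simp

theorem γ_mul_γ_mul (a : Coeff H) : γ * (γ * a) = a := by
  rw [γ, cgen_mul_cgen_mul, norm_unit]; simp

theorem mul_γ_mul_γ (a : Coeff H) : a * γ * γ = a := by
  rw [γ, mul_cgen_mul_cgen, norm_unit]; simp

theorem norm_γ_le : ‖(γ : Coeff H)‖ ≤ 1 := (norm_cgen_le _).trans norm_unit.le

theorem norm_γ_mul (a : Coeff H) : ‖γ * a‖ = ‖a‖ := by
  have h (b : Coeff H) : ‖γ * b‖ ≤ ‖b‖ :=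
    (norm_mul_le _ _).trans (by nlinarith [norm_γ_le (H := H), norm_nonneg b])
  refine le_antisymm (h a) ?_
  conv_lhs => rw [← γ_mul_γ_mul a]
  exact h _

theorem star_γ : star (γ : Coeff H) = γ := star_cgen _

theorem ι_anticomm (v : H) :
    CliffordAlgebra.ι (negNormSq (CliffSpace H)) (WithLp.toLp 2 (1, 0)) *
      CliffordAlgebra.ι (negNormSq (CliffSpace H)) (WithLp.toLp 2 (0, v))
    = -(CliffordAlgebra.ι (negNormSq (CliffSpace H)) (WithLp.toLp 2 (0, v)) *
      CliffordAlgebra.ι (negNormSq (CliffSpace H)) (WithLp.toLp 2 (1, 0))) := by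
  apply CliffordAlgebra.ι_mul_ι_comm_of_isOrtho
  rw [QuadraticMap.isOrtho_def, negNormSq_apply, negNormSq_apply, negNormSq_apply,
    WithLp.prod_norm_sq_eq_of_L2, WithLp.prod_norm_sq_eq_of_L2, WithLp.prod_norm_sq_eq_of_L2]
  simp
  ring

/-- γ anticommutes with the generators of Cliff(V⁰), so conjugation by γ is the grading
automorphism. It is needed to bring products and adjoints back to the form a + γ b. -/
theorem cliff_γ_conj {V₀ : Submodule ℝ H} {x : Coeff H} (hx : x ∈ cliff V₀) :
    γ * x * γ ∈ cliff V₀ := by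
  induction hx using cliff_induction with
  | h a ha =>
    induction ha using Algebra.adjoin_induction with
    | mem x hx =>
      obtain ⟨v, hv, rfl⟩ := hx
      have : (γ : Coeff H) * ofAlg ((1 : HilbertOp) ⊗ₜ[ℝ]
          CliffordAlgebra.ι (negNormSq (CliffSpace H)) (WithLp.toLp 2 (0, v)))
          = (-1 : ℂ) • (ofAlg ((1 : HilbertOp) ⊗ₜ[ℝ]
          CliffordAlgebra.ι (negNormSq (CliffSpace H)) (WithLp.toLp 2 (0, v))) * γ) := by
        rw [γ, cgen, cliffGen, ← ofAlg_mul, ← ofAlg_mul, Algebra.TensorProduct.tmul_mul_tmul,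
          ι_anticomm, ← ofAlg_smul, Algebra.TensorProduct.tmul_mul_tmul, TensorProduct.tmul_neg]
        simp
      rw [this, smul_mul_assoc, mul_γ_mul_γ]
      exact Submodule.smul_mem _ _ (mem_cliff (Algebra.subset_adjoin ⟨v, hv, rfl⟩))
    | algebraMap r =>
      have h1 : ofAlg ((1 : HilbertOp) ⊗ₜ[ℝ]
          algebraMap ℝ (CliffordAlgebra (negNormSq (CliffSpace H))) r) = (r : ℂ) • ofAlg 1 := by
        rw [← ofAlg_smul, Algebra.algebraMap_eq_smul_one, TensorProduct.tmul_smul,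
          TensorProduct.smul_tmul', Algebra.TensorProduct.one_def, TensorProduct.smul_tmul']
        rfl
      have h2 : γ * ofAlg ((1 : HilbertOp) ⊗ₜ[ℝ]
          algebraMap ℝ (CliffordAlgebra (negNormSq (CliffSpace H))) r) * γ
          = ofAlg ((1 : HilbertOp) ⊗ₜ[ℝ]
          algebraMap ℝ (CliffordAlgebra (negNormSq (CliffSpace H))) r) := by
        rw [h1, mul_smul_comm, smul_mul_assoc, mul_ofAlg_one, ← ofAlg_one_mul (γ * γ),
          ← mul_assoc, mul_γ_mul_γ]
      rw [h2]
      exact mem_cliff (Subalgebra.algebraMap_mem _ r)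
    | add x y _ _ hx hy =>
      rw [TensorProduct.tmul_add, ofAlg_add, mul_add, add_mul]; exact add_mem hx hy
    | mul x y _ _ hx hy =>
      have h1 : ofAlg ((1 : HilbertOp) ⊗ₜ[ℝ] (x * y))
          = ofAlg ((1 : HilbertOp) ⊗ₜ[ℝ] x) * ofAlg ((1 : HilbertOp) ⊗ₜ[ℝ] y) := by
        rw [← ofAlg_mul, Algebra.TensorProduct.tmul_mul_tmul, one_mul]
      have h2 := cliff_mul_mem hx hy
      rwa [h1, show γ * (ofAlg ((1 : HilbertOp) ⊗ₜ[ℝ] x) * ofAlg ((1 : HilbertOp) ⊗ₜ[ℝ] y)) * γ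
        = (γ * ofAlg ((1 : HilbertOp) ⊗ₜ[ℝ] x) * γ) * (γ * ofAlg ((1 : HilbertOp) ⊗ₜ[ℝ] y) * γ) by
        rw [mul_assoc γ _ γ, mul_assoc γ _ γ, mul_assoc, mul_assoc, mul_assoc, mul_assoc,
          γ_mul_γ_mul]]
  | h0 => simp
  | hadd x y _ _ hx hy => rw [mul_add, add_mul]; exact add_mem hx hy
  | hsmul c x _ hx => rw [mul_smul_comm, smul_mul_assoc]; exact Submodule.smul_mem _ _ hx

/-- The linear span of the elements `b κ`, with `b` in the Clifford algebra of `V⁰` and `κ` compact. -/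
def core (V₀ : Submodule ℝ H) : Submodule ℂ (Coeff H) :=
  Submodule.span ℂ {c | ∃ b ∈ cliff V₀, ∃ κ : HilbertOp, IsCompactOperator κ ∧ c = b * op κ}

/-- The C⋆-algebra `Cliff_ℂ(V⁰) ⊗ K`. -/
def cpt (V₀ : Submodule ℝ H) : Submodule ℂ (Coeff H) := (core V₀).topologicalClosure

theorem mem_core {V₀ : Submodule ℝ H} {b : Coeff H} (hb : b ∈ cliff V₀) {κ : HilbertOp}
    (hκ : IsCompactOperator κ) : b * op κ ∈ core V₀ := Submodule.subset_span ⟨b, hb, κ, hκ, rfl⟩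

theorem core_induction {V₀ : Submodule ℝ H} {P : ∀ x : Coeff H, x ∈ core V₀ → Prop}
    (h : ∀ b (hb : b ∈ cliff V₀) (κ : HilbertOp) (hκ : IsCompactOperator κ),
      P (b * op κ) (mem_core hb hκ)) (h0 : P 0 (zero_mem _))
    (hadd : ∀ x y hx hy, P x hx → P y hy → P (x + y) (add_mem hx hy))
    (hsmul : ∀ (c : ℂ) x hx, P x hx → P (c • x) (Submodule.smul_mem _ c hx)) {x : Coeff H}
    (hx : x ∈ core V₀) : P x hx := by
  induction hx using Submodule.span_induction with
  | mem x hx => obtain ⟨b, hb, κ, hκ, rfl⟩ := hx; exact h b hb κ hκ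
  | zero => exact h0
  | add x y _ _ hx hy => exact hadd _ _ _ _ hx hy
  | smul c x _ hx => exact hsmul _ _ _ hx

theorem core_le_cpt (V₀ : Submodule ℝ H) : core V₀ ≤ cpt V₀ := Submodule.le_topologicalClosure _

theorem mem_cpt_iff {V₀ : Submodule ℝ H} {x : Coeff H} :
    x ∈ cpt V₀ ↔ x ∈ closure (core V₀ : Set (Coeff H)) := Iff.rfl

theorem isClosed_cpt (V₀ : Submodule ℝ H) : IsClosed (cpt V₀ : Set (Coeff H)) :=
  Submodule.isClosed_topologicalClosure _

theorem core_mul_mem {V₀ : Submodule ℝ H} {x y : Coeff H} (hx : x ∈ core V₀) (hy : y ∈ core V₀) :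
    x * y ∈ core V₀ := by
  induction hx using core_induction with
  | h b hb κ hκ =>
    induction hy using core_induction with
    | h b' hb' κ' hκ' =>
      rw [mul_assoc, ← mul_assoc (op κ), cliff_commute_op hb', mul_assoc b', ← op_mul, ← mul_assoc]
      exact mem_core (cliff_mul_mem hb hb') (hκ.comp_clm κ')
    | h0 => simp
    | hadd x y _ _ hx hy => rw [mul_add]; exact add_mem hx hy
    | hsmul c x _ hx => rw [mul_smul_comm]; exact Submodule.smul_mem _ _ hx
  | h0 => simp
  | hadd x y _ _ hx hy => rw [add_mul]; exact add_mem hx hy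
  | hsmul c x _ hx => rw [smul_mul_assoc]; exact Submodule.smul_mem _ _ hx

theorem cpt_mul_mem {V₀ : Submodule ℝ H} {x y : Coeff H} (hx : x ∈ cpt V₀) (hy : y ∈ cpt V₀) :
    x * y ∈ cpt V₀ :=
  map_mem_closure₂ continuous_mul hx hy fun _ ha _ hb => core_mul_mem ha hb

theorem cpt_star_mem {V₀ : Submodule ℝ H} {x : Coeff H} (hx : x ∈ cpt V₀) : star x ∈ cpt V₀ := by
  refine map_mem_closure continuous_star hx fun a ha => ?_
  induction ha using core_induction with
  | h b hb κ hκ =>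
    rw [star_mul, star_op, cliff_commute_op (cliff_star_mem hb)]
    exact mem_core (cliff_star_mem hb) hκ.star
  | h0 => simp
  | hadd x y _ _ hx hy => rw [star_add]; exact add_mem hx hy
  | hsmul c x _ hx => rw [star_smul]; exact Submodule.smul_mem _ _ hx

theorem cpt_mono {V₀ W₀ : Submodule ℝ H} (h : V₀ ≤ W₀) : cpt V₀ ≤ cpt W₀ := by
  refine Submodule.topologicalClosure_mono (Submodule.span_mono ?_)
  rintro _ ⟨b, hb, κ, hκ, rfl⟩
  exact ⟨b, cliff_mono h hb, κ, hκ, rfl⟩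

theorem cpt_γ_conj {V₀ : Submodule ℝ H} {x : Coeff H} (hx : x ∈ cpt V₀) : γ * x * γ ∈ cpt V₀ := by
  refine map_mem_closure (f := fun x => γ * x * γ)
    ((continuous_const.mul continuous_id).mul continuous_const) hx fun a ha => ?_
  change γ * a * γ ∈ core V₀
  induction ha using core_induction with
  | h b hb κ hκ =>
    rw [mul_assoc, mul_assoc, γ, commute_op_cgen, ← mul_assoc, ← mul_assoc]
    exact mem_core (cliff_γ_conj hb) hκ
  | h0 => simp
  | hadd x y _ _ hx hy => rw [mul_add, add_mul]; exact add_mem hx hy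
  | hsmul c x _ hx => rw [mul_smul_comm, smul_mul_assoc]; exact Submodule.smul_mem _ _ hx

theorem gen_mul_mem_cpt {V₀ : Submodule ℝ H} {u : H} (hu : u ∈ V₀) {x : Coeff H} (hx : x ∈ cpt V₀) :
    gen 0 u * x ∈ cpt V₀ := by
  refine map_mem_closure (f := fun x => gen 0 u * x) (continuous_const.mul continuous_id) hx
    fun a ha => ?_
  change gen 0 u * a ∈ core V₀
  induction ha using core_induction with
  | h b hb κ hκ => rw [← mul_assoc]; exact mem_core (cliff_mul_mem (cgen_mem_cliff hu) hb) hκ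
  | h0 => simp
  | hadd x y _ _ hx hy => rw [mul_add]; exact add_mem hx hy
  | hsmul c x _ hx => rw [mul_smul_comm]; exact Submodule.smul_mem _ _ hx

theorem cpt_lin_mem {V₀ W₀ : Submodule ℝ H} (A : Isom H)
    (hA : ∀ v ∈ V₀, ∃ w ∈ W₀, A (WithLp.toLp 2 (0, v)) = WithLp.toLp 2 (0, w)) {x : Coeff H}
    (hx : x ∈ cpt V₀) : lin A x ∈ cpt W₀ := by
  refine map_mem_closure (continuous_lin A) hx fun a ha => ?_
  induction ha using core_induction with
  | h b hb κ hκ => rw [map_mul, lin_op]; exact mem_core (cliff_lin_mem A hA hb) hκ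
  | h0 => simp
  | hadd x y _ _ hx hy => rw [map_add]; exact add_mem hx hy
  | hsmul c x _ hx => rw [map_smul]; exact Submodule.smul_mem _ _ hx

theorem cpt_lin_eq {V₀ : Submodule ℝ H} (A : Isom H)
    (hA : ∀ v ∈ V₀, A (WithLp.toLp 2 (0, v)) = WithLp.toLp 2 (0, v)) {x : Coeff H}
    (hx : x ∈ cpt V₀) : lin A x = x := by
  refine closure_minimal (t := {x | lin A x = x}) (fun a ha => ?_)
    (isClosed_eq (continuous_lin A) continuous_id) hx
  change lin A a = a
  induction ha using core_induction with
  | h b hb κ hκ => rw [map_mul, lin_op, cliff_lin_eq A hA hb]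
  | h0 => simp
  | hadd x y _ _ hx hy => rw [map_add, hx, hy]
  | hsmul c x _ hx => rw [map_smul, hx]

end Coeff

end

noncomputable section

set_option linter.unusedSectionVars false

open scoped NNReal BoundedContinuousFunction ZeroAtInfty
open Coeff

/-! ### Isometries of ℝ ⊕ H that fix a subspace -/

section isometries

variable {H : Type*} [NormedAddCommGroup H] [InnerProductSpace ℝ H]

/-- The vector `(s, u)` of `ℝ ⊕ H`. -/
def vec (s : ℝ) (u : H) : CliffSpace H := WithLp.toLp 2 (s, u)

theorem gen_eq_cgen_vec (s : ℝ) (u : H) : gen s u = cgen (vec s u) := rfl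

theorem γ_eq : (γ : Coeff H) = cgen (vec 1 0) := rfl

theorem vec_add (s s' : ℝ) (u u' : H) : vec (s + s') (u + u') = vec s u + vec s' u' := rfl

theorem vec_smul (r s : ℝ) (u : H) : r • vec s u = vec (r * s) (r • u) := rfl

theorem vec_sub (s s' : ℝ) (u u' : H) : vec (s - s') (u - u') = vec s u - vec s' u' := rfl

theorem vec_zero : vec 0 (0 : H) = 0 := rfl

theorem norm_vec_sq (s : ℝ) (u : H) : ‖vec s u‖ ^ 2 = s ^ 2 + ‖u‖ ^ 2 := by
  rw [WithLp.prod_norm_sq_eq_of_L2]; simp [vec]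

theorem norm_vec (s : ℝ) (u : H) : ‖vec s u‖ = √(s ^ 2 + ‖u‖ ^ 2) := by
  rw [← norm_vec_sq, Real.sqrt_sq (norm_nonneg _)]

theorem norm_vec_le (s : ℝ) (u : H) : ‖vec s u‖ ≤ |s| + ‖u‖ := by
  refine abs_le_of_sq_le_sq' ?_ (by positivity) |>.2
  rw [norm_vec_sq, add_sq, sq_abs]
  nlinarith [abs_nonneg s, norm_nonneg u, mul_nonneg (abs_nonneg s) (norm_nonneg u)]

theorem norm_vec_zero (s : ℝ≥0) : ‖vec (s : ℝ) (0 : H)‖ = s := by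
  rw [norm_vec]; simp

theorem inner_vec (s s' : ℝ) (u u' : H) :
    inner ℝ (vec s u) (vec s' u') = s * s' + inner ℝ u u' := by
  rw [vec, vec, WithLp.prod_inner_apply]; simp [mul_comm]

/-- The isometry `A` of `ℝ ⊕ H` fixes the subspace `V⁰` of `H`. -/
def FixesDir (A : Isom H) (V₀ : Submodule ℝ H) : Prop := ∀ w ∈ V₀, A (vec 0 w) = vec 0 w

/-- Take the reflection in the hyperplane orthogonal to x - y. It exchanges two vectors of equal
norm, and it fixes V⁰ because V⁰ is orthogonal to both. -/
theorem exists_isom_of_norm_eq {x y : CliffSpace H} (h : ‖x‖ = ‖y‖) {V₀ : Submodule ℝ H}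
    (hx : ∀ w ∈ V₀, inner ℝ (vec 0 w) x = 0) (hy : ∀ w ∈ V₀, inner ℝ (vec 0 w) y = 0) :
    ∃ A : Isom H, FixesDir A V₀ ∧ A x = y := by
  refine ⟨isomOf (Submodule.reflection (ℝ ∙ (x - y))ᗮ).toLinearIsometry, fun w hw => ?_, ?_⟩
  · rw [isomOf_apply]
    refine Submodule.reflection_mem_subspace_eq_self ?_
    rw [Submodule.mem_orthogonal_singleton_iff_inner_left, inner_sub_right, hx w hw, hy w hw,
      sub_zero]
  · rw [isomOf_apply]
    exact Submodule.reflection_sub h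

theorem exists_isom_vec {V₀ : Submodule ℝ H} {s s' : ℝ} {u u' : H} (hu : u ∈ V₀ᗮ) (hu' : u' ∈ V₀ᗮ)
    (h : ‖vec s u‖ = ‖vec s' u'‖) : ∃ A : Isom H, FixesDir A V₀ ∧ A (vec s u) = vec s' u' :=
  exists_isom_of_norm_eq h
    (fun w hw => by rw [inner_vec, zero_mul, zero_add]; exact hu w hw)
    (fun w hw => by rw [inner_vec, zero_mul, zero_add]; exact hu' w hw)

end isometries

/-! ### An intrinsic description of the images of the Bott maps -/

section sections

variable {H : Type*} [NormedAddCommGroup H] [InnerProductSpace ℝ H]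

/-- An intrinsic description of the image of `C_b(ℝ × V, Cliff_ℂ(V⁰) ⊗ K)` under the Bott map of
`V ⊆ H`: the functions which are equivariant under the isometries that fix `V`, and whose values on
`ℝ₊ × V` lie in `Cliff_ℂ(ℝ ⊕ V⁰) ⊗ K`. -/
structure MemCoeff (V : AffineSubspace ℝ H) (G : Fun H) : Prop where
  equivariant : ∀ A : Isom H, FixesDir A V.direction → ∀ (s s' : ℝ≥0), ∀ v ∈ V,
    ∀ u ∈ V.directionᗮ, ∀ u' ∈ V.directionᗮ, A (vec s u) = vec s' u' →
      G (s', v + u') = lin A (G (s, v + u))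
  apply_mem : ∀ (s : ℝ≥0), ∀ v ∈ V, ∃ a ∈ cpt V.direction, ∃ b ∈ cpt V.direction,
    G (s, v) = a + γ * b

namespace MemCoeff

variable {V W : AffineSubspace ℝ H} {G G' : Fun H}

theorem zero (V : AffineSubspace ℝ H) : MemCoeff V 0 where
  equivariant A _ s s' v _ u _ u' _ _ := by simp
  apply_mem s v _ := ⟨0, zero_mem _, 0, zero_mem _, by simp⟩

theorem add (hG : MemCoeff V G) (hG' : MemCoeff V G') : MemCoeff V (G + G') where
  equivariant A hA s s' v hv u hu u' hu' h := by
    simp only [BoundedContinuousFunction.coe_add, Pi.add_apply, map_add]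
    rw [hG.equivariant A hA s s' v hv u hu u' hu' h, hG'.equivariant A hA s s' v hv u hu u' hu' h]
  apply_mem s v hv := by
    obtain ⟨a, ha, b, hb, h⟩ := hG.apply_mem s v hv
    obtain ⟨a', ha', b', hb', h'⟩ := hG'.apply_mem s v hv
    refine ⟨a + a', add_mem ha ha', b + b', add_mem hb hb', ?_⟩
    rw [BoundedContinuousFunction.coe_add, Pi.add_apply, h, h', mul_add]
    abel

theorem smul (c : ℂ) (hG : MemCoeff V G) : MemCoeff V (c • G) where
  equivariant A hA s s' v hv u hu u' hu' h := by
    simp only [BoundedContinuousFunction.coe_smul, map_smul]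
    rw [hG.equivariant A hA s s' v hv u hu u' hu' h]
  apply_mem s v hv := by
    obtain ⟨a, ha, b, hb, h⟩ := hG.apply_mem s v hv
    refine ⟨c • a, Submodule.smul_mem _ c ha, c • b, Submodule.smul_mem _ c hb, ?_⟩
    change c • G (s, v) = _
    rw [h, smul_add, mul_smul_comm]

theorem sum {ι : Type*} (t : Finset ι) (f : ι → Fun H) (h : ∀ i ∈ t, MemCoeff V (f i)) :
    MemCoeff V (∑ i ∈ t, f i) := by
  classical
  induction t using Finset.induction_on with
  | empty => exact zero V
  | insert i t hi ih =>
    rw [Finset.sum_insert hi]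
    exact (h i (Finset.mem_insert_self i t)).add
      (ih fun j hj => h j (Finset.mem_insert_of_mem hj))

theorem mul (hG : MemCoeff V G) (hG' : MemCoeff V G') : MemCoeff V (G * G') where
  equivariant A hA s s' v hv u hu u' hu' h := by
    simp only [BoundedContinuousFunction.coe_mul, Pi.mul_apply, map_mul]
    rw [hG.equivariant A hA s s' v hv u hu u' hu' h, hG'.equivariant A hA s s' v hv u hu u' hu' h]
  apply_mem s v hv := by
    obtain ⟨a, ha, b, hb, h⟩ := hG.apply_mem s v hv
    obtain ⟨a', ha', b', hb', h'⟩ := hG'.apply_mem s v hv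
    -- Moving γ to the left past a coefficient costs a conjugation by γ: a γ = γ (γ a γ).
    refine ⟨a * a' + γ * b * γ * b', add_mem (cpt_mul_mem ha ha')
      (cpt_mul_mem (cpt_γ_conj hb) hb'), γ * a * γ * b' + b * a',
      add_mem (cpt_mul_mem (cpt_γ_conj ha) hb') (cpt_mul_mem hb ha'), ?_⟩
    rw [BoundedContinuousFunction.coe_mul, Pi.mul_apply, h, h']
    have h1 : γ * (γ * a * γ * b' + b * a') = a * (γ * b') + γ * b * a' := by
      rw [mul_add]; simp only [mul_assoc, γ_mul_γ_mul]
    rw [h1, add_mul, mul_add, mul_add]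
    simp only [mul_assoc]
    abel

theorem star (hG : MemCoeff V G) : MemCoeff V (star G) where
  equivariant A hA s s' v hv u hu u' hu' h := by
    rw [BoundedContinuousFunction.star_apply, BoundedContinuousFunction.star_apply,
      hG.equivariant A hA s s' v hv u hu u' hu' h, map_star]
  apply_mem s v hv := by
    obtain ⟨a, ha, b, hb, h⟩ := hG.apply_mem s v hv
    refine ⟨Star.star a, cpt_star_mem ha, γ * Star.star b * γ, cpt_γ_conj (cpt_star_mem hb), ?_⟩
    rw [BoundedContinuousFunction.star_apply, h, star_add, star_mul, star_γ, mul_assoc γ,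
      γ_mul_γ_mul]

theorem transport (t : H ≃ᵃⁱ[ℝ] H) (hG : MemCoeff V G) :
    MemCoeff (V.map (t : H →ᵃ[ℝ] H)) (transport t G) := by
  set e := t.linearIsometryEquiv with he
  have hdir : (V.map (t : H →ᵃ[ℝ] H)).direction = V.direction.map e.toLinearEquiv.toLinearMap :=
    AffineSubspace.map_direction _ _
  have hsymm (v u : H) : t.symm (v + u) = t.symm v + e.symm u := by
    have := t.symm.map_vadd v u
    simp only [vadd_eq_add] at this
    rw [add_comm, this, add_comm]; rfl
  have hmem {v : H} (hv : v ∈ V.map (t : H →ᵃ[ℝ] H)) : t.symm v ∈ V := by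
    obtain ⟨w, hw, rfl⟩ := hv
    have : t.symm (t w) = w := t.symm_apply_apply w
    exact this.symm ▸ hw
  have hort {u : H} (hu : u ∈ (V.map (t : H →ᵃ[ℝ] H)).directionᗮ) : e.symm u ∈ V.directionᗮ := by
    intro w hw
    rw [hdir] at hu
    have h1 := hu (e w) ⟨w, hw, rfl⟩
    rw [← e.inner_map_map, e.apply_symm_apply]
    exact h1
  refine ⟨fun A hA s s' v hv u hu u' hu' h => ?_, fun s v hv => ?_⟩
  · rw [transport_apply, transport_apply, hsymm, hsymm, map_eq_lin]
    -- Equivariance under A, which fixes the direction of tV, is equivariance of G under the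
    -- conjugate of A by the linear part of t, which fixes the direction of V.
    let A' : Isom H := (cliffIso e.symm).comp (A.comp (cliffIso e))
    have h1 : A' (vec s (e.symm u)) = vec s' (e.symm u') := by
      change cliffIso e.symm (A (vec s (e (e.symm u)))) = _
      rw [e.apply_symm_apply, h]; rfl
    have h2 : FixesDir A' V.direction := by
      intro w hw
      change cliffIso e.symm (A (vec 0 (e w))) = _
      rw [hA (e w) (by rw [hdir]; exact ⟨w, hw, rfl⟩)]
      change vec 0 (e.symm (e w)) = _
      rw [e.symm_apply_apply]
    rw [hG.equivariant A' h2 s s' _ (hmem hv) _ (hort hu) _ (hort hu') h1, lin_lin, lin_lin]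
    congr 1
    have : (cliffIso e).comp A' = A.comp (cliffIso e) := by
      ext x
      change cliffIso e (cliffIso e.symm (A (cliffIso e x))) = A (cliffIso e x)
      generalize A (cliffIso e x) = y
      change WithLp.toLp 2 (y.fst, e (e.symm y.snd)) = y
      rw [e.apply_symm_apply]
      rfl
    rw [this]
  · obtain ⟨a, ha, b, hb, h⟩ := hG.apply_mem s _ (hmem hv)
    have hA : ∀ v ∈ V.direction, ∃ w ∈ (V.map (t : H →ᵃ[ℝ] H)).direction,
        cliffIso e (WithLp.toLp 2 (0, v)) = WithLp.toLp 2 (0, w) := fun v hv =>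
      ⟨e v, by rw [hdir]; exact ⟨v, hv, rfl⟩, rfl⟩
    refine ⟨_, cpt_lin_mem (cliffIso e) hA ha, _, cpt_lin_mem (cliffIso e) hA hb, ?_⟩
    rw [transport_apply, h, map_eq_lin, map_add, map_mul]
    congr 2
    rw [γ_eq, lin_cgen]
    congr 1
    change vec 1 (e 0) = vec 1 0
    rw [map_zero]

end MemCoeff

/-! ### Projections -/

variable {V : AffineSubspace ℝ H} [FiniteDimensional ℝ V.direction] (o : V)

/-- The orthogonal projection to the affine subspace `V` through `o`. -/
def foot (h : H) : V :=
  ⟨V.direction.starProjection (h - o) +ᵥ (o : H),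
    AffineSubspace.vadd_mem_of_mem_direction (Submodule.starProjection_apply_mem _ _) o.2⟩

theorem sub_foot_mem (h : H) : h - foot o h ∈ V.directionᗮ := by
  have := V.direction.sub_starProjection_mem_orthogonal (h - o)
  have e : h - (foot o h : H) = h - o - V.direction.starProjection (h - o) := by
    simp only [foot, vadd_eq_add]; abel
  rwa [e]

theorem foot_add_sub (h : H) : (foot o h : H) + (h - foot o h) = h := by abel

theorem eq_foot {v : V} {u : H} (hu : u ∈ V.directionᗮ) : foot o ((v : H) + u) = v := by
  apply Subtype.ext
  have h1 : (v : H) - o ∈ V.direction := AffineSubspace.vsub_mem_direction v.2 o.2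
  have h2 : V.direction.starProjection ((v : H) + u - o) = v - o := by
    refine Submodule.eq_starProjection_of_mem_orthogonal h1 ?_
    have : (v : H) + u - o - (v - o) = u := by abel
    rwa [this]
  simp only [foot, h2, vadd_eq_add]
  abel

theorem lipschitzWith_foot : LipschitzWith 1 (foot o) := by
  refine LipschitzWith.of_dist_le_mul fun x y => ?_
  rw [Subtype.dist_eq, dist_eq_norm, dist_eq_norm, NNReal.coe_one, one_mul]
  have e : (foot o x : H) - foot o y = V.direction.starProjection (x - y) := by
    have : x - y = (x - o) - (y - o) := by abel
    rw [this, map_sub]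
    simp only [foot, vadd_eq_add]; abel
  rw [e]
  exact V.direction.norm_starProjection_apply_le _

/-- The component of `(s, h)` orthogonal to `V`. -/
def normalVec (p : ℝ≥0 × H) : CliffSpace H := vec p.1 (p.2 - foot o p.2)

/-- One unit comes from the coordinate in ℝ₊ and two from h - foot(h), a difference of two
1-Lipschitz maps. -/
theorem dist_normalVec_le (p q : ℝ≥0 × H) :
    ‖normalVec o p - normalVec o q‖ ≤ 3 * dist p q := by
  rw [normalVec, normalVec, ← vec_sub]
  refine (norm_vec_le _ _).trans ?_
  have h1 : |(p.1 : ℝ) - q.1| ≤ dist p q := by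
    rw [← NNReal.dist_eq]
    exact le_max_left _ _
  have h2 : dist p.2 q.2 ≤ dist p q := le_max_right _ _
  have h3 : dist (foot o p.2) (foot o q.2) ≤ dist p.2 q.2 := by
    simpa using (lipschitzWith_foot o).dist_le_mul p.2 q.2
  have h4 : p.2 - foot o p.2 - (q.2 - foot o q.2) = (p.2 - q.2) - (foot o p.2 - foot o q.2 : H) := by
    abel
  rw [h4]
  have h5 := norm_sub_le (p.2 - q.2) (foot o p.2 - foot o q.2 : H)
  rw [← dist_eq_norm p.2 q.2, ← dist_eq_norm (foot o p.2 : H), ← Subtype.dist_eq] at h5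
  linarith

theorem exists_isom_normalVec (p : ℝ≥0 × H) :
    ∃ A : Isom H, FixesDir A V.direction ∧ A (vec ‖normalVec o p‖ 0) = normalVec o p :=
  exists_isom_vec (zero_mem _) (sub_foot_mem o p.2) (by
    rw [norm_vec]; simp [normalVec])

/-- Equivariance applied to the rotation of (τ, 0) to the normal vector of p, with τ its length: an
element is determined by its values on ℝ₊ × V. -/
theorem MemCoeff.apply_eq_lin {G : Fun H} (hG : MemCoeff V G) (p : ℝ≥0 × H) {A : Isom H}
    (hA : FixesDir A V.direction) (h : A (vec ‖normalVec o p‖ 0) = normalVec o p) :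
    G p = lin A (G (‖normalVec o p‖₊, foot o p.2)) := by
  have := hG.equivariant A hA ‖normalVec o p‖₊ p.1 (foot o p.2) (foot o p.2).2 0 (zero_mem _) _
    (sub_foot_mem o p.2) h
  rwa [foot_add_sub, add_zero] at this

theorem MemCoeff.norm_apply_le {G : Fun H} (hG : MemCoeff V G) (p : ℝ≥0 × H) :
    ‖G p‖ ≤ ‖G (‖normalVec o p‖₊, foot o p.2)‖ := by
  obtain ⟨A, hA, h⟩ := exists_isom_normalVec o p
  rw [hG.apply_eq_lin o p hA h]
  exact norm_lin_le _ _

/-- The intrinsic form of the transitivity of Bott maps. An isometry that fixes W⁰ also fixes the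
part of w ∈ W normal to V, so equivariance is inherited. For the values on W, the rotation takes γ
to the unit normal vector, which splits into a multiple of γ and a Clifford generator from W⁰. -/
theorem MemCoeff.mono {W : AffineSubspace ℝ H} {G : Fun H} (o : V) (hG : MemCoeff V G)
    (h : V ≤ W) : MemCoeff W G := by
  have hdir := AffineSubspace.direction_le h
  have hsub {w : H} (hw : w ∈ W) : w - foot o w ∈ W.direction :=
    AffineSubspace.vsub_mem_direction hw (h (foot o w).2)
  have hadd (w : H) {u : H} (hu : u ∈ W.directionᗮ) : (w - foot o w) + u ∈ V.directionᗮ :=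
    add_mem (sub_foot_mem o w) (Submodule.orthogonal_le hdir hu)
  refine ⟨fun A hA s s' w hw u hu u' hu' hs => ?_, fun s w hw => ?_⟩
  · have e (u : H) : w + u = foot o w + ((w - foot o w) + u) := by abel
    rw [e u, e u']
    refine hG.equivariant A (fun x hx => hA x (hdir hx)) s s' _ (foot o w).2 _ (hadd w hu) _
      (hadd w hu') ?_
    have e2 (s : ℝ) (u : H) : vec s ((w - foot o w) + u) = vec 0 (w - foot o w) + vec s u := by
      rw [← vec_add, zero_add]
    rw [e2, e2, map_add, hs, hA _ (hsub hw)]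
  · obtain ⟨A, hA, hAx⟩ := exists_isom_normalVec o (s, w)
    rw [hG.apply_eq_lin o (s, w) hA hAx]
    obtain ⟨a, ha, b, hb, hab⟩ := hG.apply_mem ‖normalVec o (s, w)‖₊ _ (foot o w).2
    change ∃ _, _ ∧ ∃ _, _ ∧ lin A (G (‖normalVec o (s, w)‖₊, foot o w)) = _
    rw [hab, map_add, map_mul, cpt_lin_eq A hA ha, cpt_lin_eq A hA hb, γ_eq, lin_cgen]
    set τ := ‖normalVec o (s, w)‖
    rcases eq_or_ne τ 0 with h0 | h0
    -- Here there is no unit normal vector, but the point lies in {0} × V and the condition for V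
    -- applies as it is.
    · have hA1 : normalVec o (s, w) = 0 := norm_eq_zero.1 h0
      have hw' : w = foot o w := by
        have := congrArg (fun x : CliffSpace H => x.snd) hA1
        simp only [normalVec, vec] at this
        exact sub_eq_zero.1 this
      have hs' : s = 0 := by
        have := congrArg (fun x : CliffSpace H => x.fst) hA1
        exact NNReal.coe_eq_zero.1 this
      have hτ : ‖normalVec o (s, w)‖₊ = s := by
        rw [hA1, nnnorm_zero, hs']
      refine ⟨a, cpt_mono hdir ha, b, cpt_mono hdir hb, ?_⟩
      have h1 := hG.apply_eq_lin o (s, w) hA hAx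
      change G (s, w) = lin A (G (‖normalVec o (s, w)‖₊, foot o w)) at h1
      rw [hab, map_add, map_mul, cpt_lin_eq A hA ha, cpt_lin_eq A hA hb, γ_eq, lin_cgen] at h1
      rw [← h1, ← γ_eq, ← hab, hτ, ← hw']
    · have h1 : A (vec 1 0) = τ⁻¹ • normalVec o (s, w) := by
        rw [← hAx, ← map_smul, vec_smul, inv_mul_cancel₀ h0, smul_zero]
      have h2 : A (vec 1 0) = (τ⁻¹ * s) • vec 1 0 + vec 0 (τ⁻¹ • (w - foot o w)) := by
        rw [h1, normalVec, vec_smul, vec_smul, ← vec_add]; simp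
      refine ⟨a + gen 0 (τ⁻¹ • (w - foot o w)) * b, add_mem (cpt_mono hdir ha)
        (gen_mul_mem_cpt (W.direction.smul_mem _ (hsub hw)) (cpt_mono hdir hb)),
        ((τ⁻¹ * s : ℝ) : ℂ) • b, Submodule.smul_mem _ _ (cpt_mono hdir hb), ?_⟩
      rw [h2, cgen_add, cgen_smul, add_mul, smul_mul_assoc, mul_smul_comm, gen_eq_cgen_vec]
      abel

end sections

end

noncomputable section

set_option linter.unusedSectionVars false

open scoped NNReal BoundedContinuousFunction ZeroAtInfty
open Coeff

/-! ### Bott images of continuous and of Lipschitz functions -/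

section bott

variable {H : Type*} [NormedAddCommGroup H] [InnerProductSpace ℝ H]

namespace IsBott

variable {V : AffineSubspace ℝ H} {F F' : ℝ × V → Coeff H} {G G' : Fun H}

theorem sub (h : IsBott V F G) (h' : IsBott V F' G') : IsBott V (F - F') (G - G') := by
  intro s v u hu
  have h1 := h s v u hu
  have h2 := h' s v u hu
  simp only at h1 h2
  simp only [BoundedContinuousFunction.coe_sub, Pi.sub_apply, h1, h2]
  simp only [smul_sub, smul_add, mul_sub]
  abel

/-- The Bott formula depends on (s, u) only through its length and its direction, and the
coefficients from F are fixed by the isometry. -/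
theorem memCoeff (h : IsBott V F G) (hF : ∀ p, F p ∈ cpt V.direction) : MemCoeff V G := by
  refine ⟨fun A hA s s' v hv u hu u' hu' hs => ?_, fun s v hv => ?_⟩
  · have h1 := h s ⟨v, hv⟩ u hu
    have h2 := h s' ⟨v, hv⟩ u' hu'
    simp only [← norm_vec] at h1 h2
    rw [h1, h2, ← hs, norm_isom, map_add, map_mul, gen_eq_cgen_vec, gen_eq_cgen_vec, lin_cgen]
    have hmem (c : ℂ) (p q) : c • (F p + F q) ∈ cpt V.direction :=
      Submodule.smul_mem _ _ (add_mem (hF _) (hF _))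
    have hmem' (c : ℂ) (p q) : c • (F p - F q) ∈ cpt V.direction :=
      Submodule.smul_mem _ _ (sub_mem (hF _) (hF _))
    rw [cpt_lin_eq A hA (hmem _ _ _), cpt_lin_eq A hA (hmem' _ _ _)]
    congr 3
    have e (s : ℝ) (u : H) (r : ℝ) : vec (s / r) (r⁻¹ • u) = r⁻¹ • vec s u := by
      rw [vec_smul, div_eq_inv_mul]
    rw [e, e, map_smul, hs]
  · have h1 := h s ⟨v, hv⟩ 0 (zero_mem _)
    simp only [← norm_vec, norm_vec_zero, smul_zero, add_zero] at h1
    refine ⟨_, Submodule.smul_mem _ (1 / 2 : ℂ) (add_mem (hF (s, ⟨v, hv⟩)) (hF (-s, ⟨v, hv⟩))), _,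
      Submodule.smul_mem _ (1 / 2 : ℂ) (sub_mem (hF (s, ⟨v, hv⟩)) (hF (-s, ⟨v, hv⟩))), ?_⟩
    rw [h1]
    rcases eq_or_ne (s : ℝ) 0 with h0 | h0
    · simp [h0]
    · rw [div_self h0]; rfl

variable [FiniteDimensional ℝ V.direction] (o : V)

theorem apply (h : IsBott V F G) (p : ℝ≥0 × H) :
    G p = (1 / 2 : ℂ) • (F (‖normalVec o p‖, foot o p.2) + F (-‖normalVec o p‖, foot o p.2))
      + cgen (‖normalVec o p‖⁻¹ • normalVec o p) *
        ((1 / 2 : ℂ) • (F (‖normalVec o p‖, foot o p.2) - F (-‖normalVec o p‖, foot o p.2))) := by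
  have h1 := h p.1 (foot o p.2) _ (sub_foot_mem o p.2)
  simp only [← norm_vec] at h1
  rw [foot_add_sub] at h1
  refine h1.trans ?_
  have e (s r : ℝ) (u : H) : vec (s / r) (r⁻¹ • u) = r⁻¹ • vec s u := by
    rw [vec_smul, div_eq_inv_mul]
  rw [gen_eq_cgen_vec, e]
  rfl

theorem of_apply (h : ∀ p, G p = (1 / 2 : ℂ) • (F (‖normalVec o p‖, foot o p.2)
      + F (-‖normalVec o p‖, foot o p.2))
      + cgen (‖normalVec o p‖⁻¹ • normalVec o p) *
        ((1 / 2 : ℂ) • (F (‖normalVec o p‖, foot o p.2) - F (-‖normalVec o p‖, foot o p.2)))) :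
    IsBott V F G := by
  intro s v u hu
  have h1 : normalVec o (s, (v : H) + u) = vec s u := by
    rw [normalVec, eq_foot o hu]; simp
  simp only
  rw [h (s, v + u), h1]
  simp only [eq_foot o hu, ← norm_vec]
  have e (s r : ℝ) (u : H) : vec (s / r) (r⁻¹ • u) = r⁻¹ • vec s u := by
    rw [vec_smul, div_eq_inv_mul]
  rw [gen_eq_cgen_vec, e]

theorem norm_unit_le (x : CliffSpace H) : ‖cgen (‖x‖⁻¹ • x)‖ ≤ 1 := by
  refine (norm_cgen_le _).trans ?_
  rw [norm_smul, norm_inv, norm_norm]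
  exact inv_mul_le_one

theorem norm_bott_le {C : ℝ} {a b x : Coeff H} (ha : ‖a‖ ≤ C) (hb : ‖b‖ ≤ C) (hx : ‖x‖ ≤ 1) :
    ‖(1 / 2 : ℂ) • (a + b) + x * ((1 / 2 : ℂ) • (a - b))‖ ≤ 2 * C := by
  have h1 : ‖(1 / 2 : ℂ) • (a + b)‖ ≤ C := by
    rw [norm_smul]
    have := norm_add_le a b
    norm_num
    linarith
  have h2 : ‖(1 / 2 : ℂ) • (a - b)‖ ≤ C := by
    rw [norm_smul]
    have := norm_sub_le a b
    norm_num
    linarith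
  have h3 : ‖x * ((1 / 2 : ℂ) • (a - b))‖ ≤ C :=
    (norm_mul_le _ _).trans (by nlinarith [norm_nonneg ((1 / 2 : ℂ) • (a - b)), norm_nonneg x])
  linarith [norm_add_le ((1 / 2 : ℂ) • (a + b)) (x * ((1 / 2 : ℂ) • (a - b)))]

include o in
theorem norm_le (h : IsBott V F G) {C : ℝ} (hC : 0 ≤ C) (hF : ∀ p, ‖F p‖ ≤ C) : ‖G‖ ≤ 2 * C := by
  refine (BoundedContinuousFunction.norm_le (by positivity)).2 fun p => ?_
  rw [h.apply o p]
  exact norm_bott_le (hF _) (hF _) (norm_unit_le _)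

-- The direction of the normal vector is continuous except where that vector vanishes, and there it
-- is multiplied by the odd part of F, which tends to zero.
include o in
theorem exists_of_continuous (hc : Continuous F) {C : ℝ} (hF : ∀ p, ‖F p‖ ≤ C) :
    ∃ G : Fun H, IsBott V F G := by
  have hfoot : Continuous (foot o) := (lipschitzWith_foot o).continuous
  have hx : Continuous (normalVec o) :=
    (LipschitzWith.of_dist_le_mul (K := 3) fun p q => by
      rw [dist_eq_norm]; exact dist_normalVec_le o p q).continuous
  have hE : Continuous fun p : ℝ≥0 × H => F (‖normalVec o p‖, foot o p.2) :=
    hc.comp (hx.norm.prodMk (hfoot.comp continuous_snd))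
  have hE' : Continuous fun p : ℝ≥0 × H => F (-‖normalVec o p‖, foot o p.2) :=
    hc.comp (hx.norm.neg.prodMk (hfoot.comp continuous_snd))
  have hO : Continuous fun p : ℝ≥0 × H => (1 / 2 : ℂ) • (F (‖normalVec o p‖, foot o p.2)
      - F (-‖normalVec o p‖, foot o p.2)) :=
    Continuous.smul (continuous_const (y := (1 / 2 : ℂ))) (hE.sub hE')
  refine ⟨BoundedContinuousFunction.ofNormedAddCommGroup _ ?_ (2 * C) fun p =>
    norm_bott_le (hF _) (hF _) (norm_unit_le (normalVec o p)), of_apply o fun p => rfl⟩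
  refine (Continuous.smul (continuous_const (y := (1 / 2 : ℂ))) (hE.add hE')).add ?_
  refine continuous_iff_continuousAt.2 fun p => ?_
  rcases eq_or_ne (normalVec o p) 0 with h0 | h0
  · have h1 : Filter.Tendsto (fun p => (1 / 2 : ℂ) • (F (‖normalVec o p‖, foot o p.2)
      - F (-‖normalVec o p‖, foot o p.2))) (nhds p) (nhds 0) := by
      have := hO.tendsto p
      rwa [h0, norm_zero, neg_zero, sub_self, smul_zero] at this
    rw [ContinuousAt, h0]
    simp only [norm_zero, neg_zero, sub_self, smul_zero, mul_zero]
    refine squeeze_zero_norm (fun q => ?_) (tendsto_zero_iff_norm_tendsto_zero.1 h1)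
    refine (norm_mul_le _ _).trans ?_
    exact mul_le_of_le_one_left (norm_nonneg _) (norm_unit_le _)
  · refine ContinuousAt.mul ?_ hO.continuousAt
    refine continuous_cgen.continuousAt.comp ?_
    exact (hx.norm.continuousAt.inv₀ (norm_ne_zero_iff.2 h0)).smul hx.continuousAt

-- The constant is 12 = 6 + 6. The even and odd parts vary through the 3-Lipschitz normal vector,
-- with a factor 2 for the two summands; the variation of the direction costs another 6.
include o in
theorem lipschitzWith (h : IsBott V F G) {K : ℝ≥0} (hF : LipschitzWith K F) :
    LipschitzWith (12 * K) G := by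
  refine LipschitzWith.of_dist_le_mul fun p q => ?_
  set x := normalVec o p
  set y := normalVec o q
  have hxy : ‖x - y‖ ≤ 3 * dist p q := dist_normalVec_le o p q
  have hn : |‖x‖ - ‖y‖| ≤ 3 * dist p q := (abs_norm_sub_norm_le x y).trans hxy
  have hf : dist (foot o p.2) (foot o q.2) ≤ dist p q :=
    (by simpa using (lipschitzWith_foot o).dist_le_mul p.2 q.2 :
      dist (foot o p.2) (foot o q.2) ≤ dist p.2 q.2).trans (le_max_right _ _)
  have hd : 0 ≤ dist p q := dist_nonneg
  have h1 : ‖F (‖x‖, foot o p.2) - F (‖y‖, foot o q.2)‖ ≤ K * (3 * dist p q) := by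
    rw [← dist_eq_norm]
    refine (hF.dist_le_mul _ _).trans (mul_le_mul_of_nonneg_left ?_ K.2)
    exact max_le hn (by linarith)
  have h2 : ‖F (-‖x‖, foot o p.2) - F (-‖y‖, foot o q.2)‖ ≤ K * (3 * dist p q) := by
    rw [← dist_eq_norm]
    refine (hF.dist_le_mul _ _).trans (mul_le_mul_of_nonneg_left ?_ K.2)
    refine max_le ?_ (by simp only; linarith)
    simp only [Real.dist_eq]
    rw [← abs_neg, show -(-‖x‖ - -‖y‖) = ‖x‖ - ‖y‖ by ring]
    exact hn
  -- The odd part is of order ‖y‖ near the zero section, which compensates the steepness ‖y‖⁻¹ of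
  -- the direction y/‖y‖ estimated in `h4`.
  have h3 : ‖F (‖y‖, foot o q.2) - F (-‖y‖, foot o q.2)‖ ≤ K * (2 * ‖y‖) := by
    rw [← dist_eq_norm]
    refine (hF.dist_le_mul _ _).trans (mul_le_mul_of_nonneg_left ?_ K.2)
    refine max_le ?_ (by simp)
    simp only [Real.dist_eq]
    rw [sub_neg_eq_add, ← two_mul, abs_of_nonneg (by positivity)]
  have h4 : ‖y‖ * ‖‖x‖⁻¹ • x - ‖y‖⁻¹ • y‖ ≤ 6 * dist p q := by
    rcases eq_or_ne x 0 with hx | hx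
    · rw [hx]
      simp only [norm_zero, smul_zero, zero_sub, norm_neg, norm_smul, norm_inv, norm_norm]
      rw [hx, zero_sub, norm_neg] at hxy
      have : ‖y‖⁻¹ * ‖y‖ ≤ 1 := inv_mul_le_one
      nlinarith [norm_nonneg y]
    rcases eq_or_ne y 0 with hy | hy
    · rw [hy, norm_zero, zero_mul]; positivity
    have hx' : ‖x‖ ≠ 0 := norm_ne_zero_iff.2 hx
    have hy' : ‖y‖ ≠ 0 := norm_ne_zero_iff.2 hy
    have e : ‖y‖ * ‖‖x‖⁻¹ • x - ‖y‖⁻¹ • y‖ = ‖((‖y‖ - ‖x‖) * ‖x‖⁻¹) • x + (x - y)‖ := by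
      rw [← norm_norm y, ← norm_smul, norm_norm, smul_sub, smul_smul, smul_smul,
        mul_inv_cancel₀ hy', one_smul]
      congr 1
      rw [sub_mul, mul_inv_cancel₀ hx', sub_smul, one_smul]
      abel
    rw [e]
    refine (norm_add_le _ _).trans ?_
    rw [norm_smul, norm_mul, norm_inv, norm_norm, mul_assoc, inv_mul_cancel₀ hx', mul_one,
      Real.norm_eq_abs, abs_sub_comm]
    linarith
  rw [dist_eq_norm, h.apply o p, h.apply o q]
  change ‖(1 / 2 : ℂ) • (F (‖x‖, foot o p.2) + F (-‖x‖, foot o p.2))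
      + cgen (‖x‖⁻¹ • x) * ((1 / 2 : ℂ) • (F (‖x‖, foot o p.2) - F (-‖x‖, foot o p.2)))
    - ((1 / 2 : ℂ) • (F (‖y‖, foot o q.2) + F (-‖y‖, foot o q.2))
      + cgen (‖y‖⁻¹ • y) * ((1 / 2 : ℂ) • (F (‖y‖, foot o q.2) - F (-‖y‖, foot o q.2))))‖ ≤ _
  generalize F (‖x‖, foot o p.2) = a at *
  generalize F (-‖x‖, foot o p.2) = b at *
  generalize F (‖y‖, foot o q.2) = a' at *
  generalize F (-‖y‖, foot o q.2) = b' at *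
  have e : (1 / 2 : ℂ) • (a + b) + cgen (‖x‖⁻¹ • x) * ((1 / 2 : ℂ) • (a - b))
      - ((1 / 2 : ℂ) • (a' + b') + cgen (‖y‖⁻¹ • y) * ((1 / 2 : ℂ) • (a' - b')))
      = ((1 / 2 : ℂ) • ((a - a') + (b - b')) +
        cgen (‖x‖⁻¹ • x) * ((1 / 2 : ℂ) • ((a - a') - (b - b'))))
        + cgen (‖x‖⁻¹ • x - ‖y‖⁻¹ • y) * ((1 / 2 : ℂ) • (a' - b')) := by
    rw [cgen_sub, sub_mul]
    simp only [smul_add, smul_sub, mul_sub]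
    abel
  rw [e]
  refine (norm_add_le _ _).trans ?_
  have h5 := norm_bott_le h1 h2 (norm_unit_le x)
  have h6 : ‖cgen (‖x‖⁻¹ • x - ‖y‖⁻¹ • y) * ((1 / 2 : ℂ) • (a' - b'))‖ ≤ 6 * K * dist p q := by
    refine (norm_mul_le _ _).trans ?_
    have h7 : ‖(1 / 2 : ℂ) • (a' - b')‖ ≤ K * ‖y‖ := by
      rw [norm_smul]; norm_num; linarith
    calc ‖cgen (‖x‖⁻¹ • x - ‖y‖⁻¹ • y)‖ * ‖(1 / 2 : ℂ) • (a' - b')‖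
        ≤ ‖‖x‖⁻¹ • x - ‖y‖⁻¹ • y‖ * (K * ‖y‖) :=
          mul_le_mul (norm_cgen_le _) h7 (norm_nonneg _) (norm_nonneg _)
      _ = K * (‖y‖ * ‖‖x‖⁻¹ • x - ‖y‖⁻¹ • y‖) := by ring
      _ ≤ K * (6 * dist p q) := mul_le_mul_of_nonneg_left h4 K.2
      _ = _ := by ring
  push_cast
  linarith

end IsBott

/-! ### Inversion of the Bott map -/

namespace MemCoeff

variable {V : AffineSubspace ℝ H} {G : Fun H}

/-- The isometry σ that fixes V⁰ and sends γ to -γ separates a value a + γ b into a and b, which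
serve as the even and the odd part of F. Both are Lipschitz because they are averages of G and σG,
up to a factor γ. -/
theorem exists_isBott (hG : MemCoeff V G) {K : ℝ≥0} (hK : LipschitzWith K G) :
    ∃ F : ℝ × V → Coeff H, (∀ p, F p ∈ cpt V.direction) ∧ IsBott V F G ∧ LipschitzWith (3 * K) F ∧
      ∀ (s : ℝ≥0) (v : V), G (s, v) = 0 → F (s, v) = 0 ∧ F (-s, v) = 0 := by
  obtain ⟨σ, hσ, hσγ⟩ : ∃ A : Isom H, FixesDir A V.direction ∧ A (vec 1 0) = vec (-1) 0 :=
    exists_isom_vec (zero_mem _) (zero_mem _) (by rw [norm_vec, norm_vec]; simp)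
  have hσ1 : lin σ γ = -γ := by
    rw [γ_eq, lin_cgen, hσγ]
    have : vec (-1) (0 : H) = (-1 : ℝ) • vec 1 0 := by rw [vec_smul]; simp
    rw [this, cgen_smul]; simp
  let E : ℝ≥0 × V → Coeff H := fun p => (1 / 2 : ℂ) • (G (p.1, p.2) + lin σ (G (p.1, p.2)))
  let O : ℝ≥0 × V → Coeff H := fun p => γ * ((1 / 2 : ℂ) • (G (p.1, p.2) - lin σ (G (p.1, p.2))))
  have hmem (p : ℝ≥0 × V) : E p ∈ cpt V.direction ∧ O p ∈ cpt V.direction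
      ∧ G (p.1, p.2) = E p + γ * O p := by
    obtain ⟨a, ha, b, hb, hab⟩ := hG.apply_mem p.1 p.2 p.2.2
    have h1 : lin σ (a + γ * b) = a - γ * b := by
      rw [map_add, map_mul, cpt_lin_eq σ hσ ha, cpt_lin_eq σ hσ hb, hσ1, neg_mul, sub_eq_add_neg]
    have h2 : E p = a := by
      simp only [E, hab, h1]
      rw [show a + γ * b + (a - γ * b) = (2 : ℂ) • a by rw [two_smul]; abel, smul_smul]
      norm_num
    have h3 : O p = b := by
      simp only [O, hab, h1]
      rw [show a + γ * b - (a - γ * b) = (2 : ℂ) • (γ * b) by rw [two_smul]; abel, smul_smul,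
        mul_smul_comm, γ_mul_γ_mul]
      norm_num
    rw [h2, h3]
    exact ⟨ha, hb, hab⟩
  have hdist (p q : ℝ≥0 × V) : dist ((p.1, p.2) : ℝ≥0 × H) (q.1, q.2) = dist p q := rfl
  have hGl (p q : ℝ≥0 × V) : ‖G (p.1, p.2) - G (q.1, q.2)‖ ≤ K * dist p q := by
    rw [← dist_eq_norm, ← hdist]; exact hK.dist_le_mul _ _
  have hσG (p q : ℝ≥0 × V) : ‖lin σ (G (p.1, p.2)) - lin σ (G (q.1, q.2))‖ ≤ K * dist p q := by
    rw [← map_sub]; exact (norm_lin_le _ _).trans (hGl p q)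
  have hE : LipschitzWith K E := LipschitzWith.of_dist_le_mul fun p q => by
    rw [dist_eq_norm]
    simp only [E]
    rw [← smul_sub, norm_smul, add_sub_add_comm]
    have := norm_add_le (G (p.1, p.2) - G (q.1, q.2)) (lin σ (G (p.1, p.2)) - lin σ (G (q.1, q.2)))
    norm_num
    linarith [hGl p q, hσG p q]
  have hO : LipschitzWith K O := LipschitzWith.of_dist_le_mul fun p q => by
    rw [dist_eq_norm]
    simp only [O]
    rw [← mul_sub, norm_γ_mul, ← smul_sub, norm_smul, sub_sub_sub_comm]
    have := norm_sub_le (G (p.1, p.2) - G (q.1, q.2)) (lin σ (G (p.1, p.2)) - lin σ (G (q.1, q.2)))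
    norm_num
    linarith [hGl p q, hσG p q]
  -- The vector (0, 0) is fixed by every isometry, so G is σ-invariant at s = 0. The odd part
  -- vanishes there and can be reflected without a jump.
  have hzero (v : V) : lin σ (G (0, v)) = G (0, v) := by
    have h := hG.equivariant σ hσ 0 0 v v.2 0 (zero_mem _) 0 (zero_mem _) (by
      rw [NNReal.coe_zero, vec_zero, map_zero])
    rw [add_zero] at h
    exact h.symm
  have hO0 (v : V) : O (0, v) = 0 := by
    simp only [O, hzero, sub_self, smul_zero, mul_zero]
  -- The even extension of E plus the odd extension of O. At most one of the two truncated terms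
  -- differs from O(0, v) = 0, so one Lipschitz formula covers both signs.
  let F : ℝ × V → Coeff H := fun p =>
    E (Real.nnabs p.1, p.2) + (O (p.1.toNNReal, p.2) - O ((-p.1).toNNReal, p.2))
  have hFp (s : ℝ≥0) (v : V) : F (s, v) = E (s, v) + O (s, v) := by
    simp only [F]
    have : Real.nnabs (s : ℝ) = s := by ext; simp
    rw [this, Real.toNNReal_coe, Real.toNNReal_of_nonpos (by simp), hO0, sub_zero]
  have hFn (s : ℝ≥0) (v : V) : F (-s, v) = E (s, v) - O (s, v) := by
    simp only [F]
    rw [neg_neg, Real.toNNReal_coe, Real.toNNReal_of_nonpos (by simp), hO0, zero_sub]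
    have : Real.nnabs (-(s : ℝ)) = s := by ext; simp
    rw [this, sub_eq_add_neg]
  refine ⟨F, fun p => ?_, ?_, ?_, fun s v h0 => ?_⟩
  · exact add_mem (hmem _).1 (sub_mem (hmem _).2.1 (hmem _).2.1)
  · intro s v u hu
    simp only [← norm_vec]
    set τ : ℝ≥0 := ‖vec (s : ℝ) u‖₊ with hτ
    have hτ' : ‖vec (s : ℝ) u‖ = (τ : ℝ) := rfl
    rw [hτ', hFp, hFn]
    have e1 : E (τ, v) + O (τ, v) + (E (τ, v) - O (τ, v)) = (2 : ℂ) • E (τ, v) := by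
      rw [two_smul]; abel
    have e2 : E (τ, v) + O (τ, v) - (E (τ, v) - O (τ, v)) = (2 : ℂ) • O (τ, v) := by
      rw [two_smul]; abel
    have half (x : Coeff H) : (1 / 2 : ℂ) • (2 : ℂ) • x = x := by
      rw [smul_smul]; norm_num
    rw [e1, e2, half, half]
    obtain ⟨A, hA, hAx⟩ : ∃ A : Isom H, FixesDir A V.direction ∧ A (vec τ 0) = vec s u :=
      exists_isom_vec (zero_mem _) hu (by rw [norm_vec_zero, hτ'])
    have h1 := hG.equivariant A hA τ s v v.2 0 (zero_mem _) u hu hAx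
    rw [add_zero] at h1
    rw [h1, (hmem (τ, v)).2.2, map_add, map_mul, cpt_lin_eq A hA (hmem _).1,
      cpt_lin_eq A hA (hmem _).2.1]
    congr 1
    rcases eq_or_ne τ 0 with h0 | h0
    · rw [h0, hO0, mul_zero, mul_zero]
    · congr 1
      have h0' : (τ : ℝ) ≠ 0 := NNReal.coe_ne_zero.2 h0
      have : vec 1 (0 : H) = (τ : ℝ)⁻¹ • vec τ 0 := by
        rw [vec_smul, inv_mul_cancel₀ h0', smul_zero]
      rw [γ_eq, lin_cgen, this, map_smul, hAx, gen_eq_cgen_vec, vec_smul, div_eq_inv_mul]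
  · refine LipschitzWith.of_dist_le_mul fun p q => ?_
    have habs : dist (Real.nnabs p.1, p.2) (Real.nnabs q.1, q.2) ≤ dist p q := by
      refine max_le ?_ (le_max_right _ _)
      rw [NNReal.dist_eq, Real.coe_nnabs, Real.coe_nnabs]
      exact (abs_abs_sub_abs_le_abs_sub _ _).trans (le_max_left _ _)
    have hpos : dist (p.1.toNNReal, p.2) (q.1.toNNReal, q.2) ≤ dist p q := by
      refine max_le ?_ (le_max_right _ _)
      rw [NNReal.dist_eq, Real.coe_toNNReal', Real.coe_toNNReal']
      exact (abs_max_sub_max_le_abs _ _ _).trans (le_max_left _ _)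
    have hneg : dist ((-p.1).toNNReal, p.2) ((-q.1).toNNReal, q.2) ≤ dist p q := by
      refine max_le ?_ (le_max_right _ _)
      rw [NNReal.dist_eq, Real.coe_toNNReal', Real.coe_toNNReal']
      refine (abs_max_sub_max_le_abs _ _ _).trans (le_trans (le_of_eq ?_) (le_max_left _ _))
      rw [Real.dist_eq, ← abs_neg]; congr 1; ring
    have a1 := (hE.dist_le_mul (Real.nnabs p.1, p.2) (Real.nnabs q.1, q.2)).trans
      (mul_le_mul_of_nonneg_left habs K.2)
    have a2 := (hO.dist_le_mul (p.1.toNNReal, p.2) (q.1.toNNReal, q.2)).trans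
      (mul_le_mul_of_nonneg_left hpos K.2)
    have a3 := (hO.dist_le_mul ((-p.1).toNNReal, p.2) ((-q.1).toNNReal, q.2)).trans
      (mul_le_mul_of_nonneg_left hneg K.2)
    rw [dist_eq_norm] at a1 a2 a3
    rw [dist_eq_norm]
    simp only [F]
    rw [add_sub_add_comm, sub_sub_sub_comm]
    refine (norm_add_le _ _).trans ?_
    have := norm_sub_le (O (p.1.toNNReal, p.2) - O (q.1.toNNReal, q.2))
      (O ((-p.1).toNNReal, p.2) - O ((-q.1).toNNReal, q.2))
    push_cast
    linarith
  · have hE0 : E (s, v) = 0 := by simp only [E, h0, map_zero, add_zero, smul_zero]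
    have hO0' : O (s, v) = 0 := by simp only [O, h0, map_zero, sub_zero, smul_zero, mul_zero]
    rw [hFp, hFn, hE0, hO0']
    simp

end MemCoeff

end bott

end

noncomputable section

set_option linter.unusedSectionVars false

open scoped NNReal BoundedContinuousFunction ZeroAtInfty
open Coeff

/-! ### A smooth partition of unity on a lattice -/

namespace LatticePartition

/-- A smooth function supported in `[-1, 1]` whose integer translates add up to `1`. -/
def bump (t : ℝ) : ℝ := Real.smoothTransition (t + 1) - Real.smoothTransition t

theorem contDiff_bump : ContDiff ℝ 1 bump := by
  have h : ContDiff ℝ 1 Real.smoothTransition := Real.smoothTransition.contDiff (n := 1)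
  exact (h.comp (contDiff_id.add contDiff_const)).sub h

theorem bump_nonneg (t : ℝ) : 0 ≤ bump t :=
  sub_nonneg.2 (Real.smoothTransition.monotone (by linarith))

theorem bump_le_one (t : ℝ) : bump t ≤ 1 := by
  have h1 := Real.smoothTransition.le_one (t + 1)
  have h2 := Real.smoothTransition.nonneg t
  unfold bump
  linarith

theorem bump_eq_zero {t : ℝ} (ht : 1 ≤ |t|) : bump t = 0 := by
  unfold bump
  rcases le_abs.1 ht with h | h
  · rw [Real.smoothTransition.one_of_one_le h, Real.smoothTransition.one_of_one_le (by linarith),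
      sub_self]
  · rw [Real.smoothTransition.zero_of_nonpos (by linarith),
      Real.smoothTransition.zero_of_nonpos (by linarith), sub_self]

theorem hasCompactSupport_bump : HasCompactSupport bump :=
  HasCompactSupport.intro (isCompact_Icc (a := (-1 : ℝ)) (b := 1)) fun t ht => bump_eq_zero (by
    by_contra h
    exact ht (abs_le.1 (not_le.1 h).le))

theorem exists_lipschitzWith_bump : ∃ κ : ℝ≥0, LipschitzWith κ bump :=
  contDiff_bump.lipschitzWith_of_hasCompactSupport hasCompactSupport_bump one_ne_zero

/-- The integers at distance less than `1` from `t`. -/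
def near (t : ℝ) : Finset ℤ := {⌊t⌋, ⌊t⌋ + 1}

theorem mem_near {t : ℝ} {m : ℤ} (h : |t - m| < 1) : m ∈ near t := by
  obtain ⟨h1, h2⟩ := abs_lt.1 h
  have h3 : m ≤ ⌊t⌋ + 1 := by
    have : (m : ℝ) < t + 1 := by linarith
    have h4 := Int.lt_floor_add_one t
    have : (m : ℝ) < (⌊t⌋ + 2 : ℤ) := by push_cast; linarith
    have := Int.cast_lt.1 this
    omega
  have h4 : ⌊t⌋ ≤ m := by
    have h5 := Int.floor_le t
    have : ((⌊t⌋ : ℤ) : ℝ) < (m + 1 : ℤ) := by push_cast; linarith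
    have := Int.cast_lt.1 this
    omega
  simp only [near, Finset.mem_insert, Finset.mem_singleton]
  omega

theorem abs_sub_le_of_mem_near {t : ℝ} {m : ℤ} (h : m ∈ near t) : |t - m| ≤ 1 := by
  have h1 := Int.lt_floor_add_one t
  have h2 := Int.floor_le t
  simp only [near, Finset.mem_insert, Finset.mem_singleton] at h
  rcases h with rfl | rfl
  · rw [abs_le]; constructor <;> linarith
  · push_cast; rw [abs_le]; constructor <;> linarith

theorem bump_sub_eq_zero {t : ℝ} {m : ℤ} (h : m ∉ near t) : bump (t - m) = 0 :=
  bump_eq_zero (not_lt.1 fun h' => h (mem_near h'))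

/-- Only two translates are nonzero at t, and their smooth transitions telescope. -/
theorem sum_bump (t : ℝ) : ∑ m ∈ near t, bump (t - m) = 1 := by
  rw [near, Finset.sum_pair (by omega)]
  have h1 := Int.lt_floor_add_one t
  have h2 := Int.floor_le t
  unfold bump
  push_cast
  rw [Real.smoothTransition.one_of_one_le (show 1 ≤ t - ⌊t⌋ + 1 by linarith),
    Real.smoothTransition.zero_of_nonpos (show t - (⌊t⌋ + 1) ≤ 0 by linarith),
    show t - (⌊t⌋ + 1) + 1 = t - ⌊t⌋ by ring]
  ring

variable {ι : Type*} [Fintype ι] [DecidableEq ι]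

/-- The product partition of unity on `ℝ^ι`. -/
def weight (t : ι → ℝ) (m : ι → ℤ) : ℝ := ∏ j, bump (t j - m j)

/-- The lattice points that contribute at `t`. -/
def nearPi (t : ι → ℝ) : Finset (ι → ℤ) := Fintype.piFinset fun j => near (t j)

theorem weight_nonneg (t : ι → ℝ) (m : ι → ℤ) : 0 ≤ weight t m :=
  Finset.prod_nonneg fun _ _ => bump_nonneg _

theorem weight_eq_zero_of_one_le {t : ι → ℝ} {m : ι → ℤ} {j : ι} (h : 1 ≤ |t j - m j|) :
    weight t m = 0 := Finset.prod_eq_zero (Finset.mem_univ j) (bump_eq_zero h)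

theorem weight_eq_zero {t : ι → ℝ} {m : ι → ℤ} (h : m ∉ nearPi t) : weight t m = 0 := by
  rw [nearPi, Fintype.mem_piFinset] at h
  push Not at h
  obtain ⟨j, hj⟩ := h
  exact Finset.prod_eq_zero (Finset.mem_univ j) (bump_sub_eq_zero hj)

theorem sum_weight {t : ι → ℝ} {S : Finset (ι → ℤ)} (h : nearPi t ⊆ S) :
    ∑ m ∈ S, weight t m = 1 := by
  rw [← Finset.sum_subset h fun m _ hm => weight_eq_zero hm]
  unfold weight nearPi
  rw [← Finset.prod_univ_sum (fun j => near (t j)) fun j m => bump (t j - m)]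
  exact Finset.prod_eq_one fun j _ => sum_bump _

theorem abs_prod_sub_prod_le (s : Finset ι) (a b : ι → ℝ) (ha : ∀ j, 0 ≤ a j ∧ a j ≤ 1)
    (hb : ∀ j, 0 ≤ b j ∧ b j ≤ 1) : |∏ j ∈ s, a j - ∏ j ∈ s, b j| ≤ ∑ j ∈ s, |a j - b j| := by
  induction s using Finset.induction_on with
  | empty => simp
  | insert j s hj ih =>
    rw [Finset.prod_insert hj, Finset.prod_insert hj, Finset.sum_insert hj]
    have h1 : 0 ≤ ∏ j ∈ s, a j := Finset.prod_nonneg fun j _ => (ha j).1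
    have h2 : ∏ j ∈ s, a j ≤ 1 := Finset.prod_le_one (fun j _ => (ha j).1) fun j _ => (ha j).2
    have e : a j * ∏ j ∈ s, a j - b j * ∏ j ∈ s, b j
        = (a j - b j) * ∏ j ∈ s, a j + b j * (∏ j ∈ s, a j - ∏ j ∈ s, b j) := by ring
    rw [e]
    refine (abs_add_le _ _).trans ?_
    rw [abs_mul, abs_mul, abs_of_nonneg h1, abs_of_nonneg (hb j).1]
    have := hb j
    nlinarith [abs_nonneg (a j - b j), abs_nonneg (∏ j ∈ s, a j - ∏ j ∈ s, b j)]

theorem abs_weight_sub_le {κ : ℝ≥0} (hκ : LipschitzWith κ bump) (t t' : ι → ℝ) (m : ι → ℤ) :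
    |weight t m - weight t' m| ≤ Fintype.card ι * (κ * ‖t - t'‖) := by
  refine (abs_prod_sub_prod_le _ _ _ (fun j => ⟨bump_nonneg _, bump_le_one _⟩)
    fun j => ⟨bump_nonneg _, bump_le_one _⟩).trans ?_
  refine (Finset.sum_le_card_nsmul _ _ (κ * ‖t - t'‖) fun j _ => ?_).trans (by simp)
  have h := hκ.dist_le_mul (t j - m j) (t' j - m j)
  rw [Real.dist_eq, Real.dist_eq, sub_sub_sub_cancel_right] at h
  exact h.trans (mul_le_mul_of_nonneg_left (norm_le_pi_norm (t - t') j) κ.2)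

variable {E : Type*} [NormedAddCommGroup E] [NormedSpace ℝ E] {f : (ι → ℤ) → E}
  {T : Finset (ι → ℤ)}

theorem sum_smul_eq (hf : ∀ m ∉ T, f m = 0) (t : ι → ℝ) {S : Finset (ι → ℤ)} (h : nearPi t ⊆ S) :
    ∑ m ∈ T, weight t m • f m = ∑ m ∈ S, weight t m • f m := by
  rw [Finset.sum_subset (Finset.subset_union_left (s₁ := T) (s₂ := S)) fun m _ hm => by
      rw [hf m hm, smul_zero],
    ← Finset.sum_subset (Finset.subset_union_right (s₁ := T) (s₂ := S)) fun m _ hm => by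
      rw [weight_eq_zero fun h' => hm (h h'), zero_smul]]

theorem norm_sum_smul_sub_le (hf : ∀ m ∉ T, f m = 0) (t : ι → ℝ) {e : E} {B : ℝ}
    (h : ∀ m ∈ nearPi t, ‖f m - e‖ ≤ B) : ‖∑ m ∈ T, weight t m • f m - e‖ ≤ B := by
  rw [sum_smul_eq hf t (Finset.Subset.refl _)]
  have e1 : e = ∑ m ∈ nearPi t, weight t m • e := by
    rw [← Finset.sum_smul, sum_weight (Finset.Subset.refl _), one_smul]
  conv_lhs => rw [e1, ← Finset.sum_sub_distrib]
  refine (norm_sum_le_of_le (n := fun m => weight t m * B) _ fun m hm => ?_).trans ?_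
  · rw [← smul_sub, norm_smul, Real.norm_of_nonneg (weight_nonneg _ _)]
    exact mul_le_mul_of_nonneg_left (h m hm) (weight_nonneg _ _)
  · rw [← Finset.sum_mul, sum_weight (Finset.Subset.refl _), one_mul]

/-- The weights at t and those at t' both add up to 1, so a reference value f(m₀) can be subtracted
and only the oscillation of f over neighbouring lattice points enters. Each coordinate has at most
four relevant integers, two near t and two near t', hence the power of 4. -/
theorem norm_sum_smul_sub_sum_smul_le {κ : ℝ≥0} (hκ : LipschitzWith κ bump)
    (hf : ∀ m ∉ T, f m = 0) {B : ℝ} (h : ∀ m m', (∀ j, |m j - m' j| ≤ 3) → ‖f m - f m'‖ ≤ B)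
    {t t' : ι → ℝ} (ht : ‖t - t'‖ ≤ 1) :
    ‖∑ m ∈ T, weight t m • f m - ∑ m ∈ T, weight t' m • f m‖
      ≤ 4 ^ Fintype.card ι * (Fintype.card ι * (κ * ‖t - t'‖) * B) := by
  let S : Finset (ι → ℤ) := Fintype.piFinset fun j => near (t j) ∪ near (t' j)
  have hS : nearPi t ⊆ S := Fintype.piFinset_subset _ _ fun j => Finset.subset_union_left
  have hS' : nearPi t' ⊆ S := Fintype.piFinset_subset _ _ fun j => Finset.subset_union_right
  let m₀ : ι → ℤ := fun j => ⌊t j⌋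
  rw [sum_smul_eq hf t hS, sum_smul_eq hf t' hS', ← Finset.sum_sub_distrib]
  have e : ∑ m ∈ S, (weight t m • f m - weight t' m • f m)
      = ∑ m ∈ S, (weight t m - weight t' m) • (f m - f m₀) := by
    simp only [smul_sub, sub_smul, Finset.sum_sub_distrib, ← Finset.sum_smul, sum_weight hS,
      sum_weight hS']
    simp
  rw [e]
  refine (norm_sum_le_of_le (n := fun _ => Fintype.card ι * (κ * ‖t - t'‖) * B) _
    fun m hm => ?_).trans ?_
  · rw [norm_smul]
    refine mul_le_mul (abs_weight_sub_le hκ t t' m) (h m m₀ fun j => ?_) (norm_nonneg _)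
      (by positivity)
    have h1 : |t j - t' j| ≤ 1 := (norm_le_pi_norm (t - t') j).trans ht
    -- The radius 3 is the sum of this 2 and the distance 1 from t to the reference point m₀.
    have h2 : |t j - m j| ≤ 2 := by
      rcases Finset.mem_union.1 (Fintype.mem_piFinset.1 hm j) with h | h
      · linarith [abs_sub_le_of_mem_near h]
      · linarith [abs_sub_le_of_mem_near h, abs_sub_le (t j) (t' j) (m j)]
    have h3 : |t j - m₀ j| ≤ 1 := abs_sub_le_of_mem_near (by simp [near, m₀])
    have h4 := abs_sub_le (m j : ℝ) (t j) (m₀ j)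
    rw [abs_sub_comm (m j : ℝ) (t j)] at h4
    have h5 : ((|m j - m₀ j| : ℤ) : ℝ) ≤ (3 : ℤ) := by push_cast; linarith
    exact Int.cast_le.1 h5
  · have hB : 0 ≤ B := (norm_nonneg _).trans (h 0 0 fun j => by simp)
    rw [Finset.sum_const, nsmul_eq_mul]
    refine mul_le_mul_of_nonneg_right ?_ (by positivity)
    have h1 : S.card ≤ 4 ^ Fintype.card ι := by
      rw [Fintype.card_piFinset, ← Finset.card_univ]
      refine Finset.prod_le_pow_card _ _ _ fun j _ => ?_
      refine (Finset.card_union_le _ _).trans ?_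
      exact add_le_add Finset.card_le_two Finset.card_le_two
    exact_mod_cast h1

end LatticePartition

end

noncomputable section

set_option linter.unusedSectionVars false

open scoped NNReal BoundedContinuousFunction ZeroAtInfty
open Coeff

section elementary

variable {H : Type*} [NormedAddCommGroup H] [InnerProductSpace ℝ H] {V : AffineSubspace ℝ H}

/-! ### Finite sums of elementary tensors -/

theorem apply_mem_core {F : ℝ × V → Coeff H} (hF : F ∈ Submodule.span ℂ (elementary V))
    (p : ℝ × V) : F p ∈ core V.direction := by
  induction hF using Submodule.span_induction with
  | mem F hF =>
    obtain ⟨g, h, κ, hh, hκ, rfl⟩ := hF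
    exact Submodule.smul_mem _ _ (mem_core (hh _) hκ)
  | zero => exact zero_mem _
  | add F F' _ _ hF hF' => exact add_mem hF hF'
  | smul c F _ hF => exact Submodule.smul_mem _ c hF

theorem apply_mem_cpt {F : ℝ × V → Coeff H} (hF : F ∈ Submodule.span ℂ (elementary V))
    (p : ℝ × V) : F p ∈ cpt V.direction := core_le_cpt _ (apply_mem_core hF p)

theorem continuous_of_mem_span {F : ℝ × V → Coeff H}
    (hF : F ∈ Submodule.span ℂ (elementary V)) : Continuous F := by
  induction hF using Submodule.span_induction with
  | mem F hF =>
    obtain ⟨g, h, κ, hh, hκ, rfl⟩ := hF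
    exact Continuous.smul (g.continuous.comp continuous_fst)
      ((h.continuous.comp continuous_snd).mul continuous_const)
  | zero => exact continuous_const
  | add F F' _ _ hF hF' => exact hF.add hF'
  | smul c F _ hF => exact Continuous.smul (continuous_const (y := c)) hF

theorem smul_mem_span_elementary {g : ℝ → ℝ} (hg : Continuous g) (hgc : HasCompactSupport g)
    {ψ : V → ℝ} (hψ : Continuous ψ) (hψc : HasCompactSupport ψ) {b : Coeff H}
    (hb : b ∈ core V.direction) :
    (fun p : ℝ × V => (g p.1 * ψ p.2) • b) ∈ Submodule.span ℂ (elementary V) := by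
  induction hb using core_induction with
  | h b hb κ hκ =>
    refine Submodule.subset_span ⟨⟨⟨fun t => (g t : ℂ), Complex.continuous_ofReal.comp hg⟩,
      (hgc.comp_left (g := fun t : ℝ => (t : ℂ)) Complex.ofReal_zero).is_zero_at_infty⟩,
      ⟨⟨fun v => (ψ v : ℂ) • b, Continuous.smul (Complex.continuous_ofReal.comp hψ) continuous_const⟩,
      (hψc.comp_left (g := fun t : ℝ => (t : ℂ) • b) (by simp)).is_zero_at_infty⟩, κ,
      fun v => Submodule.smul_mem _ _ hb, hκ, ?_⟩
    funext p
    change (g p.1 * ψ p.2) • (b * op κ) = (g p.1 : ℂ) • ((ψ p.2 : ℂ) • b * op κ)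
    rw [smul_mul_assoc, smul_smul, ← Complex.ofReal_mul, Complex.coe_smul]
  | h0 => simp only [smul_zero]; exact zero_mem _
  | hadd x y _ _ hx hy => simp only [smul_add]; exact add_mem hx hy
  | hsmul c x _ hx =>
    have e : (fun p : ℝ × V => (g p.1 * ψ p.2) • c • x)
        = c • fun p : ℝ × V => (g p.1 * ψ p.2) • x := by
      funext p; exact smul_comm _ _ _
    rw [e]
    exact Submodule.smul_mem _ c hx

/-! ### Directional derivatives -/

theorem IsDirDeriv.apply_mem_cpt {F D : ℝ × V → Coeff H} {a : ℝ} {w : V.direction}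
    (h : IsDirDeriv V F a w D) (hF : ∀ p, F p ∈ cpt V.direction) (p : ℝ × V) :
    D p ∈ cpt V.direction := by
  have h1 := hasDerivAt_iff_tendsto_slope.1 (h p.1 p.2)
  refine (isClosed_cpt V.direction).mem_of_tendsto h1 (Filter.Eventually.of_forall fun t => ?_)
  rw [slope_def_module]
  exact Submodule.smul_of_tower_mem _ _ (sub_mem (hF _) (hF _))

/-- The isometry σ with γ ↦ -γ recovers the even and odd parts of D from averages of G and σG, each
of norm at most ‖G‖, and D is their sum or difference. This turns norm bounds in A(V) ⊗ K into
pointwise bounds. -/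
theorem IsBott.norm_apply_le {D : ℝ × V → Coeff H} {G : Fun H} (h : IsBott V D G)
    (hD : ∀ p, D p ∈ cpt V.direction) (p : ℝ × V) : ‖D p‖ ≤ 2 * ‖G‖ := by
  obtain ⟨σ, hσ, hσγ⟩ : ∃ A : Isom H, FixesDir A V.direction ∧ A (vec 1 0) = vec (-1) 0 :=
    exists_isom_vec (zero_mem _) (zero_mem _) (by rw [norm_vec, norm_vec]; simp)
  have hσ1 : lin σ γ = -γ := by
    rw [γ_eq, lin_cgen, hσγ]
    have : vec (-1) (0 : H) = (-1 : ℝ) • vec 1 0 := by rw [vec_smul]; simp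
    rw [this, cgen_smul]; simp
  have key (s : ℝ≥0) (v : V) : ‖D (s, v)‖ ≤ 2 * ‖G‖ ∧ ‖D (-s, v)‖ ≤ 2 * ‖G‖ := by
    have h1 := h s v 0 (zero_mem _)
    have hG : ‖G (s, v + 0)‖ ≤ ‖G‖ := G.norm_coe_le_norm _
    simp only [← norm_vec, norm_vec_zero, smul_zero] at h1
    rcases eq_or_ne (s : ℝ) 0 with h0 | h0
    -- At s = 0 the direction in the Bott formula is 0/0, but the odd part is zero anyway.
    · have e : D (s, v) = G (s, v + 0) := by
        rw [h1, h0, div_zero, neg_zero, sub_self, smul_zero, mul_zero, add_zero, ← two_smul ℂ,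
          smul_smul]
        norm_num
      rw [h0, neg_zero, and_self, ← h0, e]
      linarith [norm_nonneg G]
    · rw [div_self h0] at h1
      change _ = _ + γ * _ at h1
      set E := (1 / 2 : ℂ) • (D (s, v) + D (-s, v)) with hE
      set O := (1 / 2 : ℂ) • (D (s, v) - D (-s, v)) with hO
      have hEm : E ∈ cpt V.direction := Submodule.smul_mem _ _ (add_mem (hD _) (hD _))
      have hOm : O ∈ cpt V.direction := Submodule.smul_mem _ _ (sub_mem (hD _) (hD _))
      have h2 : lin σ (G (s, v + 0)) = E - γ * O := by
        rw [h1, map_add, map_mul, cpt_lin_eq σ hσ hEm, cpt_lin_eq σ hσ hOm, hσ1, neg_mul,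
          sub_eq_add_neg]
      have hG' : ‖lin σ (G (s, v + 0))‖ ≤ ‖G‖ := (norm_lin_le _ _).trans hG
      have half (x : Coeff H) : (1 / 2 : ℂ) • x + (1 / 2 : ℂ) • x = x := by
        rw [← add_smul]; norm_num
      have e1 : E = (1 / 2 : ℂ) • (G (s, v + 0) + lin σ (G (s, v + 0))) := by
        rw [h2, h1, show E + γ * O + (E - γ * O) = E + E by abel, smul_add, half]
      have e2 : γ * O = (1 / 2 : ℂ) • (G (s, v + 0) - lin σ (G (s, v + 0))) := by
        rw [h2, h1, show E + γ * O - (E - γ * O) = γ * O + γ * O by abel, smul_add, half]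
      have n1 : ‖E‖ ≤ ‖G‖ := by
        rw [e1, norm_smul]
        have := norm_add_le (G (s, v + 0)) (lin σ (G (s, v + 0)))
        rw [show ‖(1 / 2 : ℂ)‖ = 1 / 2 by norm_num]
        linarith
      have n2 : ‖O‖ ≤ ‖G‖ := by
        rw [← norm_γ_mul, e2, norm_smul]
        have := norm_sub_le (G (s, v + 0)) (lin σ (G (s, v + 0)))
        rw [show ‖(1 / 2 : ℂ)‖ = 1 / 2 by norm_num]
        linarith
      have d1 : D (s, v) = E + O := by
        rw [hE, hO, ← smul_add, show ∀ a b : Coeff H, a + b + (a - b) = a + a by intro a b; abel,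
          smul_add, half]
      have d2 : D (-s, v) = E - O := by
        rw [hE, hO, ← smul_sub, show ∀ a b : Coeff H, a + b - (a - b) = b + b by intro a b; abel,
          smul_add, half]
      rw [d1, d2]
      exact ⟨(norm_add_le _ _).trans (by linarith), (norm_sub_le _ _).trans (by linarith)⟩
  rcases le_total 0 p.1 with h0 | h0
  · exact (key ⟨p.1, h0⟩ p.2).1
  · have h2 : ‖D (-(-p.1), p.2)‖ ≤ 2 * ‖G‖ := (key ⟨-p.1, neg_nonneg.2 h0⟩ p.2).2
    rwa [neg_neg] at h2

theorem shift_shift (v : V) (w w' : V.direction) : shift V (shift V v w) w' = shift V v (w + w') :=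
  Subtype.ext (by simp only [shift, vadd_eq_add, Submodule.coe_add]; abel)

theorem shift_zero (v : V) : shift V v 0 = v := Subtype.ext (by simp [shift])

/-- The mean value inequality along the segment from q to p, run at unit speed for the Euclidean
norm. The factor 2 pays for the passage to the supremum metric of ℝ × V. -/
theorem lipschitzWith_of_isDirDeriv {F : ℝ × V → Coeff H} {C : ℝ≥0}
    (h : ∀ (a : ℝ) (w : V.direction), a ^ 2 + ‖w‖ ^ 2 ≤ 1 →
      ∃ D, IsDirDeriv V F a w D ∧ ∀ p, ‖D p‖ ≤ C) : LipschitzWith (2 * C) F := by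
  refine LipschitzWith.of_dist_le_mul fun p q => ?_
  set a : ℝ := p.1 - q.1 with ha
  set w : V.direction := ⟨p.2 - q.2, AffineSubspace.vsub_mem_direction p.2.2 q.2.2⟩ with hw
  set L : ℝ := √(a ^ 2 + ‖w‖ ^ 2) with hL
  have hL2 : L ^ 2 = a ^ 2 + ‖w‖ ^ 2 := Real.sq_sqrt (by positivity)
  have hL0 : 0 ≤ L := Real.sqrt_nonneg _
  have had : |a| ≤ dist p q := by rw [ha, ← Real.dist_eq]; exact le_max_left _ _
  have hwd : ‖w‖ ≤ dist p q := by
    have : ‖w‖ = dist p.2 q.2 := by rw [Subtype.dist_eq, dist_eq_norm]; rfl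
    rw [this]; exact le_max_right _ _
  have hLd : L ≤ 2 * dist p q := by
    refine Real.sqrt_le_iff.2 ⟨by positivity, ?_⟩
    have := sq_le_sq' (by linarith [abs_nonneg a, dist_nonneg (x := p) (y := q)]) had
    rw [sq_abs] at this
    nlinarith [norm_nonneg w, sq_nonneg (dist p q)]
  rcases eq_or_ne L 0 with h0 | h0
  · have h1 : a ^ 2 + ‖w‖ ^ 2 = 0 := by rw [← hL2, h0]; norm_num
    have h2 : a = 0 := by nlinarith [sq_nonneg a, sq_nonneg ‖w‖]
    have h3 : w = 0 := by
      have : ‖w‖ = 0 := by nlinarith [sq_nonneg a, sq_nonneg ‖w‖]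
      exact norm_eq_zero.1 this
    have e : p = q := Prod.ext (sub_eq_zero.1 h2)
      (Subtype.ext (sub_eq_zero.1 (congrArg Subtype.val h3)))
    rw [e, dist_self]
    positivity
  obtain ⟨D, hD, hDC⟩ := h (L⁻¹ * a) (L⁻¹ • w) (by
    rw [norm_smul, mul_pow, mul_pow, Real.norm_of_nonneg (by positivity), ← mul_add, ← hL2,
      inv_pow, inv_mul_cancel₀ (by positivity)])
  let f : ℝ → Coeff H := fun t => F (q.1 + t * (L⁻¹ * a), shift V q.2 (t • L⁻¹ • w))
  have hf (t : ℝ) : HasDerivAt f (D (q.1 + t * (L⁻¹ * a), shift V q.2 (t • L⁻¹ • w))) t := by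
    have h1 := hD (q.1 + t * (L⁻¹ * a)) (shift V q.2 (t • L⁻¹ • w))
    rw [← sub_self t] at h1
    have h2 := h1.comp_sub_const t t
    refine h2.congr_of_eventuallyEq (Filter.Eventually.of_forall fun x => ?_)
    simp only [f, shift_shift]
    congr 2
    · ring
    · rw [← add_smul]; congr 2; ring
  have h1 := Convex.norm_image_sub_le_of_norm_hasDerivWithin_le (f := f) (s := Set.univ) (x := 0)
    (y := L) (C := C) (fun t _ => (hf t).hasDerivWithinAt) (fun t _ => hDC _) convex_univ
    (Set.mem_univ _) (Set.mem_univ _)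
  have e0 : f 0 = F q := by simp only [f, zero_mul, zero_smul, add_zero, shift_zero]
  have eL : f L = F p := by
    simp only [f]
    rw [smul_smul, ← mul_assoc, mul_inv_cancel₀ h0, one_mul, one_smul]
    congr 1
    refine Prod.ext (by simp [ha]) (Subtype.ext ?_)
    simp [shift, hw]
  rw [e0, eL, sub_zero, Real.norm_of_nonneg hL0] at h1
  rw [dist_eq_norm]
  refine h1.trans ?_
  push_cast
  nlinarith [C.2]

end elementary

end

noncomputable section

set_option linter.unusedSectionVars false

open scoped NNReal BoundedContinuousFunction ZeroAtInfty
open Coeff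

section approximation

variable {H : Type*} [NormedAddCommGroup H] [InnerProductSpace ℝ H]

/-! ### Bounded supports -/

/-- `G` vanishes at distance at least `r` from `(0, o)`. -/
def SuppIn (o : H) (r : ℝ) (G : Fun H) : Prop :=
  ∀ p : ℝ≥0 × H, r ≤ ‖vec p.1 (p.2 - o)‖ → G p = 0

theorem norm_vec_abs (s : ℝ) (u : H) : ‖vec |s| u‖ = ‖vec s u‖ := by
  rw [norm_vec, norm_vec, sq_abs]

theorem norm_le_norm_vec (s : ℝ) (u : H) : ‖u‖ ≤ ‖vec s u‖ :=
  le_of_sq_le_sq (by rw [norm_vec_sq]; nlinarith [sq_nonneg s]) (norm_nonneg _)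

theorem abs_le_norm_vec (s : ℝ) (u : H) : |s| ≤ ‖vec s u‖ :=
  le_of_sq_le_sq (by rw [norm_vec_sq, sq_abs]; nlinarith [sq_nonneg ‖u‖]) (norm_nonneg _)

variable {V : AffineSubspace ℝ H} [FiniteDimensional ℝ V.direction] (o : V)

/-- Pythagoras: folding p onto ℝ₊ × V, with the length of its normal vector as first coordinate,
preserves the distance to (0, o). Supports can therefore be checked on ℝ₊ × V. -/
theorem norm_vec_normalVec (p : ℝ≥0 × H) :
    ‖vec ‖normalVec o p‖ ((foot o p.2 : H) - o)‖ = ‖vec p.1 (p.2 - o)‖ := by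
  rw [← sq_eq_sq₀ (norm_nonneg _) (norm_nonneg _), norm_vec_sq, norm_vec_sq, normalVec, norm_vec_sq,
    add_assoc]
  congr 1
  have h1 : inner ℝ (p.2 - foot o p.2) ((foot o p.2 : H) - o) = 0 := by
    rw [real_inner_comm]
    exact sub_foot_mem o p.2 _ (AffineSubspace.vsub_mem_direction (foot o p.2).2 o.2)
  have h2 := norm_add_sq_real (p.2 - foot o p.2) ((foot o p.2 : H) - o)
  rw [h1, sub_add_sub_cancel] at h2
  linarith

theorem IsBott.suppIn {F : ℝ × V → Coeff H} {G : Fun H} (h : IsBott V F G) {r : ℝ}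
    (hF : ∀ (s : ℝ) (v : V), r ≤ ‖vec s ((v : H) - o)‖ → F (s, v) = 0) : SuppIn (o : H) r G := by
  intro p hp
  rw [← norm_vec_normalVec] at hp
  rw [h.apply o p, hF _ _ hp, hF _ _ (by rwa [← norm_vec_abs, abs_neg, norm_vec_abs])]
  simp

theorem MemCoeff.suppIn {G : Fun H} (h : MemCoeff V G) {r : ℝ}
    (hG : ∀ (s : ℝ≥0) (v : V), r ≤ ‖vec s ((v : H) - o)‖ → G (s, v) = 0) : SuppIn (o : H) r G := by
  intro p hp
  rw [← norm_vec_normalVec] at hp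
  have h1 := h.norm_apply_le o p
  rw [hG ‖normalVec o p‖₊ _ hp, norm_zero] at h1
  exact norm_le_zero_iff.1 h1

/-! ### Orthonormal coordinates -/

/-- Orthonormal coordinates of the affine space `V` with origin `o`. -/
def coord : V ≃ₜ (Fin (Module.finrank ℝ V.direction) → ℝ) where
  toFun v := ((stdOrthonormalBasis ℝ V.direction).repr
    ⟨(v : H) - o, AffineSubspace.vsub_mem_direction v.2 o.2⟩).ofLp
  invFun y := shift V o ((stdOrthonormalBasis ℝ V.direction).repr.symm (WithLp.toLp 2 y))
  left_inv v := by
    apply Subtype.ext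
    simp [shift]
  right_inv y := by
    have e (w : V.direction) : (⟨(shift V o w : H) - o,
        AffineSubspace.vsub_mem_direction (shift V o w).2 o.2⟩ : V.direction) = w :=
      Subtype.ext (by simp [shift])
    simp only [e, LinearIsometryEquiv.apply_symm_apply]
  continuous_toFun := by
    refine (PiLp.continuous_ofLp 2 _).comp ((LinearIsometryEquiv.continuous _).comp ?_)
    exact (continuous_subtype_val.sub continuous_const).subtype_mk _
  continuous_invFun := by
    refine Continuous.subtype_mk ?_ _
    exact (continuous_subtype_val.comp ((LinearIsometryEquiv.continuous _).comp
      (PiLp.continuous_toLp 2 _))).add continuous_const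

theorem coord_shift (v : V) (w : V.direction) :
    coord o (shift V v w) = coord o v + ((stdOrthonormalBasis ℝ V.direction).repr w).ofLp := by
  change ((stdOrthonormalBasis ℝ V.direction).repr _).ofLp
    = ((stdOrthonormalBasis ℝ V.direction).repr _).ofLp + _
  rw [← WithLp.ofLp_add, ← map_add]
  congr 2
  apply Subtype.ext
  simp only [shift, vadd_eq_add, Submodule.coe_add]
  abel

theorem abs_repr_le (w : V.direction) (j) :
    |((stdOrthonormalBasis ℝ V.direction).repr w).ofLp j| ≤ ‖w‖ := by
  rw [← (stdOrthonormalBasis ℝ V.direction).repr.norm_map w]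
  exact PiLp.norm_apply_le ((stdOrthonormalBasis ℝ V.direction).repr w) j

theorem abs_coord_le (v : V) (j) : |coord o v j| ≤ ‖(v : H) - o‖ :=
  abs_repr_le (⟨(v : H) - o, AffineSubspace.vsub_mem_direction v.2 o.2⟩ : V.direction) j

theorem dist_le_sum_coord (v v' : V) : dist v v' ≤ ∑ j, |coord o v j - coord o v' j| := by
  let w : V.direction := ⟨(v : H) - v', AffineSubspace.vsub_mem_direction v.2 v'.2⟩
  have h1 : v = shift V v' w := Subtype.ext (by simp [shift, w])
  have h2 (j) : coord o v j - coord o v' j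
      = ((stdOrthonormalBasis ℝ V.direction).repr w).ofLp j := by
    conv_lhs => rw [h1, coord_shift]
    simp
  simp only [h2]
  rw [Subtype.dist_eq, dist_eq_norm]
  change ‖w‖ ≤ _
  conv_lhs => rw [← (stdOrthonormalBasis ℝ V.direction).sum_repr w]
  refine norm_sum_le_of_le _ fun j _ => ?_
  rw [norm_smul, OrthonormalBasis.norm_eq_one, mul_one, Real.norm_eq_abs]

end approximation

end

noncomputable section

set_option linter.unusedSectionVars false

open scoped NNReal BoundedContinuousFunction ZeroAtInfty
open Coeff

/-! ### Approximation by finite sums of elementary tensors -/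

section approximation

variable {H : Type*} [NormedAddCommGroup H] [InnerProductSpace ℝ H]

open LatticePartition

/-- The product bump function at the lattice point `m`, at scale `δ`. -/
def scaledBump {d : ℕ} (δ : ℝ) (m : Fin d → ℤ) (y : Fin d → ℝ) : ℝ :=
  ∏ j, bump (δ⁻¹ * y j - m j)

theorem contDiff_scaledBump {d : ℕ} (δ : ℝ) (m : Fin d → ℤ) : ContDiff ℝ 1 (scaledBump δ m) := by
  refine contDiff_prod fun j _ => contDiff_bump.comp ?_
  exact (contDiff_const.mul (contDiff_apply ℝ ℝ j)).sub contDiff_const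

theorem abs_inv_mul_sub {δ : ℝ} (hδ : 0 < δ) (y m : ℝ) : |δ⁻¹ * y - m| = δ⁻¹ * |y - δ * m| := by
  rw [← abs_of_pos (inv_pos.2 hδ), ← abs_mul, abs_of_pos (inv_pos.2 hδ)]
  congr 1
  field_simp

theorem one_le_abs_inv_mul_sub {δ : ℝ} (hδ : 0 < δ) {y m : ℝ} (h : δ ≤ |y - δ * m|) :
    1 ≤ |δ⁻¹ * y - m| := by
  rw [abs_inv_mul_sub hδ, ← inv_mul_cancel₀ hδ.ne']
  exact mul_le_mul_of_nonneg_left h (inv_pos.2 hδ).le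

theorem hasCompactSupport_scaledBump {d : ℕ} {δ : ℝ} (hδ : 0 < δ) (m : Fin d → ℤ) :
    HasCompactSupport (scaledBump δ m) := by
  refine HasCompactSupport.intro (isCompact_closedBall (fun j => δ * m j) δ) fun y hy => ?_
  rw [Metric.mem_closedBall, dist_pi_le_iff hδ.le] at hy
  push Not at hy
  obtain ⟨j, hj⟩ := hy
  rw [Real.dist_eq] at hj
  exact Finset.prod_eq_zero (Finset.mem_univ j) (bump_eq_zero (one_le_abs_inv_mul_sub hδ hj.le))

theorem contDiff_bump_scaled (δ : ℝ) (m : ℤ) : ContDiff ℝ 1 fun s => bump (δ⁻¹ * s - m) :=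
  contDiff_bump.comp ((contDiff_const.mul contDiff_id).sub contDiff_const)

theorem hasCompactSupport_bump_scaled {δ : ℝ} (hδ : 0 < δ) (m : ℤ) :
    HasCompactSupport fun s => bump (δ⁻¹ * s - m) := by
  refine HasCompactSupport.intro (isCompact_closedBall (δ * m) δ) fun y hy => ?_
  rw [Metric.mem_closedBall, not_le, Real.dist_eq] at hy
  exact bump_eq_zero (one_le_abs_inv_mul_sub hδ hy.le)

variable {V : AffineSubspace ℝ H} [FiniteDimensional ℝ V.direction] (o : V)

/-- The coordinates of `ℝ × V` at scale `δ`. -/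
def scaledCoord (δ : ℝ) (p : ℝ × V) : Option (Fin (Module.finrank ℝ V.direction)) → ℝ
  | none => δ⁻¹ * p.1
  | some j => δ⁻¹ * coord o p.2 j

/-- The point of `ℝ × V` with given lattice coordinates at scale `δ`. -/
def gridPoint (δ : ℝ) (m : Option (Fin (Module.finrank ℝ V.direction)) → ℤ) : ℝ × V :=
  (δ * m none, (coord o).symm fun j => δ * m (some j))

theorem weight_scaledCoord (δ : ℝ) (p : ℝ × V) (m) :
    weight (scaledCoord o δ p) m
      = bump (δ⁻¹ * p.1 - m none) * scaledBump δ (fun j => m (some j)) (coord o p.2) :=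
  Fintype.prod_option _

theorem abs_scaledCoord_sub {δ : ℝ} (hδ : 0 < δ) (p : ℝ × V)
    (m : Option (Fin (Module.finrank ℝ V.direction)) → ℤ) :
    |p.1 - δ * m none| = δ * |scaledCoord o δ p none - m none| ∧
    ∀ j, |coord o p.2 j - δ * m (some j)| = δ * |scaledCoord o δ p (some j) - m (some j)| := by
  simp only [scaledCoord, abs_inv_mul_sub hδ, mul_inv_cancel_left₀ hδ.ne', implies_true, and_self]

theorem dist_gridPoint_le {δ C : ℝ} (hδ : 0 < δ) {p : ℝ × V} {m}
    (h : ∀ j, |scaledCoord o δ p j - m j| ≤ C) :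
    |p.1 - δ * m none| ≤ δ * C ∧
      dist p.2 (gridPoint o δ m).2 ≤ Module.finrank ℝ V.direction * (δ * C) := by
  obtain ⟨h1, h2⟩ := abs_scaledCoord_sub o hδ p m
  refine ⟨h1.trans_le (mul_le_mul_of_nonneg_left (h none) hδ.le), ?_⟩
  refine (dist_le_sum_coord o _ _).trans ?_
  refine (Finset.sum_le_card_nsmul _ _ (δ * C) fun j _ => ?_).trans (by simp)
  rw [gridPoint, Homeomorph.apply_symm_apply, h2]
  exact mul_le_mul_of_nonneg_left (h (some j)) hδ.le

theorem scaledCoord_gridPoint {δ : ℝ} (hδ : 0 < δ) (m) :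
    scaledCoord o δ (gridPoint o δ m) = fun j => (m j : ℝ) := by
  funext j
  cases j with
  | none => simp only [scaledCoord, gridPoint, inv_mul_cancel_left₀ hδ.ne']
  | some j =>
    simp only [scaledCoord, gridPoint, Homeomorph.apply_symm_apply, inv_mul_cancel_left₀ hδ.ne']

theorem dist_le_add {Y : Type*} [PseudoMetricSpace Y] (p q : ℝ × Y) :
    dist p q ≤ |p.1 - q.1| + dist p.2 q.2 := by
  rw [← Real.dist_eq]
  exact max_le (le_add_of_nonneg_right dist_nonneg) (le_add_of_nonneg_left dist_nonneg)

-- F, the Bott preimage of G, is sampled on a lattice of mesh δ and interpolated with a smooth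
-- partition of unity. Derivatives of the weights grow like δ⁻¹, but they meet only the oscillation
-- of the samples over neighbouring lattice points, which is at most δb. The derivative bound is
-- thus independent of δ, hence of ε, and the order of the quantifiers records that it depends only
-- on the dimension and the Lipschitz constant.
set_option maxHeartbeats 1000000 in
theorem MemCoeff.exists_approximation (d : ℕ) (K : ℝ≥0) : ∃ c : ℝ, ∀ (V : AffineSubspace ℝ H)
    [FiniteDimensional ℝ V.direction], Module.finrank ℝ V.direction = d → ∀ (o : V) (r : ℝ)
    (G : Fun H), MemCoeff V G → LipschitzWith K G → SuppIn (o : H) r G → ∀ ε > 0,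
    ∃ F ∈ Submodule.span ℂ (elementary V), ∃ G' : Fun H, IsBott V F G' ∧ ‖G - G'‖ ≤ ε ∧
      SuppIn (o : H) (r + 1) G' ∧ ∀ (a : ℝ) (w : V.direction), a ^ 2 + ‖w‖ ^ 2 ≤ 1 →
        ∃ D ∈ Submodule.span ℂ (elementary V), IsDirDeriv V F a w D ∧
          ∃ GD : Fun H, IsBott V D GD ∧ ‖GD‖ ≤ c := by
  obtain ⟨κ, hκ⟩ := exists_lipschitzWith_bump
  -- δb bounds the oscillation of the samples: F is 3K-Lipschitz, relevant lattice points differ by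
  -- at most 3 steps in each of d + 1 coordinates, and each of two samples has an error δ.
  set b : ℝ := 9 * K * (d + 1) + 2 with hb
  have hb0 : 0 ≤ b := by positivity
  refine ⟨2 * (4 ^ (d + 1) * ((d + 1) * κ * b)), fun V _ hd o r G hG hK hr ε hε => ?_⟩
  obtain ⟨F, hFm, hFG, hFK, hF0⟩ := hG.exists_isBott hK
  -- The first condition keeps the growth of the support within 1. The second controls the error,
  -- with the factor 2 of `IsBott.norm_le`.
  obtain ⟨δ, hδ, hδ1, hδε⟩ : ∃ δ : ℝ, 0 < δ ∧ δ * (d + 1) ≤ 1 ∧ 2 * (δ * b) ≤ ε := by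
    refine ⟨min (1 / (d + 1)) (ε / (2 * (b + 1))), by positivity, ?_, ?_⟩
    · calc _ ≤ 1 / (d + 1 : ℝ) * (d + 1) :=
            mul_le_mul_of_nonneg_right (min_le_left _ _) (by positivity)
        _ = 1 := by field_simp
    · calc 2 * (min (1 / (d + 1 : ℝ)) (ε / (2 * (b + 1))) * b)
          ≤ 2 * (ε / (2 * (b + 1)) * (b + 1)) := by
            gcongr
            · exact min_le_right _ _
            · linarith
        _ = ε := by field_simp
  have hFr (s : ℝ) (v : V) (h : r ≤ ‖vec s ((v : H) - o)‖) : F (s, v) = 0 := by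
    rw [← norm_vec_abs] at h
    have h1 := hF0 ⟨|s|, abs_nonneg s⟩ v (hr _ h)
    rcases abs_cases s with h2 | h2
    · have h3 : F (|s|, v) = 0 := h1.1
      rwa [h2.1] at h3
    · have h3 : F (-|s|, v) = 0 := h1.2
      rwa [h2.1, neg_neg] at h3
  -- the values at the lattice points
  have hex (m) : ∃ x ∈ core V.direction, ‖x - F (gridPoint o δ m)‖ ≤ δ ∧
      (F (gridPoint o δ m) = 0 → x = 0) := by
    -- Where F vanishes the sample is exactly zero, so that only finitely many samples are nonzero
    -- and supports stay controlled.
    by_cases h0 : F (gridPoint o δ m) = 0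
    · exact ⟨0, zero_mem _, by rw [h0, sub_self, norm_zero]; exact hδ.le, fun _ => rfl⟩
    · obtain ⟨x, hx, hxd⟩ := Metric.mem_closure_iff.1 (mem_cpt_iff.1 (hFm (gridPoint o δ m))) δ hδ
      rw [dist_comm, dist_eq_norm] at hxd
      exact ⟨x, hx, hxd.le, fun h => absurd h h0⟩
  choose f hfm hfF hf0 using hex
  have hcard : Fintype.card (Option (Fin (Module.finrank ℝ V.direction))) = d + 1 := by
    rw [Fintype.card_option, Fintype.card_fin, hd]
  -- the comparison of `F` with the values at the lattice points
  have hFf {p : ℝ × V} {m} {C : ℝ} (hC : 0 ≤ C) (h : ∀ j, |scaledCoord o δ p j - m j| ≤ C) :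
      ‖f m - F p‖ ≤ δ * (3 * K * (d + 1) * C + 1) := by
    obtain ⟨h1, h2⟩ := dist_gridPoint_le o hδ h
    have h3 := hFK.dist_le_mul p (gridPoint o δ m)
    rw [hd] at h2
    have h4 : dist p (gridPoint o δ m) ≤ δ * (d + 1) * C := by
      have := dist_le_add p (gridPoint o δ m)
      change _ ≤ |p.1 - δ * m none| + _ at this
      linarith
    have h5 : ((3 * K : ℝ≥0) : ℝ) * dist p (gridPoint o δ m) ≤ 3 * K * (δ * (d + 1) * C) := by
      push_cast
      exact mul_le_mul_of_nonneg_left h4 (by positivity)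
    rw [dist_comm, dist_eq_norm] at h3
    have h6 := norm_sub_le_norm_sub_add_norm_sub (f m) (F (gridPoint o δ m)) (F p)
    linarith [hfF m]
  have hff (m m') (h : ∀ j, |m j - m' j| ≤ 3) : ‖f m - f m'‖ ≤ δ * b := by
    have h1 : ‖f m - F (gridPoint o δ m')‖ ≤ δ * (3 * K * (d + 1) * 3 + 1) := by
      refine hFf (by norm_num) fun j => ?_
      rw [scaledCoord_gridPoint o hδ, abs_sub_comm]
      change |(m j : ℝ) - (m' j : ℝ)| ≤ 3
      exact_mod_cast h j
    have h2 := norm_sub_le_norm_sub_add_norm_sub (f m) (F (gridPoint o δ m')) (f m')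
    rw [norm_sub_rev (F _) (f m')] at h2
    have h3 := hfF m'
    rw [hb]
    linarith
  obtain ⟨M, hM⟩ := exists_nat_ge (δ⁻¹ * r)
  let T : Finset (Option (Fin (Module.finrank ℝ V.direction)) → ℤ) :=
    Fintype.piFinset fun _ => Finset.Icc (-(M : ℤ)) M
  have hfsupp (m) (h : f m ≠ 0) : ‖vec (gridPoint o δ m).1 (((gridPoint o δ m).2 : H) - o)‖ < r := by
    by_contra h'
    exact h (hf0 m (hFr _ _ (not_lt.1 h')))
  have hfT : ∀ m ∉ T, f m = 0 := by
    intro m hm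
    by_contra h
    have h1 := hfsupp m h
    refine hm (Fintype.mem_piFinset.2 fun j => ?_)
    have h2 : δ * |(m j : ℝ)| ≤ r := by
      rw [← abs_of_pos hδ, ← abs_mul]
      cases j with
      | none =>
        exact (abs_le_norm_vec (gridPoint o δ m).1 _).trans h1.le
      | some j =>
        have h3 := abs_coord_le o (gridPoint o δ m).2 j
        rw [gridPoint, Homeomorph.apply_symm_apply] at h3
        exact h3.trans ((norm_le_norm_vec _ _).trans h1.le)
    have h3 : |(m j : ℝ)| ≤ M := by
      refine le_trans ?_ hM
      rwa [inv_mul_eq_div, le_div_iff₀ hδ, mul_comm]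
    rw [Finset.mem_Icc]
    have := abs_le.1 h3
    exact ⟨by exact_mod_cast this.1, by exact_mod_cast this.2⟩
  let F' : ℝ × V → Coeff H := fun p => ∑ m ∈ T, weight (scaledCoord o δ p) m • f m
  have hF'F (p : ℝ × V) : ‖F' p - F p‖ ≤ δ * b := by
    refine (norm_sum_smul_sub_le hfT _ (B := δ * (3 * K * (d + 1) * 1 + 1)) fun m hm =>
      hFf zero_le_one fun j => abs_sub_le_of_mem_near (Fintype.mem_piFinset.1 hm j)).trans ?_
    refine mul_le_mul_of_nonneg_left ?_ hδ.le
    rw [hb]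
    nlinarith [K.2, mul_nonneg K.2 (Nat.cast_nonneg (α := ℝ) d)]
  have hF's : F' ∈ Submodule.span ℂ (elementary V) := by
    have e : F' = ∑ m ∈ T, fun p : ℝ × V => (bump (δ⁻¹ * p.1 - m none) *
        scaledBump δ (fun j => m (some j)) (coord o p.2)) • f m := by
      funext p
      rw [Finset.sum_apply]
      simp only [F', weight_scaledCoord]
    rw [e]
    refine Submodule.sum_mem _ fun m _ => ?_
    exact smul_mem_span_elementary (contDiff_bump_scaled δ (m none)).continuous
      (hasCompactSupport_bump_scaled hδ (m none))
      ((contDiff_scaledBump δ _).continuous.comp (coord o).continuous)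
      ((hasCompactSupport_scaledBump hδ _).comp_homeomorph (coord o)) (hfm m)
  have hF'C (p : ℝ × V) : ‖F' p‖ ≤ δ * b + 2 * ‖G‖ := by
    have h1 := hFG.norm_apply_le hFm p
    have h2 := norm_add_le (F' p - F p) (F p)
    rw [sub_add_cancel] at h2
    linarith [hF'F p]
  obtain ⟨G', hG'⟩ := IsBott.exists_of_continuous o (continuous_of_mem_span hF's) hF'C
  refine ⟨F', hF's, G', hG', ?_, ?_, ?_⟩
  · refine ((hFG.sub hG').norm_le o (C := δ * b) (by positivity) fun p => ?_).trans hδε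
    rw [Pi.sub_apply, norm_sub_rev]
    exact hF'F p
  · refine hG'.suppIn o fun s v hs => Finset.sum_eq_zero fun m _ => ?_
    by_contra h0
    have h1 : f m ≠ 0 := fun h => h0 (by rw [h, smul_zero])
    have h2 : ∀ j, |scaledCoord o δ (s, v) j - m j| ≤ 1 := by
      intro j
      by_contra h
      exact h0 (by rw [weight_eq_zero_of_one_le (not_le.1 h).le, zero_smul])
    obtain ⟨h3, h4⟩ := dist_gridPoint_le o hδ h2
    rw [hd] at h4
    have h5 := hfsupp m h1
    have h6 : vec s ((v : H) - o) = vec (gridPoint o δ m).1 (((gridPoint o δ m).2 : H) - o)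
        + vec (s - (gridPoint o δ m).1) ((v : H) - (gridPoint o δ m).2) := by
      rw [← vec_add]; congr 1 <;> abel
    have h7 := norm_vec_le (s - (gridPoint o δ m).1) ((v : H) - (gridPoint o δ m).2)
    rw [Subtype.dist_eq, dist_eq_norm] at h4
    have h8 := norm_add_le (vec (gridPoint o δ m).1 (((gridPoint o δ m).2 : H) - o))
      (vec (s - (gridPoint o δ m).1) ((v : H) - (gridPoint o δ m).2))
    rw [← h6] at h8
    change |s - (gridPoint o δ m).1| ≤ _ at h3
    simp only at h4
    linarith
  · intro a w haw
    set y : Fin (Module.finrank ℝ V.direction) → ℝ :=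
      ((stdOrthonormalBasis ℝ V.direction).repr w).ofLp with hy
    have ha1 : |a| ≤ 1 := abs_le_one_iff_mul_self_le_one.2 (by nlinarith [sq_nonneg ‖w‖])
    have hw1 : ‖w‖ ≤ 1 := by nlinarith [sq_nonneg a, norm_nonneg w]
    -- By the product rule, the derivative is again a finite sum of elementary tensors, so its Bott
    -- image lies in the coefficient algebra.
    let D : ℝ × V → Coeff H := fun p => ∑ m ∈ T,
      (a * deriv (fun s => bump (δ⁻¹ * s - m none)) p.1 *
          scaledBump δ (fun j => m (some j)) (coord o p.2) +
        bump (δ⁻¹ * p.1 - m none) *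
          fderiv ℝ (scaledBump δ fun j => m (some j)) (coord o p.2) y) • f m
    have hDs : D ∈ Submodule.span ℂ (elementary V) := by
      have e : D = ∑ m ∈ T, ((fun p : ℝ × V => (a * deriv (fun s => bump (δ⁻¹ * s - m none)) p.1 *
          scaledBump δ (fun j => m (some j)) (coord o p.2)) • f m) +
          fun p : ℝ × V => (bump (δ⁻¹ * p.1 - m none) *
          fderiv ℝ (scaledBump δ fun j => m (some j)) (coord o p.2) y) • f m) := by
        funext p
        rw [Finset.sum_apply]
        simp only [D, Pi.add_apply, add_smul]
      rw [e]
      refine Submodule.sum_mem _ fun m _ => add_mem ?_ ?_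
      · exact smul_mem_span_elementary (g := fun s => a * deriv (fun s => bump (δ⁻¹ * s - m none)) s)
          (continuous_const.mul ((contDiff_bump_scaled δ (m none)).continuous_deriv le_rfl))
          ((hasCompactSupport_bump_scaled hδ (m none)).deriv.mul_left)
          ((contDiff_scaledBump δ _).continuous.comp (coord o).continuous)
          ((hasCompactSupport_scaledBump hδ _).comp_homeomorph (coord o)) (hfm m)
      · exact smul_mem_span_elementary (contDiff_bump_scaled δ (m none)).continuous
          (hasCompactSupport_bump_scaled hδ (m none))
          (ψ := fun v => fderiv ℝ (scaledBump δ fun j => m (some j)) (coord o v) y)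
          ((((contDiff_scaledBump δ _).continuous_fderiv one_ne_zero).comp
            (coord o).continuous).clm_apply continuous_const)
          (((((hasCompactSupport_scaledBump hδ _).fderiv ℝ).comp_left
            (g := fun L : (Fin (Module.finrank ℝ V.direction) → ℝ) →L[ℝ] ℝ => L y) rfl)).comp_homeomorph
              (coord o)) (hfm m)
    have hDF : IsDirDeriv V F' a w D := by
      intro s v
      refine HasDerivAt.fun_sum fun m _ => HasDerivAt.smul_const ?_ (f m)
      simp only [weight_scaledCoord, coord_shift, map_smul, WithLp.ofLp_smul, ← hy]
      have h1 : HasDerivAt (fun h : ℝ => s + h * a) a 0 := by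
        simpa using ((hasDerivAt_id (0 : ℝ)).mul_const a).const_add s
      have h2 : HasDerivAt (fun h : ℝ => coord o v + h • y) y 0 := by
        simpa using ((hasDerivAt_id (0 : ℝ)).smul_const y).const_add (coord o v)
      have h3 : HasDerivAt (fun s => bump (δ⁻¹ * s - m none))
          (deriv (fun s => bump (δ⁻¹ * s - m none)) s) (s + 0 * a) := by
        rw [zero_mul, add_zero]
        exact ((contDiff_bump_scaled δ (m none)).differentiable one_ne_zero s).hasDerivAt
      have h4 : HasFDerivAt (scaledBump δ fun j => m (some j))
          (fderiv ℝ (scaledBump δ fun j => m (some j)) (coord o v))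
          (coord o v + (0 : ℝ) • y) := by
        rw [zero_smul, add_zero]
        exact ((contDiff_scaledBump δ _).differentiable one_ne_zero _).hasFDerivAt
      have h5 := (h3.comp 0 h1).mul (h4.comp_hasDerivAt 0 h2)
      simp only [Function.comp_apply, zero_mul, zero_smul, add_zero] at h5
      rw [mul_comm a]
      exact h5
    -- The derivative is bounded through difference quotients with increment below δ: the factor δ⁻¹
    -- of the scaled coordinates cancels the δ of the oscillation bound.
    have hDC (p : ℝ × V) : ‖D p‖ ≤ 4 ^ (d + 1) * ((d + 1) * κ * b) := by
      refine (hDF p.1 p.2).le_of_lip' (by positivity) ?_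
      filter_upwards [Metric.ball_mem_nhds (0 : ℝ) hδ] with h hh
      rw [Metric.mem_ball, dist_zero_right, Real.norm_eq_abs] at hh
      rw [sub_zero, zero_mul, zero_smul, add_zero, shift_zero]
      have ht : ‖scaledCoord o δ (p.1 + h * a, shift V p.2 (h • w)) - scaledCoord o δ p‖
          ≤ δ⁻¹ * |h| := by
        refine (pi_norm_le_iff_of_nonneg (by positivity)).2 fun j => ?_
        cases j with
        | none =>
          simp only [Pi.sub_apply, scaledCoord]
          rw [← mul_sub, add_sub_cancel_left, norm_mul, norm_mul, Real.norm_of_nonneg (by positivity)]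
          refine mul_le_mul_of_nonneg_left ?_ (by positivity)
          exact mul_le_of_le_one_right (abs_nonneg h) ha1
        | some j =>
          simp only [Pi.sub_apply, scaledCoord, coord_shift, Pi.add_apply, map_smul,
            WithLp.ofLp_smul, Pi.smul_apply, smul_eq_mul]
          rw [← mul_sub, add_sub_cancel_left, norm_mul, norm_mul, Real.norm_of_nonneg (by positivity)]
          refine mul_le_mul_of_nonneg_left ?_ (by positivity)
          exact mul_le_of_le_one_right (abs_nonneg h) ((abs_repr_le w j).trans hw1)
      have h1 : δ⁻¹ * |h| ≤ 1 := by
        rw [inv_mul_le_iff₀ hδ, mul_one]; exact hh.le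
      refine (norm_sum_smul_sub_sum_smul_le hκ hfT hff (ht.trans h1)).trans ?_
      rw [hcard, Real.norm_eq_abs]
      calc (4 : ℝ) ^ (d + 1) * ((d + 1 : ℕ) * (κ * ‖scaledCoord o δ
            (p.1 + h * a, shift V p.2 (h • w)) - scaledCoord o δ p‖) * (δ * b))
          ≤ (4 : ℝ) ^ (d + 1) * ((d + 1 : ℕ) * (κ * (δ⁻¹ * |h|)) * (δ * b)) := by gcongr
        _ = 4 ^ (d + 1) * ((d + 1) * κ * b) * |h| := by push_cast; field_simp
    obtain ⟨GD, hGD⟩ := IsBott.exists_of_continuous o (continuous_of_mem_span hDs) hDC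
    exact ⟨D, hDs, hDF, GD, hGD, hGD.norm_le o (by positivity) hDC⟩

end approximation

end

noncomputable section

set_option linter.unusedSectionVars false

open scoped NNReal BoundedContinuousFunction ZeroAtInfty
open Coeff

/-! ### Comparison of the two notions of support -/

section supports

variable {H : Type*} [NormedAddCommGroup H] [InnerProductSpace ℝ H]
  {V : AffineSubspace ℝ H} [FiniteDimensional ℝ V.direction] (o : V)

theorem MemCoeff.mem_coeffAlg {G : Fun H} (hG : MemCoeff V G) {K : ℝ≥0} (hK : LipschitzWith K G)
    {r : ℝ} (hr : SuppIn (o : H) r G) : G ∈ coeffAlg V := by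
  obtain ⟨c, hc⟩ := MemCoeff.exists_approximation (H := H) (Module.finrank ℝ V.direction) K
  refine Metric.mem_closure_iff.2 fun ε hε => ?_
  obtain ⟨F, hF, G', hG', h, -⟩ := hc V rfl o r G hG hK hr (ε / 2) (by positivity)
  exact ⟨G', ⟨F, hF, hG'⟩, by rw [dist_eq_norm]; linarith⟩

theorem MemCoeff.suppIn_of_coeffSupport {G : Fun H} (hG : MemCoeff V G) {r : ℝ}
    (h : coeffSupport V G ⊆ {p | (p.1 : ℝ) ^ 2 + ‖(p.2 : H) - o‖ ^ 2 < r ^ 2}) (hr : 0 ≤ r) :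
    SuppIn (o : H) r G := by
  refine hG.suppIn o fun s v hs => ?_
  by_contra h0
  have h1 : (s, v) ∈ coeffSupport V G := fun g hg => ⟨(s, v), smul_ne_zero hg h0⟩
  have h2 : (s : ℝ) ^ 2 + ‖(v : H) - o‖ ^ 2 < r ^ 2 := h h1
  rw [← norm_vec_sq] at h2
  exact absurd hs (not_le.2 (lt_of_pow_lt_pow_left₀ 2 hr h2))

include o in
theorem properSpace_coe : ProperSpace V := by
  refine ProperSpace.of_isCompact_closedBall_of_le 0 fun x r _ => ?_
  have h : Metric.closedBall x r ⊆ shift V x '' Metric.closedBall 0 r := by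
    intro y hy
    refine ⟨⟨(y : H) - x, AffineSubspace.vsub_mem_direction y.2 x.2⟩, ?_, Subtype.ext ?_⟩
    · rw [mem_closedBall_zero_iff]
      rw [Metric.mem_closedBall, Subtype.dist_eq, dist_eq_norm] at hy
      exact hy
    · simp [shift]
  refine ((isCompact_closedBall (0 : V.direction) r).image ?_).of_isClosed_subset
    Metric.isClosed_closedBall h
  exact (continuous_subtype_val.add continuous_const).subtype_mk _

/-- The support in the sense of central multipliers is closed and may contain points at distance
exactly r, hence the larger radius r'. A tent function of radius half the gap tests a point outside.
-/
theorem SuppIn.coeffSupport_subset {G : Fun H} {r r' : ℝ} (hG : SuppIn (o : H) r G)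
    (h : r < r') : coeffSupport V G ⊆ {p | (p.1 : ℝ) ^ 2 + ‖(p.2 : H) - o‖ ^ 2 < r' ^ 2} := by
  have := properSpace_coe o
  intro p hp
  by_contra h0
  have h1 : r' ≤ ‖vec p.1 ((p.2 : H) - o)‖ := by
    refine le_of_sq_le_sq ?_ (norm_nonneg _)
    rw [norm_vec_sq]
    exact not_lt.1 h0
  set η : ℝ := (r' - r) / 2 with hη
  have hη0 : 0 < η := by rw [hη]; linarith
  let g : ℝ≥0 × V → ℝ := fun q => max (1 - η⁻¹ * dist q p) 0
  have hgc : HasCompactSupport g :=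
    HasCompactSupport.intro (isCompact_closedBall p η) fun q hq => by
      rw [Metric.mem_closedBall, not_le] at hq
      refine max_eq_right (sub_nonpos.2 ?_)
      rw [← inv_mul_cancel₀ hη0.ne']
      exact mul_le_mul_of_nonneg_left hq.le (by positivity)
  have hg : Continuous g :=
    (continuous_const.sub (continuous_const.mul (continuous_id.dist continuous_const))).max
      continuous_const
  obtain ⟨q, hq⟩ := hp ⟨⟨fun q => (g q : ℂ), Complex.continuous_ofReal.comp hg⟩,
    (hgc.comp_left (g := fun t : ℝ => (t : ℂ)) Complex.ofReal_zero).is_zero_at_infty⟩ (by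
      change (g p : ℂ) ≠ 0
      simp [g])
  have hq' : (g q : ℂ) • G (q.1, (q.2 : H)) ≠ 0 := hq
  have hgq : g q ≠ 0 := fun h => hq' (by rw [h, Complex.ofReal_zero, zero_smul])
  have hGq : G (q.1, (q.2 : H)) ≠ 0 := fun h => hq' (by rw [h, smul_zero])
  have hqp : dist q p ≤ η := by
    by_contra h
    refine hgq (max_eq_right (sub_nonpos.2 ?_))
    rw [← inv_mul_cancel₀ hη0.ne']
    exact mul_le_mul_of_nonneg_left (not_le.1 h).le (by positivity)
  have h2 : ‖vec q.1 ((q.2 : H) - o)‖ < r := by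
    by_contra h
    exact hGq (hG _ (not_lt.1 h))
  have h3 : vec p.1 ((p.2 : H) - o) = vec q.1 ((q.2 : H) - o)
      + vec ((p.1 : ℝ) - q.1) ((p.2 : H) - q.2) := by
    rw [← vec_add]; congr 1 <;> abel
  have h4 := norm_vec_le ((p.1 : ℝ) - q.1) ((p.2 : H) - q.2)
  have h5 : |(p.1 : ℝ) - q.1| ≤ η := by
    rw [abs_sub_comm, ← NNReal.dist_eq]
    exact (le_max_left _ _).trans hqp
  have h6 : ‖(p.2 : H) - q.2‖ ≤ η := by
    rw [← dist_eq_norm, dist_comm, ← Subtype.dist_eq]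
    exact (le_max_right _ _).trans hqp
  have h7 := norm_add_le (vec q.1 ((q.2 : H) - o)) (vec ((p.1 : ℝ) - q.1) ((p.2 : H) - q.2))
  rw [← h3] at h7
  linarith

end supports

/-! ### Tame sequences and their relation to admissible ones -/

section tame

open Filter

variable {X : ℕ → Type u} [∀ n, MetricSpace (X n)] {H : Type v} [NormedAddCommGroup H]
  [InnerProductSpace ℝ H] (𝔢 : FibredCoarseEmbedding.{u, v, w} X H)

namespace FibredCoarseEmbedding

theorem pt_mem_W {n : ℕ} {k : ℝ} {x z : X n} (h : dist z x ≤ 𝔢.l n) (hk : dist z x ≤ k) :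
    𝔢.pt n x z ∈ 𝔢.W n k x := subset_affineSpan ℝ _ ⟨z, h, hk, rfl⟩

theorem pt_self_mem_W {n : ℕ} {k : ℝ} (hk : 0 ≤ k) (x : X n) : 𝔢.pt n x x ∈ 𝔢.W n k x :=
  𝔢.pt_mem_W (by rw [dist_self]; exact 𝔢.l_nonneg' n) (by rwa [dist_self])

theorem W_mono {n : ℕ} {k k' : ℝ} (h : k ≤ k') (x : X n) : 𝔢.W n k x ≤ 𝔢.W n k' x := by
  refine affineSpan_mono ℝ ?_
  rintro _ ⟨z, hz, hzk, rfl⟩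
  exact ⟨z, hz, hzk.trans h, rfl⟩

theorem W_le_V (n : ℕ) (k : ℝ) (x : X n) : 𝔢.W n k x ≤ 𝔢.V n := by
  refine affineSpan_mono ℝ ?_
  rintro _ ⟨z, hz, -, rfl⟩
  exact ⟨x, z, hz, rfl⟩

theorem trans_pt {n : ℕ} {x y z : X n} (hx : dist z x ≤ 𝔢.l n) (hy : dist z y ≤ 𝔢.l n) :
    𝔢.trans n x y (𝔢.pt n y z) = 𝔢.pt n x z := 𝔢.trans_spec n hx hy _

/-- t_{xy} carries t_y(z)(s(z)) to t_x(z)(s(z)) for z in both trivialised balls, and B(y, k) lies in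
B(x, k + R). -/
theorem map_W_le {n : ℕ} {k R : ℝ} {x y : X n} (hxy : dist x y ≤ R) (h : k + R ≤ 𝔢.l n) :
    (𝔢.W n k y).map (𝔢.trans n x y : H →ᵃ[ℝ] H) ≤ 𝔢.W n (k + R) x := by
  unfold W
  rw [AffineSubspace.map_span]
  refine affineSpan_mono ℝ ?_
  rintro _ ⟨_, ⟨z, hz, hzk, rfl⟩, rfl⟩
  have h1 : dist z x ≤ k + R := by
    rw [dist_comm] at hxy
    linarith [dist_triangle z y x]
  exact ⟨z, h1.trans h, h1, 𝔢.trans_pt (h1.trans h) hz⟩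

variable [∀ n, Fintype (X n)]

theorem finiteDimensional_W (n : ℕ) (k : ℝ) (x : X n) :
    FiniteDimensional ℝ (𝔢.W n k x).direction := by
  refine finiteDimensional_direction_affineSpan_of_finite ℝ ?_
  refine (Set.finite_range (𝔢.pt n x)).subset ?_
  rintro _ ⟨z, -, -, rfl⟩
  exact ⟨z, rfl⟩

theorem finiteDimensional_V (n : ℕ) : FiniteDimensional ℝ (𝔢.V n).direction := by
  refine finiteDimensional_direction_affineSpan_of_finite ℝ ?_
  refine (Set.finite_range fun p : X n × X n => 𝔢.pt n p.1 p.2).subset ?_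
  rintro _ ⟨x, z, -, rfl⟩
  exact ⟨(x, z), rfl⟩

/-- The spanning points of W_k(x) are indexed by a ball of radius k. A uniform bound is what allows
one approximation constant for all n and x. -/
theorem exists_finrank_W_le [UniformBoundedGeometry X] (k : ℝ) :
    ∃ N : ℕ, ∀ n (x : X n), Module.finrank ℝ (𝔢.W n k x).direction ≤ N := by
  classical
  obtain ⟨N, hN⟩ := UniformBoundedGeometry.exists_bound (X := X) k
  refine ⟨N, fun n x => ?_⟩
  let s : Finset (X n) := Finset.univ.filter fun z => dist z x ≤ 𝔢.l n ∧ dist z x ≤ k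
  have hs : s.card ≤ N := by
    refine le_trans ?_ (hN n x).2
    rw [← Set.ncard_coe_finset]
    refine Set.ncard_le_ncard (fun z hz => ?_) (hN n x).1
    exact (Finset.mem_filter.1 (Finset.mem_coe.1 hz)).2.2
  have e : {v | ∃ z : X n, dist z x ≤ 𝔢.l n ∧ dist z x ≤ k ∧ v = 𝔢.pt n x z}
      = ((s.image (𝔢.pt n x) : Finset H) : Set H) := by
    ext v
    simp only [Set.mem_ofPred_eq, Finset.coe_image, Set.mem_image, Finset.mem_coe, s,
      Finset.mem_filter, Finset.mem_univ, true_and]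
    constructor
    · rintro ⟨z, h1, h2, rfl⟩; exact ⟨z, ⟨h1, h2⟩, rfl⟩
    · rintro ⟨z, ⟨h1, h2⟩, rfl⟩; exact ⟨z, h1, h2, rfl⟩
  unfold W
  rw [direction_affineSpan, e]
  rcases Nat.eq_zero_or_pos s.card with h0 | h0
  · have : s = ∅ := Finset.card_eq_zero.1 h0
    rw [this, Finset.image_empty, Finset.coe_empty, vectorSpan_empty, finrank_bot]
    exact Nat.zero_le _
  · refine (finrank_vectorSpan_image_finset_le ℝ (𝔢.pt n x) s (n := s.card - 1) (by omega)).trans ?_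
    omega

/-- The matrices whose entries are uniformly local, Lipschitz and of bounded support. -/
def TameAt (k : ℝ) (K : ℝ≥0) (r : ℝ) (n : ℕ) (T : X n → X n → Fun H) : Prop :=
  ∀ x y, MemCoeff (𝔢.W n k x) (T x y) ∧ LipschitzWith K (T x y) ∧ SuppIn (𝔢.pt n x x) r (T x y)

/-- The sequences of matrices whose entries are, for large `n`, uniformly local, Lipschitz and of
bounded support. -/
def Tame (T : MatSeq X H) : Prop :=
  ∃ k : ℝ, 0 ≤ k ∧ ∃ (K : ℝ≥0) (r : ℝ), 0 ≤ r ∧ ∀ᶠ n in atTop, 𝔢.TameAt k K r n (T n)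

variable {𝔢}

theorem TameAt.mono {k k' r r' : ℝ} {K K' : ℝ≥0} {n : ℕ} {T : X n → X n → Fun H}
    (h : 𝔢.TameAt k K r n T) (hk0 : 0 ≤ k) (hk : k ≤ k') (hK : K ≤ K') (hr : r ≤ r') :
    𝔢.TameAt k' K' r' n T := fun x y =>
  have := 𝔢.finiteDimensional_W n k x
  ⟨(h x y).1.mono (⟨_, 𝔢.pt_self_mem_W hk0 x⟩ : 𝔢.W n k x) (𝔢.W_mono hk x),
    (h x y).2.1.weaken hK, fun p hp => (h x y).2.2 p (hr.trans hp)⟩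

variable [UniformBoundedGeometry X]

/-- Derivative bounds become a Lipschitz bound for the preimage and then for its Bott image. -/
theorem Admissible.tame {T : MatSeq X H} (hT : 𝔢.Admissible T) : 𝔢.Tame T := by
  obtain ⟨k, hk, c, hc, h⟩ := hT.local_smooth
  obtain ⟨r, hr, hs⟩ := hT.support
  -- Factor 2 from the norm of the Bott image to pointwise values, 2 from derivatives to Lipschitz
  -- constants, and 12 from a function to its Bott image.
  refine ⟨k, hk.le, 12 * (2 * (2 * c.toNNReal)), r, hr.le, Eventually.of_forall fun n x y => ?_⟩
  have := 𝔢.finiteDimensional_W n k x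
  have := 𝔢.finiteDimensional_V n
  obtain ⟨F, hF, hFT, hD⟩ := h n x y
  let o : 𝔢.W n k x := ⟨_, 𝔢.pt_self_mem_W hk.le x⟩
  have hm : MemCoeff (𝔢.W n k x) (T n x y) := hFT.memCoeff (apply_mem_cpt hF)
  refine ⟨hm, hFT.lipschitzWith o (lipschitzWith_of_isDirDeriv fun a w haw => ?_), ?_⟩
  · obtain ⟨D, hD, G, -, hG, hGc⟩ := hD a w haw
    refine ⟨D, hD, fun p => (hG.norm_apply_le (hD.apply_mem_cpt (apply_mem_cpt hF)) p).trans ?_⟩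
    push_cast
    rw [Real.coe_toNNReal c hc.le]
    linarith
  · exact (hm.mono o (𝔢.W_le_V n k x)).suppIn_of_coeffSupport
      (⟨_, 𝔢.W_le_V n k x o.2⟩ : 𝔢.V n) (hs n x y) hr.le

/-- Every entry is approximated with error 1/(n + 1), which disappears in the quotient. Entries that
vanish stay zero, so propagation is preserved, and the sequence is put to zero for the n at which T
is not yet tame. -/
theorem exists_admissible {T : 𝔢.Pre} (hT : 𝔢.Tame T.1) :
    ∃ S : 𝔢.Pre, 𝔢.Admissible S.1 ∧ 𝔢.cls S = 𝔢.cls T := by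
  obtain ⟨k, hk, K, r, hr, hT⟩ := hT
  obtain ⟨⟨C, hC⟩, ⟨R, hR⟩⟩ := T.2
  -- The radius k + 1 replaces k because an admissible sequence needs a strictly positive one.
  obtain ⟨N, hN⟩ := 𝔢.exists_finrank_W_le (k + 1)
  choose f hf using fun d => MemCoeff.exists_approximation (H := H) d K
  -- A common bound for the finitely many approximation constants in dimensions up to N; the summand
  -- 1 makes it positive.
  obtain ⟨c, hc0, hc⟩ : ∃ c : ℝ, 0 < c ∧ ∀ d ≤ N, f d ≤ c := by
    refine ⟨1 + ∑ d ∈ Finset.range (N + 1), |f d|, by positivity, fun d hd => ?_⟩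
    have h1 := Finset.single_le_sum (f := fun d => |f d|) (fun d _ => abs_nonneg (f d))
      (Finset.mem_range.2 (Nat.lt_succ_of_le hd))
    have h2 := le_abs_self (f d)
    linarith
  have key (n) (x y : X n) : ∃ S : Fun H, (∃ F ∈ Submodule.span ℂ (elementary (𝔢.W n (k + 1) x)),
      IsBott (𝔢.W n (k + 1) x) F S ∧
      ∀ (a : ℝ) (w : (𝔢.W n (k + 1) x).direction), a ^ 2 + ‖w‖ ^ 2 ≤ 1 →
        ∃ D, IsDirDeriv (𝔢.W n (k + 1) x) F a w D ∧
          ∃ G ∈ coeffAlg (𝔢.W n (k + 1) x), IsBott (𝔢.W n (k + 1) x) D G ∧ ‖G‖ ≤ c) ∧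
      -- The radius grows by 1 in the approximation and by 1 more in passing to the closed support.
      S ∈ coeffAlg (𝔢.V n) ∧ coeffSupport (𝔢.V n) S ⊆
        {p | (p.1 : ℝ) ^ 2 + ‖(p.2 : H) - 𝔢.pt n x x‖ ^ 2 < (r + 2) ^ 2} ∧
      (T.1 n x y = 0 → S = 0) ∧ ‖S‖ ≤ C + 1 ∧
      (𝔢.TameAt k K r n (T.1 n) → ‖S - T.1 n x y‖ ≤ 1 / (n + 1)) := by
    have := 𝔢.finiteDimensional_W n (k + 1) x
    have := 𝔢.finiteDimensional_V n
    let o : 𝔢.W n (k + 1) x := ⟨_, 𝔢.pt_self_mem_W (by linarith) x⟩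
    let o' : 𝔢.V n := ⟨_, 𝔢.W_le_V n (k + 1) x o.2⟩
    have hC0 : 0 ≤ C := (norm_nonneg _).trans (hC n x y)
    by_cases h0 : 𝔢.TameAt k K r n (T.1 n) ∧ T.1 n x y ≠ 0
    · obtain ⟨h1, h2, h3⟩ := h0.1.mono hk (show k ≤ k + 1 by linarith) le_rfl le_rfl x y
      obtain ⟨F, hF, S, hFS, hS, hSr, hD⟩ :=
        hf _ (𝔢.W n (k + 1) x) rfl o r _ h1 h2 h3 (1 / (n + 1)) (by positivity)
      rw [norm_sub_rev] at hS
      have hm : MemCoeff (𝔢.W n (k + 1) x) S := hFS.memCoeff (apply_mem_cpt hF)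
      have hL : LipschitzWith (12 * (2 * (2 * c.toNNReal))) S :=
        hFS.lipschitzWith o (lipschitzWith_of_isDirDeriv fun a w haw => by
          obtain ⟨D, hDs, hD, G, hG, hGc⟩ := hD a w haw
          refine ⟨D, hD, fun p => (hG.norm_apply_le (apply_mem_cpt hDs) p).trans ?_⟩
          push_cast
          rw [Real.coe_toNNReal c hc0.le]
          linarith [hc _ (hN n x)])
      refine ⟨S, ⟨F, hF, hFS, fun a w haw => ?_⟩, (hm.mono o (𝔢.W_le_V n _ x)).mem_coeffAlg o' hL hSr,
        hSr.coeffSupport_subset o' (by linarith), fun h => absurd h h0.2, ?_, fun _ => hS⟩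
      · obtain ⟨D, hDs, hD, G, hG, hGc⟩ := hD a w haw
        exact ⟨D, hD, G, subset_closure ⟨D, hDs, hG⟩, hG, hGc.trans (hc _ (hN n x))⟩
      · have h4 := norm_add_le (S - T.1 n x y) (T.1 n x y)
        rw [sub_add_cancel] at h4
        have h5 : (1 : ℝ) / (n + 1) ≤ 1 := by
          rw [div_le_one (by positivity)]; linarith [(Nat.cast_nonneg n : (0 : ℝ) ≤ n)]
        linarith [hC n x y]
    · have hB (V : AffineSubspace ℝ H) : IsBott V 0 0 := fun s v u _ => by simp
      have h0m (V : AffineSubspace ℝ H) : (0 : Fun H) ∈ coeffAlg V :=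
        subset_closure ⟨0, zero_mem _, hB V⟩
      refine ⟨0, ⟨0, zero_mem _, hB _, fun a w _ => ⟨0, fun s v => hasDerivAt_const _ _, 0, h0m _, hB _,
        by rw [norm_zero]; exact hc0.le⟩⟩, h0m _,
        SuppIn.coeffSupport_subset o' (r := r) (fun _ _ => rfl) (by linarith), fun _ => rfl,
        by rw [norm_zero]; linarith, fun h => ?_⟩
      have h1 : T.1 n x y = 0 := by
        by_contra h'
        exact h0 ⟨h, h'⟩
      rw [h1, sub_zero, norm_zero]
      positivity
  choose S hS1 hS2 hS3 hS4 hS5 hS6 using key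
  have hR' : ∀ n (x y : X n), R < dist x y → S n x y = 0 := fun n x y h => hS4 n x y (hR n x y h)
  refine ⟨⟨S, ⟨C + 1, hS5⟩, R, hR'⟩, ⟨⟨C + 1, fun n x y => ⟨hS2 n x y, hS5 n x y⟩⟩,
    ⟨k + 1, by linarith, c, hc0, fun n x y => hS1 n x y⟩, ⟨R, hR'⟩,
    ⟨r + 2, by linarith, hS3⟩⟩, cls_eq.2 fun ε hε => ?_⟩
  obtain ⟨m, hm⟩ := exists_nat_one_div_lt hε
  filter_upwards [hT, eventually_ge_atTop m] with n h1 h2 x y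
  refine (hS6 n x y h1).trans (le_trans ?_ hm.le)
  exact one_div_le_one_div_of_le (by positivity) (by exact_mod_cast Nat.succ_le_succ h2)

end FibredCoarseEmbedding

end tame

end

noncomputable section

set_option linter.unusedSectionVars false

open scoped NNReal BoundedContinuousFunction ZeroAtInfty
open Coeff

/-! ### Lipschitz constants and supports under the operations -/

section closure_properties

variable {H : Type*} [NormedAddCommGroup H] [InnerProductSpace ℝ H]

theorem norm_coe_sub_le {G : Fun H} {K : ℝ≥0} (h : LipschitzWith K G) (p q) :
    ‖G p - G q‖ ≤ K * dist p q := by rw [← dist_eq_norm]; exact h.dist_le_mul p q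

theorem lipschitzWith_of_norm_sub_le {G : Fun H} {K : ℝ≥0} (h : ∀ p q, ‖G p - G q‖ ≤ K * dist p q) :
    LipschitzWith K G := LipschitzWith.of_dist_le_mul fun p q => by
  rw [dist_eq_norm]; exact h p q

theorem lipschitzWith_fun_smul (c : ℂ) {G : Fun H} {K : ℝ≥0} (h : LipschitzWith K G) :
    LipschitzWith (‖c‖₊ * K) (c • G : Fun H) := lipschitzWith_of_norm_sub_le fun p q => by
  change ‖c • G p - c • G q‖ ≤ _
  rw [← smul_sub, norm_smul]
  push_cast
  rw [mul_assoc]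
  exact mul_le_mul_of_nonneg_left (norm_coe_sub_le h p q) (norm_nonneg _)

theorem lipschitzWith_fun_star {G : Fun H} {K : ℝ≥0} (h : LipschitzWith K G) :
    LipschitzWith K (star G : Fun H) := lipschitzWith_of_norm_sub_le fun p q => by
  rw [BoundedContinuousFunction.star_apply, BoundedContinuousFunction.star_apply, ← star_sub,
    norm_star]
  exact norm_coe_sub_le h p q

theorem lipschitzWith_transport (t : H ≃ᵃⁱ[ℝ] H) {G : Fun H} {K : ℝ≥0} (h : LipschitzWith K G) :
    LipschitzWith K (transport t G) := lipschitzWith_of_norm_sub_le fun p q => by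
  rw [transport_apply, transport_apply, ← map_sub]
  refine (Coeff.norm_map_le _ _).trans ((norm_coe_sub_le h _ _).trans_eq ?_)
  congr 1
  rw [Prod.dist_eq, Prod.dist_eq, t.symm.dist_map]

theorem lipschitzWith_fun_mul {G G' : Fun H} {K K' C C' : ℝ≥0} (h : LipschitzWith K G)
    (h' : LipschitzWith K' G') (hC : ‖G‖ ≤ C) (hC' : ‖G'‖ ≤ C') :
    LipschitzWith (K * C' + C * K') (G * G' : Fun H) := lipschitzWith_of_norm_sub_le fun p q => by
  rw [BoundedContinuousFunction.coe_mul, Pi.mul_apply, Pi.mul_apply,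
    show G p * G' p - G q * G' q = (G p - G q) * G' p + G q * (G' p - G' q) by
      rw [sub_mul, mul_sub]; abel]
  have h1 : ‖(G p - G q) * G' p‖ ≤ (K * dist p q) * C' :=
    (norm_mul_le _ _).trans (mul_le_mul (norm_coe_sub_le h p q)
      ((G'.norm_coe_le_norm p).trans hC') (norm_nonneg _) (by positivity))
  have h2 : ‖G q * (G' p - G' q)‖ ≤ C * (K' * dist p q) :=
    (norm_mul_le _ _).trans (mul_le_mul ((G.norm_coe_le_norm q).trans hC)
      (norm_coe_sub_le h' p q) (norm_nonneg _) C.2)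
  refine (norm_add_le _ _).trans ?_
  push_cast
  linarith

theorem lipschitzWith_fun_sum {ι : Type*} (s : Finset ι) (f : ι → Fun H) {K : ℝ≥0}
    (h : ∀ i ∈ s, LipschitzWith K (f i)) : LipschitzWith (s.card * K) (∑ i ∈ s, f i : Fun H) :=
  lipschitzWith_of_norm_sub_le fun p q => by
    rw [BoundedContinuousFunction.coe_sum, Finset.sum_apply, Finset.sum_apply,
      ← Finset.sum_sub_distrib]
    refine (norm_sum_le_of_le (n := fun _ => K * dist p q) _ fun i hi =>
      norm_coe_sub_le (h i hi) p q).trans ?_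
    rw [Finset.sum_const, nsmul_eq_mul]
    push_cast
    linarith

theorem suppIn_transport (t : H ≃ᵃⁱ[ℝ] H) {G : Fun H} {o : H} {r : ℝ} (h : SuppIn o r G) :
    SuppIn (t o) r (transport t G) := by
  intro p hp
  rw [transport_apply, h _ ?_, map_zero]
  have e : ‖t.symm p.2 - o‖ = ‖p.2 - t o‖ := by
    rw [← dist_eq_norm, ← dist_eq_norm, ← t.dist_map, t.apply_symm_apply]
  rwa [norm_vec, e, ← norm_vec]

theorem SuppIn.of_norm_sub_le {G : Fun H} {o o' : H} {r s : ℝ} (h : SuppIn o r G)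
    (hs : ‖o' - o‖ ≤ s) : SuppIn o' (r + s) G := by
  intro p hp
  refine h p ?_
  have h1 : vec p.1 (p.2 - o') = vec p.1 (p.2 - o) + vec 0 (o - o') := by
    rw [← vec_add, add_zero]; congr 1; abel
  have h2 := norm_add_le (vec p.1 (p.2 - o)) (vec 0 (o - o'))
  rw [← h1] at h2
  have h3 := norm_vec_le 0 (o - o')
  rw [abs_zero, zero_add, norm_sub_rev] at h3
  linarith

end closure_properties

/-! ### The twisted algebra as the algebra of tame classes -/

section tame

open Filter

variable {X : ℕ → Type u} [∀ n, MetricSpace (X n)] {H : Type v} [NormedAddCommGroup H]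
  [InnerProductSpace ℝ H] {𝔢 : FibredCoarseEmbedding.{u, v, w} X H}

namespace FibredCoarseEmbedding

variable [∀ n, Fintype (X n)]

theorem TameAt.add {k r : ℝ} {K K' : ℝ≥0} {n : ℕ} {T S : X n → X n → Fun H}
    (hT : 𝔢.TameAt k K r n T) (hS : 𝔢.TameAt k K' r n S) : 𝔢.TameAt k (K + K') r n (T + S) :=
  fun x y => ⟨(hT x y).1.add (hS x y).1, by
    simp only [Pi.add_apply, BoundedContinuousFunction.coe_add]
    exact (hT x y).2.1.add (hS x y).2.1, fun p hp => by
    simp only [Pi.add_apply, BoundedContinuousFunction.coe_add]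
    rw [(hT x y).2.2 p hp, (hS x y).2.2 p hp, add_zero]⟩

theorem Tame.add {T S : MatSeq X H} (hT : 𝔢.Tame T) (hS : 𝔢.Tame S) : 𝔢.Tame (T + S) := by
  obtain ⟨k, hk, K, r, hr, hT⟩ := hT
  obtain ⟨k', hk', K', r', hr', hS⟩ := hS
  refine ⟨max k k', hk.trans (le_max_left _ _), K + K', max r r', hr.trans (le_max_left _ _), ?_⟩
  filter_upwards [hT, hS] with n h1 h2
  exact (h1.mono hk (le_max_left _ _) le_rfl (le_max_left _ _)).add
    (h2.mono hk' (le_max_right _ _) le_rfl (le_max_right _ _))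

theorem Tame.zero : 𝔢.Tame (0 : MatSeq X H) :=
  ⟨0, le_rfl, 0, 0, le_rfl, Eventually.of_forall fun n x y =>
    ⟨MemCoeff.zero _, lipschitzWith_of_norm_sub_le fun p q => by simp, fun _ _ => rfl⟩⟩

theorem Tame.smul (c : ℂ) {T : MatSeq X H} (hT : 𝔢.Tame T) : 𝔢.Tame (c • T) := by
  obtain ⟨k, hk, K, r, hr, hT⟩ := hT
  refine ⟨k, hk, ‖c‖₊ * K, r, hr, ?_⟩
  filter_upwards [hT] with n h x y
  refine ⟨(h x y).1.smul c, lipschitzWith_fun_smul c (h x y).2.1, fun p hp => ?_⟩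
  simp only [Pi.smul_apply, BoundedContinuousFunction.coe_smul]
  rw [(h x y).2.2 p hp, smul_zero]

variable [UniformBoundedGeometry X]

theorem memCoeff_transport {n : ℕ} {k R : ℝ} {x z : X n} (hk : 0 ≤ k) (hxz : dist x z ≤ R)
    (h : k + R ≤ 𝔢.l n) {G : Fun H} (hG : MemCoeff (𝔢.W n k z) G) :
    MemCoeff (𝔢.W n (k + R) x) (transport (𝔢.trans n x z) G) := by
  have h1 := hG.transport (𝔢.trans n x z)
  have := 𝔢.finiteDimensional_W n k z
  have : FiniteDimensional ℝ ((𝔢.W n k z).map (𝔢.trans n x z : H →ᵃ[ℝ] H)).direction := by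
    rw [AffineSubspace.map_direction]; infer_instance
  exact MemCoeff.mono (V := (𝔢.W n k z).map (𝔢.trans n x z : H →ᵃ[ℝ] H))
    ⟨_, _, 𝔢.pt_self_mem_W hk z, rfl⟩ h1 (𝔢.map_W_le hxz h)

theorem Tame.star {T : 𝔢.Pre} (hT : 𝔢.Tame T.1) : 𝔢.Tame (starPre T).1 := by
  obtain ⟨k, hk, K, r, hr, hT⟩ := hT
  obtain ⟨R, hR⟩ := T.2.2
  have hρ : 0 ≤ 𝔢.ρp (max R 0) := 𝔢.ρp_nonneg _ (le_max_right _ _)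
  refine ⟨k + max R 0, by positivity, K, r + 𝔢.ρp (max R 0), by positivity, ?_⟩
  filter_upwards [hT, 𝔢.eventually_le (k + max R 0)] with n h hl x y
  change MemCoeff _ (transport (𝔢.trans n x y) (Star.star (T.1 n y x))) ∧
    LipschitzWith _ (transport (𝔢.trans n x y) (Star.star (T.1 n y x))) ∧
    SuppIn _ _ (transport (𝔢.trans n x y) (Star.star (T.1 n y x)))
  by_cases hxy : R < dist y x
  · rw [hR n y x hxy, star_zero, map_zero]
    exact ⟨MemCoeff.zero _, lipschitzWith_of_norm_sub_le fun p q => by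
      simp only [BoundedContinuousFunction.coe_zero, Pi.zero_apply, sub_self, norm_zero]
      positivity, fun _ _ => rfl⟩
  have hd : dist x y ≤ max R 0 := by
    rw [dist_comm]; exact (not_lt.1 hxy).trans (le_max_left _ _)
  refine ⟨memCoeff_transport hk hd hl (h y x).1.star, lipschitzWith_transport _
    (lipschitzWith_fun_star (h y x).2.1), ?_⟩
  have hs : SuppIn (𝔢.pt n y y) r (Star.star (T.1 n y x)) := fun p hp => by
    rw [BoundedContinuousFunction.star_apply, (h y x).2.2 p hp, star_zero]
  have h1 := suppIn_transport (𝔢.trans n x y) hs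
  have h0 (z : X n) : dist z z ≤ 𝔢.l n := by rw [dist_self]; exact 𝔢.l_nonneg' n
  have hyx : dist y x ≤ 𝔢.l n := by rw [dist_comm]; linarith
  rw [𝔢.trans_pt hyx (h0 y)] at h1
  -- After transport the support is centred at t_x(y)(s(y)), which is within ρ₊(max R 0) of the
  -- required centre t_x(x)(s(x)).
  refine h1.of_norm_sub_le ((𝔢.dist_le n x x y (h0 x) hyx).trans ?_)
  exact 𝔢.ρp_mono (Set.mem_Ici.2 dist_nonneg) (Set.mem_Ici.2 (le_max_right _ _)) hd

/-- The support of each summand is that of its left factor, so r does not grow. Locality grows by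
the propagation of the left factor, and the Lipschitz constant by the number of summands. -/
theorem Tame.mul {T S : 𝔢.Pre} (hT : 𝔢.Tame T.1) (hS : 𝔢.Tame S.1) : 𝔢.Tame (mulPre T S).1 := by
  classical
  obtain ⟨k, hk, K, r, hr, hT⟩ := hT
  obtain ⟨k', hk', K', r', hr', hS⟩ := hS
  obtain ⟨⟨C, hC⟩, ⟨R, hR⟩⟩ := T.2
  obtain ⟨⟨C', hC'⟩, -⟩ := S.2
  obtain ⟨N, hN⟩ := UniformBoundedGeometry.exists_bound (X := X) R
  refine ⟨max k (k' + max R 0), hk.trans (le_max_left _ _),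
    N * (K * C'.toNNReal + C.toNNReal * K'), r, hr, ?_⟩
  filter_upwards [hT, hS, 𝔢.eventually_le (k' + max R 0)] with n h h' hl x y
  let s : Finset (X n) := Finset.univ.filter fun z => dist z x ≤ R
  have hs : s.card ≤ N := by
    rw [← Set.ncard_coe_finset]
    simpa [s] using (hN n x).2
  have e : (mulPre T S).1 n x y = ∑ z ∈ s, T.1 n x z * transport (𝔢.trans n x z) (S.1 n z y) := by
    symm
    refine Finset.sum_subset (Finset.subset_univ _) fun z _ hz => ?_
    rw [hR n x z (by simpa [s, dist_comm] using hz), zero_mul]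
  rw [e]
  refine ⟨MemCoeff.sum _ _ fun z hz => ?_, ?_, fun p hp => ?_⟩
  · have hd : dist x z ≤ max R 0 := by
      rw [dist_comm]; exact (Finset.mem_filter.1 hz).2.trans (le_max_left _ _)
    have := 𝔢.finiteDimensional_W n k x
    have := 𝔢.finiteDimensional_W n (k' + max R 0) x
    refine ((h x z).1.mono (⟨_, 𝔢.pt_self_mem_W hk x⟩ : 𝔢.W n k x)
      (𝔢.W_mono (le_max_left _ _) x)).mul ?_
    exact (memCoeff_transport hk' hd hl (h' z y).1).mono
      (⟨_, 𝔢.pt_self_mem_W (by positivity) x⟩ : 𝔢.W n (k' + max R 0) x)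
      (𝔢.W_mono (le_max_right _ _) x)
  · refine (lipschitzWith_fun_sum s _ fun z _ => lipschitzWith_fun_mul (h x z).2.1
      (lipschitzWith_transport _ (h' z y).2.1) ((hC n x z).trans (Real.le_coe_toNNReal C))
      ((norm_transport_le _ _).trans ((hC' n z y).trans (Real.le_coe_toNNReal C')))).weaken ?_
    gcongr
  · rw [BoundedContinuousFunction.coe_sum, Finset.sum_apply]
    refine Finset.sum_eq_zero fun z _ => ?_
    rw [BoundedContinuousFunction.coe_mul, Pi.mul_apply, (h x z).2.2 p hp, zero_mul]

/-- Tame classes form a `*`-algebra that contains the admissible classes, and each tame sequence is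
equivalent to an admissible one. Elements may henceforth be constructed as tame sequences, without
elementary tensors. -/
theorem mem_twistedAlgebra_iff {c : 𝔢.Ambient} :
    c ∈ 𝔢.twistedAlgebra ↔ ∃ T : 𝔢.Pre, 𝔢.Tame T.1 ∧ 𝔢.cls T = c := by
  constructor
  · intro hc
    induction hc using NonUnitalStarAlgebra.adjoin_induction with
    | mem c hc => obtain ⟨T, hT, rfl⟩ := hc; exact ⟨T, hT.tame, rfl⟩
    | add c d _ _ hc hd =>
      obtain ⟨T, hT, rfl⟩ := hc
      obtain ⟨S, hS, rfl⟩ := hd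
      exact ⟨T + S, hT.add hS, rfl⟩
    | zero => exact ⟨0, Tame.zero, rfl⟩
    | mul c d _ _ hc hd =>
      obtain ⟨T, hT, rfl⟩ := hc
      obtain ⟨S, hS, rfl⟩ := hd
      exact ⟨mulPre T S, hT.mul hS, rfl⟩
    | smul c d _ hd =>
      obtain ⟨S, hS, rfl⟩ := hd
      exact ⟨c • S, hS.smul c, rfl⟩
    | star c _ hc =>
      obtain ⟨T, hT, rfl⟩ := hc
      exact ⟨starPre T, hT.star, rfl⟩
  · rintro ⟨T, hT, rfl⟩
    obtain ⟨S, hS, hST⟩ := exists_admissible hT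
    exact NonUnitalStarAlgebra.subset_adjoin ℂ _ ⟨S, hS, hST⟩

end FibredCoarseEmbedding

end tame

end

noncomputable section

set_option linter.unusedSectionVars false

open scoped NNReal BoundedContinuousFunction ZeroAtInfty
open Coeff

namespace CStarMatrix

variable {ι A : Type*} [Fintype ι] [NonUnitalCStarAlgebra A] [PartialOrder A] [StarOrderedRing A]

theorem norm_le_of_support (M : CStarMatrix ι ι A) (s : Finset ι) {N : ℕ} (hs : s.card ≤ N) {C : ℝ}
    (hC : 0 ≤ C) (h0 : ∀ i j, M i j ≠ 0 → i ∈ s ∧ j ∈ s) (hM : ∀ i j, ‖M i j‖ ≤ C) :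
    ‖M‖ ≤ N * (N * C) := by
  refine (norm_le_sum_norm M).trans ?_
  have h1 (j) : ∑ i, ‖M i j‖ ≤ N * C := by
    rw [← Finset.sum_subset (Finset.subset_univ s) fun i _ hi => by
      by_contra h; exact hi (h0 i j (norm_ne_zero_iff.1 h)).1]
    refine (Finset.sum_le_card_nsmul _ _ C fun i _ => hM i j).trans ?_
    rw [nsmul_eq_mul]
    gcongr
  rw [← Finset.sum_subset (Finset.subset_univ s) fun j _ hj => by
    refine Finset.sum_eq_zero fun i _ => ?_
    by_contra h; exact hj (h0 i j (norm_ne_zero_iff.1 h)).2]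
  refine (Finset.sum_le_card_nsmul _ _ (N * C) fun j _ => h1 j).trans ?_
  rw [nsmul_eq_mul]
  gcongr

/-- The compression of M* M to a set of indices is the square of the column cut of M. This is how
the C⋆-identity survives the restriction to a ball. -/
theorem rowCut_colCut_star_mul (P : ι → Prop) [DecidablePred P] (M : CStarMatrix ι ι A) :
    rowCut P (colCut P (star M * M)) = star (colCut P M) * colCut P M := by
  ext i j
  rw [rowCut_apply, colCut_apply, mul_apply, mul_apply]
  simp only [star_apply, colCut_apply]
  by_cases hi : P i <;> by_cases hj : P j <;> simp [hi, hj]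

end CStarMatrix

/-! ### Matrices over balls, evaluated at a point -/

section loc

open Filter

variable {X : ℕ → Type u} [∀ n, MetricSpace (X n)] {H : Type v} [NormedAddCommGroup H]
  [InnerProductSpace ℝ H] (𝔢 : FibredCoarseEmbedding.{u, v, w} X H) [∀ n, Fintype (X n)]

namespace FibredCoarseEmbedding

open Classical in
/-- The matrix of the values at `p` of the entries of `T` over the ball `B(y, L)`, in the
trivialisation at `y`. -/
def loc (n : ℕ) (T : X n → X n → Fun H) (y : X n) (L : ℝ) (p : ℝ≥0 × H) :
    CStarMatrix (X n) (X n) (Coeff H) :=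
  CStarMatrix.ofMatrix fun x z =>
    if dist x y ≤ L ∧ dist z y ≤ L then transport (𝔢.trans n y x) (T x z) p else 0

open Classical in
theorem loc_apply (n : ℕ) (T : X n → X n → Fun H) (y : X n) (L : ℝ) (p : ℝ≥0 × H) (x z : X n) :
    𝔢.loc n T y L p x z
      = if dist x y ≤ L ∧ dist z y ≤ L then transport (𝔢.trans n y x) (T x z) p else 0 := rfl

theorem loc_add (n : ℕ) (T S : X n → X n → Fun H) (y : X n) (L : ℝ) (p : ℝ≥0 × H) :
    𝔢.loc n (T + S) y L p = 𝔢.loc n T y L p + 𝔢.loc n S y L p := by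
  ext x z
  rw [CStarMatrix.add_apply, loc_apply, loc_apply, loc_apply]
  split_ifs
  · rw [Pi.add_apply, Pi.add_apply, map_add]; rfl
  · rw [add_zero]

theorem loc_smul (n : ℕ) (c : ℂ) (T : X n → X n → Fun H) (y : X n) (L : ℝ) (p : ℝ≥0 × H) :
    𝔢.loc n (c • T) y L p = c • 𝔢.loc n T y L p := by
  ext x z
  rw [CStarMatrix.smul_apply, loc_apply, loc_apply]
  split_ifs
  · rw [Pi.smul_apply, Pi.smul_apply, map_smul]; rfl
  · rw [smul_zero]

open Classical in
theorem loc_cut {n : ℕ} (T : X n → X n → Fun H) (y : X n) {L L' : ℝ} (h : L ≤ L') (p : ℝ≥0 × H) :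
    𝔢.loc n T y L p = CStarMatrix.rowCut (fun x => dist x y ≤ L)
      (CStarMatrix.colCut (fun x => dist x y ≤ L) (𝔢.loc n T y L' p)) := by
  ext x z
  rw [CStarMatrix.rowCut_apply, CStarMatrix.colCut_apply, loc_apply, loc_apply]
  by_cases hx : dist x y ≤ L
  · by_cases hz : dist z y ≤ L
    · simp [hx, hz, hx.trans h, hz.trans h]
    · simp [hz]
  · simp [hx]

theorem norm_loc_le {n : ℕ} (T : X n → X n → Fun H) (y : X n) (L : ℝ) (p : ℝ≥0 × H) {N : ℕ}
    (hN : {x | dist x y ≤ L}.ncard ≤ N) {C : ℝ} (hC : 0 ≤ C)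
    (h : ∀ x z, dist x y ≤ L → dist z y ≤ L → ‖T x z‖ ≤ C) : ‖𝔢.loc n T y L p‖ ≤ N * (N * C) := by
  classical
  refine CStarMatrix.norm_le_of_support _ (Finset.univ.filter fun x => dist x y ≤ L) ?_ hC
    (fun x z hxz => ?_) fun x z => ?_
  · rw [← Set.ncard_coe_finset]
    simpa using hN
  · by_contra h'
    refine hxz ?_
    rw [loc_apply, if_neg]
    simpa using h'
  · rw [loc_apply]
    split_ifs with hxz
    · exact ((transport _ _).norm_coe_le_norm p).trans
        ((norm_transport_le _ _).trans (h x z hxz.1 hxz.2))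
    · rw [norm_zero]; exact hC

variable {𝔢}

theorem transport_trans_trans {n : ℕ} {x y z q : X n} (hx : dist q x ≤ 𝔢.l n)
    (hy : dist q y ≤ 𝔢.l n) (hz : dist q z ≤ 𝔢.l n) (F : Fun H) :
    transport (𝔢.trans n x y) (transport (𝔢.trans n y z) F) = transport (𝔢.trans n x z) F := by
  rw [transport_transport, 𝔢.trans_trans n hx hy hz]

theorem loc_starSeq {n : ℕ} (T : MatSeq X H) (y : X n) {L : ℝ} (hL : L ≤ 𝔢.l n) (p : ℝ≥0 × H) :
    𝔢.loc n (𝔢.starSeq T n) y L p = star (𝔢.loc n (T n) y L p) := by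
  ext x z
  rw [CStarMatrix.star_apply, loc_apply, loc_apply]
  by_cases h : dist x y ≤ L ∧ dist z y ≤ L
  · rw [if_pos h, if_pos h.symm]
    change transport _ (transport _ (star (T n z x))) p = _
    rw [transport_trans_trans (q := y) (by rw [dist_self]; exact 𝔢.l_nonneg' n)
      (by rw [dist_comm]; exact h.1.trans hL) (by rw [dist_comm]; exact h.2.trans hL), map_star]
    rfl
  · rw [if_neg h, if_neg fun h' => h h'.symm, star_zero]

-- In a product starting in B(y, L) the intermediate index stays in the ball enlarged by the
-- propagation. There the isometries compose, so the product can be taken over the larger ball and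
-- cut back.
open Classical in
theorem loc_mulSeq {n : ℕ} {T S : MatSeq X H} {R : ℝ} (hR : ∀ x y : X n, R < dist x y → T n x y = 0)
    (y : X n) {L L' : ℝ} (hL : L + R ≤ L') (hLL : L ≤ L') (hL' : L' ≤ 𝔢.l n) (p : ℝ≥0 × H) :
    𝔢.loc n (𝔢.mulSeq T S n) y L p = CStarMatrix.rowCut (fun x => dist x y ≤ L)
      (CStarMatrix.colCut (fun x => dist x y ≤ L)
        (𝔢.loc n (T n) y L' p * 𝔢.loc n (S n) y L' p)) := by
  ext x w
  rw [CStarMatrix.rowCut_apply, CStarMatrix.colCut_apply, loc_apply, CStarMatrix.mul_apply]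
  by_cases hx : dist x y ≤ L
  swap
  · simp [hx]
  by_cases hw : dist w y ≤ L
  swap
  · simp [hw]
  rw [if_pos ⟨hx, hw⟩, if_pos hx, if_pos hw]
  change transport (𝔢.trans n y x) (∑ z, T n x z * transport (𝔢.trans n x z) (S n z w)) p = _
  rw [map_sum, BoundedContinuousFunction.coe_sum, Finset.sum_apply]
  refine Finset.sum_congr rfl fun z _ => ?_
  rw [loc_apply, loc_apply, map_mul, BoundedContinuousFunction.coe_mul, Pi.mul_apply]
  by_cases hz : dist z y ≤ L'
  · rw [if_pos ⟨hx.trans hLL, hz⟩, if_pos ⟨hz, hw.trans hLL⟩, transport_trans_trans (q := y)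
      (by rw [dist_self]; exact 𝔢.l_nonneg' n) (by rw [dist_comm]; exact hx.trans (hLL.trans hL'))
      (by rw [dist_comm]; exact hz.trans hL')]
  · rw [if_neg fun h => hz h.2, if_neg fun h => hz h.1, zero_mul, hR x z, map_zero]
    · exact zero_mul _
    · have := dist_triangle z x y
      rw [dist_comm z x] at this
      linarith

/-! ### Rows that do not vanish at a point -/

theorem TameAt.dist_lt {k r : ℝ} {K : ℝ≥0} {n : ℕ} {T : X n → X n → Fun H} (hT : 𝔢.TameAt k K r n T)
    {x y : X n} (hxy : dist x y ≤ 𝔢.l n) {z : X n} {p : ℝ≥0 × H}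
    (h : transport (𝔢.trans n y x) (T x z) p ≠ 0) : ‖p.2 - 𝔢.pt n y x‖ < r := by
  have h1 := suppIn_transport (𝔢.trans n y x) (hT x z).2.2
  rw [𝔢.trans_pt hxy (by rw [dist_self]; exact 𝔢.l_nonneg' n)] at h1
  by_contra h'
  exact h (h1 p ((not_lt.1 h').trans (norm_le_norm_vec _ _)))

/-- The lower control function ρ₋ turns closeness in H to a common point v into closeness in X_n.
This is the only use of ρ₋, and it confines the rows that are nonzero at a point to a ball of fixed
radius. -/
theorem dist_le_of_norm_sub_pt_lt {n : ℕ} {r D : ℝ} (hD : ∀ t, 0 ≤ t → 𝔢.ρm t < 2 * r → t ≤ D)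
    {x x' y : X n} (hx : dist x y ≤ 𝔢.l n) (hx' : dist x' y ≤ 𝔢.l n) {v : H}
    (h : ‖v - 𝔢.pt n y x‖ < r) (h' : ‖v - 𝔢.pt n y x'‖ < r) : dist x x' ≤ D := by
  refine hD _ dist_nonneg ((𝔢.le_dist n y x x' hx hx').trans_lt ?_)
  have h1 := norm_sub_le (v - 𝔢.pt n y x') (v - 𝔢.pt n y x)
  rw [sub_sub_sub_cancel_left] at h1
  change ‖𝔢.pt n y x - 𝔢.pt n y x'‖ < _
  linarith

variable (𝔢) in
theorem exists_radius (r : ℝ) : ∃ D, 0 ≤ D ∧ ∀ t, 0 ≤ t → 𝔢.ρm t < 2 * r → t ≤ D := by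
  obtain ⟨D, hD⟩ := (𝔢.ρm_tendsto.eventually_ge_atTop (2 * r)).exists_forall_of_atTop
  refine ⟨max D 0, le_max_right _ _, fun t _ h => ?_⟩
  by_contra h'
  exact absurd (hD t ((le_max_left _ _).trans (not_le.1 h').le)) (not_le.2 h)

/-- Choose one row x₀ that is nonzero at p. All other such rows are within D of it and their nonzero
columns within D + R. Retrivialising at x₀ moves p and applies a `*`-homomorphism to the entries,
and the matrix over B(y, L) is obtained from the one over B(x₀, D + R) by this contraction and by
cut-offs. -/
theorem TameAt.exists_norm_loc_le {k r : ℝ} {K : ℝ≥0} {n : ℕ} {T : X n → X n → Fun H}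
    (hT : 𝔢.TameAt k K r n T) {D R : ℝ} (hR0 : 0 ≤ R)
    (hD : ∀ t, 0 ≤ t → 𝔢.ρm t < 2 * r → t ≤ D) (hR : ∀ x y : X n, R < dist x y → T x y = 0)
    (hl : D + R ≤ 𝔢.l n) (y : X n) {L : ℝ} (hL : L ≤ 𝔢.l n) (p : ℝ≥0 × H) :
    ∃ x₀ p', ‖𝔢.loc n T y L p‖ ≤ ‖𝔢.loc n T x₀ (D + R) p'‖ := by
  classical
  by_cases h0 : ∀ x z, 𝔢.loc n T y L p x z = 0
  · refine ⟨y, p, ?_⟩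
    have : 𝔢.loc n T y L p = 0 := by ext x z; exact h0 x z
    rw [this, norm_zero]
    exact norm_nonneg _
  push Not at h0
  obtain ⟨x₀, z₀, h0⟩ := h0
  have hentry {x z} (h : 𝔢.loc n T y L p x z ≠ 0) : dist x y ≤ L ∧ ‖p.2 - 𝔢.pt n y x‖ < r ∧
      dist x z ≤ R := by
    rw [loc_apply] at h
    by_cases hx : dist x y ≤ L ∧ dist z y ≤ L
    · rw [if_pos hx] at h
      refine ⟨hx.1, hT.dist_lt (hx.1.trans hL) h, ?_⟩
      by_contra h'
      exact h (by rw [hR x z (not_le.1 h'), map_zero]; rfl)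
    · exact absurd (if_neg hx) h
  obtain ⟨h1, h2, -⟩ := hentry h0
  have hx₀ {x z} (h : 𝔢.loc n T y L p x z ≠ 0) : dist x x₀ ≤ D + R ∧ dist z x₀ ≤ D + R := by
    obtain ⟨h3, h4, h5⟩ := hentry h
    have h6 := dist_le_of_norm_sub_pt_lt hD (h3.trans hL) (h1.trans hL) h4 h2
    rw [dist_comm] at h5
    exact ⟨by linarith, by linarith [dist_triangle z x x₀]⟩
  refine ⟨x₀, (p.1, (𝔢.trans n y x₀).symm p.2), ?_⟩
  have e : 𝔢.loc n T y L p = CStarMatrix.rowCut (fun x => dist x y ≤ L)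
      (CStarMatrix.colCut (fun x => dist x y ≤ L)
        ((𝔢.loc n T x₀ (D + R) (p.1, (𝔢.trans n y x₀).symm p.2)).map
          (Coeff.map (𝔢.trans n y x₀).linearIsometryEquiv))) := by
    ext x z
    rw [CStarMatrix.rowCut_apply, CStarMatrix.colCut_apply, CStarMatrix.map_apply]
    by_cases hx : dist x y ≤ L
    swap
    · rw [if_neg hx, loc_apply, if_neg fun h => hx h.1]
    by_cases hz : dist z y ≤ L
    swap
    · rw [if_neg hz, ite_self, loc_apply, if_neg fun h => hz h.2]
    rw [if_pos hx, if_pos hz]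
    by_cases h : dist x x₀ ≤ D + R ∧ dist z x₀ ≤ D + R
    · rw [loc_apply, loc_apply, if_pos ⟨hx, hz⟩, if_pos h, ← transport_apply (𝔢.trans n y x₀),
        transport_trans_trans (q := x) (hx.trans hL) (h.1.trans hl)
          (by rw [dist_self]; exact 𝔢.l_nonneg' n)]
    · rw [loc_apply _ _ _ x₀, if_neg h, map_zero]
      by_contra h'
      exact h (hx₀ h')
  rw [e]
  exact (CStarMatrix.norm_rowCut_le _ _).trans ((CStarMatrix.norm_colCut_le _ _).trans
    (CStarMatrix.norm_map_le _ _))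

end FibredCoarseEmbedding

end loc

end

noncomputable section

set_option linter.unusedSectionVars false

open scoped NNReal BoundedContinuousFunction ZeroAtInfty
open Coeff

/-! ### The norm over balls as a C⋆-seminorm -/

section norm

open Filter

variable {X : ℕ → Type u} [∀ n, MetricSpace (X n)] {H : Type v} [NormedAddCommGroup H]
  [InnerProductSpace ℝ H] (𝔢 : FibredCoarseEmbedding.{u, v, w} X H) [∀ n, Fintype (X n)]

namespace FibredCoarseEmbedding

/-- The matrices over the balls of any fixed radius have, for large `n`, pointwise norm at most `r`. -/
def LocBound (T : MatSeq X H) (r : ℝ) : Prop :=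
  ∀ L : ℝ, ∀ᶠ n in atTop, ∀ (y : X n) (p : ℝ≥0 × H), ‖𝔢.loc n (T n) y L p‖ ≤ r

variable {𝔢}

theorem LocBound.add {T S : MatSeq X H} {r s : ℝ} (hT : 𝔢.LocBound T r) (hS : 𝔢.LocBound S s) :
    𝔢.LocBound (T + S) (r + s) := fun L => by
  filter_upwards [hT L, hS L] with n h h' y p
  rw [Pi.add_apply, loc_add]
  exact (norm_add_le _ _).trans (add_le_add (h y p) (h' y p))

theorem LocBound.smul (c : ℂ) {T : MatSeq X H} {r : ℝ} (hT : 𝔢.LocBound T r) :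
    𝔢.LocBound (c • T) (‖c‖ * r) := fun L => by
  filter_upwards [hT L] with n h y p
  rw [Pi.smul_apply, loc_smul, norm_smul]
  exact mul_le_mul_of_nonneg_left (h y p) (norm_nonneg c)

theorem LocBound.starSeq {T : MatSeq X H} {r : ℝ} (hT : 𝔢.LocBound T r) :
    𝔢.LocBound (𝔢.starSeq T) r := fun L => by
  filter_upwards [hT L, 𝔢.eventually_le L] with n h hL y p
  rw [loc_starSeq T y hL, norm_star]
  exact h y p

theorem LocBound.mulSeq {T S : MatSeq X H} {R : ℝ}
    (hR : ∀ n (x y : X n), R < dist x y → T n x y = 0) {r s : ℝ} (hT : 𝔢.LocBound T r)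
    (hS : 𝔢.LocBound S s) (hr : 0 ≤ r) : 𝔢.LocBound (𝔢.mulSeq T S) (r * s) := fun L => by
  classical
  filter_upwards [hT (L + max R 0), hS (L + max R 0), 𝔢.eventually_le (L + max R 0)]
    with n h h' hL y p
  have h1 := le_max_left R 0
  have h2 := le_max_right R 0
  rw [loc_mulSeq (hR n) y (L' := L + max R 0) (by linarith) (by linarith) hL]
  refine (CStarMatrix.norm_rowCut_le _ _).trans ((CStarMatrix.norm_colCut_le _ _).trans ?_)
  exact (norm_mul_le _ _).trans (mul_le_mul (h y p) (h' y p) (norm_nonneg _) hr)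

/-- Over B(y, L) the matrix of T* T is the square of a column cut of the matrix of T over a larger
ball, and that column cut still contains the matrix of T over B(y, L). -/
theorem LocBound.of_star_mul {T : MatSeq X H} {R : ℝ}
    (hR : ∀ n (x y : X n), R < dist x y → T n x y = 0) {r : ℝ} (hr : 0 ≤ r)
    (h : 𝔢.LocBound (𝔢.mulSeq (𝔢.starSeq T) T) (r ^ 2)) : 𝔢.LocBound T r := fun L => by
  classical
  filter_upwards [h L, 𝔢.eventually_le (L + max R 0)] with n h hL y p
  have h1 := le_max_left R 0
  have h2 := le_max_right R 0
  have hR' : ∀ x y : X n, R < dist x y → 𝔢.starSeq T n x y = 0 := fun x y hxy => by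
    change transport _ (star (T n y x)) = 0
    rw [hR n y x (by rwa [dist_comm]), star_zero, map_zero]
  have h3 := h y p
  rw [loc_mulSeq hR' y (L' := L + max R 0) (by linarith) (by linarith) hL, loc_starSeq T y hL,
    CStarMatrix.rowCut_colCut_star_mul, CStarRing.norm_star_mul_self, ← sq] at h3
  rw [𝔢.loc_cut (T n) y (show L ≤ L + max R 0 by linarith) p]
  exact (CStarMatrix.norm_rowCut_le _ _).trans (le_of_sq_le_sq h3 hr)

theorem LocBound.of_null [UniformBoundedGeometry X] {T : 𝔢.Pre} (hT : T ∈ 𝔢.Null) {ε : ℝ}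
    (hε : 0 < ε) : 𝔢.LocBound T.1 ε := fun L => by
  obtain ⟨N, hN⟩ := UniformBoundedGeometry.exists_bound (X := X) L
  filter_upwards [hT (ε / (N * N + 1)) (by positivity)] with n h y p
  refine (𝔢.norm_loc_le (T.1 n) y L p (hN n y).2 (C := ε / (N * N + 1)) (by positivity)
    fun x z _ _ => h x z).trans ?_
  rw [← mul_assoc, mul_div_assoc', div_le_iff₀ (by positivity)]
  nlinarith [hε.le, mul_nonneg (Nat.cast_nonneg (α := ℝ) N) (Nat.cast_nonneg (α := ℝ) N)]

/-- Representatives of one class differ by a null sequence, whose matrices over balls of fixed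
radius have a bounded number of entries. The strict inequality leaves room for it. -/
theorem LocBound.congr [UniformBoundedGeometry X] {T S : 𝔢.Pre} (h : 𝔢.cls T = 𝔢.cls S) {r s : ℝ}
    (hT : 𝔢.LocBound T.1 r) (hrs : r < s) : 𝔢.LocBound S.1 s := by
  have h1 := hT.add (LocBound.of_null (cls_eq.1 h.symm) (sub_pos.2 hrs))
  have e : T.1 + (S - T).1 = S.1 := by
    change T.1 + (S.1 - T.1) = S.1
    abel
  rwa [e, add_sub_cancel] at h1

theorem Tame.eventually_loc_le [UniformBoundedGeometry X] {T : 𝔢.Pre} (hT : 𝔢.Tame T.1) :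
    ∃ L₀ : ℝ, ∀ᶠ n in atTop, ∀ (y : X n) (L : ℝ) (p : ℝ≥0 × H), L ≤ 𝔢.l n →
      ∃ x₀ p', ‖𝔢.loc n (T.1 n) y L p‖ ≤ ‖𝔢.loc n (T.1 n) x₀ L₀ p'‖ := by
  obtain ⟨k, -, K, r, -, hT⟩ := hT
  obtain ⟨R, hR⟩ := T.2.2
  obtain ⟨D, -, hD⟩ := 𝔢.exists_radius r
  refine ⟨D + max R 0, ?_⟩
  filter_upwards [hT, 𝔢.eventually_le (D + max R 0)] with n h hl y L p hL
  exact h.exists_norm_loc_le (le_max_right _ _) hD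
    (fun x y hxy => hR n x y ((le_max_left _ _).trans_lt hxy)) hl y hL p

theorem Tame.exists_locBound [UniformBoundedGeometry X] {T : 𝔢.Pre} (hT : 𝔢.Tame T.1) :
    ∃ r, 0 ≤ r ∧ 𝔢.LocBound T.1 r := by
  obtain ⟨L₀, hL⟩ := hT.eventually_loc_le
  obtain ⟨C, hC⟩ := T.2.1
  obtain ⟨N, hN⟩ := UniformBoundedGeometry.exists_bound (X := X) L₀
  refine ⟨N * (N * |C|), by positivity, fun L => ?_⟩
  filter_upwards [hL, 𝔢.eventually_le L] with n h hl y p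
  obtain ⟨x₀, p', h1⟩ := h y L p hl
  exact h1.trans (𝔢.norm_loc_le _ _ _ _ (hN n x₀).2 (abs_nonneg C)
    fun x z _ _ => (hC n x z).trans (le_abs_self C))

/-- `LocBound` fixes L before n. For tame sequences the radius D + R controls all others, so the
same bound holds for all L up to l_n at once; the module E_n needs it at L = l_n/2. -/
theorem Tame.eventually_loc_le_of_locBound [UniformBoundedGeometry X] {T : 𝔢.Pre} (hT : 𝔢.Tame T.1)
    {r : ℝ} (hr : 𝔢.LocBound T.1 r) : ∀ᶠ n in atTop, ∀ (y : X n) (L : ℝ) (p : ℝ≥0 × H),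
      L ≤ 𝔢.l n → ‖𝔢.loc n (T.1 n) y L p‖ ≤ r := by
  obtain ⟨L₀, hL⟩ := hT.eventually_loc_le
  filter_upwards [hL, hr L₀] with n h h' y L p hl
  obtain ⟨x₀, p', h1⟩ := h y L p hl
  exact h1.trans (h' x₀ p')

/-- The bounds of the representatives of a class. -/
def boundSet (c : 𝔢.Ambient) : Set ℝ := {r | 0 ≤ r ∧ ∃ T : 𝔢.Pre, 𝔢.cls T = c ∧ 𝔢.LocBound T.1 r}

theorem bddBelow_boundSet (c : 𝔢.Ambient) : BddBelow (boundSet c) := ⟨0, fun _ h => h.1⟩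

variable [UniformBoundedGeometry X]

theorem nonempty_boundSet (c : 𝔢.twistedAlgebra) : (boundSet (c : 𝔢.Ambient)).Nonempty := by
  obtain ⟨T, hT, h⟩ := mem_twistedAlgebra_iff.1 c.2
  obtain ⟨r, hr, hr'⟩ := hT.exists_locBound
  exact ⟨r, hr, T, h, hr'⟩

/-- The norm of an element of the algebraic twisted Roe algebra: the limit of the norms over balls. -/
def locNorm (c : 𝔢.twistedAlgebra) : ℝ := sInf (boundSet (c : 𝔢.Ambient))

theorem locNorm_nonneg (c : 𝔢.twistedAlgebra) : 0 ≤ locNorm c :=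
  Real.sInf_nonneg fun _ h => h.1

theorem locNorm_le {c : 𝔢.twistedAlgebra} {T : 𝔢.Pre} (hT : 𝔢.cls T = c) {r : ℝ} (hr : 0 ≤ r)
    (h : 𝔢.LocBound T.1 r) : locNorm c ≤ r := csInf_le (bddBelow_boundSet _) ⟨hr, T, hT, h⟩

theorem locBound_of_locNorm_lt {c : 𝔢.twistedAlgebra} {T : 𝔢.Pre} (hT : 𝔢.cls T = c) {r : ℝ}
    (h : locNorm c < r) : 𝔢.LocBound T.1 r := by
  obtain ⟨s, ⟨-, S, hS, hs⟩, hsr⟩ := exists_lt_of_csInf_lt (nonempty_boundSet c) h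
  exact hs.congr (hS.trans hT.symm) hsr

theorem locNorm_add_le (a b : 𝔢.twistedAlgebra) : locNorm (a + b) ≤ locNorm a + locNorm b := by
  obtain ⟨T, hT⟩ := cls_surjective (a : 𝔢.Ambient)
  obtain ⟨S, hS⟩ := cls_surjective (b : 𝔢.Ambient)
  refine le_of_forall_pos_le_add fun ε hε => ?_
  have h1 := locBound_of_locNorm_lt hT (show locNorm a < locNorm a + ε / 2 by linarith)
  have h2 := locBound_of_locNorm_lt hS (show locNorm b < locNorm b + ε / 2 by linarith)
  refine (locNorm_le (T := T + S) (by rw [cls_add, hT, hS]; rfl)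
    (by linarith [locNorm_nonneg a, locNorm_nonneg b]) (h1.add h2)).trans (by linarith)

theorem locNorm_smul_le (c : ℂ) (a : 𝔢.twistedAlgebra) : locNorm (c • a) ≤ ‖c‖ * locNorm a := by
  obtain ⟨T, hT⟩ := cls_surjective (a : 𝔢.Ambient)
  refine le_of_forall_pos_le_add fun ε hε => ?_
  have h1 := locBound_of_locNorm_lt hT
    (show locNorm a < locNorm a + ε / (‖c‖ + 1) by linarith [show 0 < ε / (‖c‖ + 1) by positivity])
  have h0 := locNorm_nonneg a
  refine (locNorm_le (T := c • T) (by rw [cls_smul, hT]; rfl) (by positivity)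
    (h1.smul c)).trans ?_
  rw [mul_add]
  gcongr
  rw [mul_div_assoc', div_le_iff₀ (by positivity)]
  nlinarith [norm_nonneg c]

theorem locNorm_mul_le (a b : 𝔢.twistedAlgebra) : locNorm (a * b) ≤ locNorm a * locNorm b := by
  obtain ⟨T, hT⟩ := cls_surjective (a : 𝔢.Ambient)
  obtain ⟨S, hS⟩ := cls_surjective (b : 𝔢.Ambient)
  obtain ⟨R, hR⟩ := T.2.2
  have h0 := locNorm_nonneg a
  have h0' := locNorm_nonneg b
  have h (ε : ℝ) (hε : 0 < ε) : locNorm (a * b) ≤ (locNorm a + ε) * (locNorm b + ε) :=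
    locNorm_le (T := mulPre T S) (by rw [cls_mul, hT, hS]; rfl) (by positivity)
      ((locBound_of_locNorm_lt hT (by linarith)).mulSeq hR
        (locBound_of_locNorm_lt hS (by linarith)) (by positivity))
  -- The estimate holds with slack ε in both factors, and ε tends to zero from the right.
  have hc : Continuous fun ε : ℝ => (locNorm a + ε) * (locNorm b + ε) := by fun_prop
  have h1 := (hc.tendsto 0).mono_left (nhdsWithin_le_nhds (s := Set.Ioi 0))
  simp only [add_zero] at h1
  exact ge_of_tendsto h1 (eventually_mem_nhdsWithin.mono fun ε hε => h ε hε)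

theorem locNorm_star_le (a : 𝔢.twistedAlgebra) : locNorm (star a) ≤ locNorm a := by
  obtain ⟨T, hT⟩ := cls_surjective (a : 𝔢.Ambient)
  refine le_of_forall_pos_le_add fun ε hε => ?_
  exact locNorm_le (T := starPre T) (by rw [cls_star, hT]; rfl)
    (by linarith [locNorm_nonneg a])
    (locBound_of_locNorm_lt hT (by linarith)).starSeq

theorem locNorm_star_mul_self (a : 𝔢.twistedAlgebra) :
    locNorm (star a * a) = locNorm a * locNorm a := by
  refine le_antisymm ((locNorm_mul_le _ _).trans
    (mul_le_mul_of_nonneg_right (locNorm_star_le a) (locNorm_nonneg a))) ?_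
  obtain ⟨T, hT⟩ := cls_surjective (a : 𝔢.Ambient)
  obtain ⟨R, hR⟩ := T.2.2
  have h0 := locNorm_nonneg (star a * a)
  refine le_of_forall_pos_le_add fun ε hε => ?_
  have h1 := locBound_of_locNorm_lt (T := mulPre (starPre T) T) (c := star a * a)
    (by rw [cls_mul, cls_star, hT]; rfl)
    (show _ < √(locNorm (star a * a) + ε) ^ 2 by rw [Real.sq_sqrt (by positivity)]; linarith)
  have h2 := locNorm_le hT (Real.sqrt_nonneg _) (LocBound.of_star_mul hR (Real.sqrt_nonneg _) h1)
  rw [← sq]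
  exact (pow_le_pow_left₀ (locNorm_nonneg a) h2 2).trans_eq (Real.sq_sqrt (by positivity))

variable (𝔢) in
/-- The norm of the algebraic twisted Roe algebra as a `C⋆`-seminorm. -/
def locSeminorm : CStarSeminorm 𝔢.twistedAlgebra where
  toFun := locNorm
  add_le' := locNorm_add_le
  smul' c a := by
    refine le_antisymm (locNorm_smul_le c a) ?_
    rcases eq_or_ne c 0 with h | h
    · rw [h, norm_zero, zero_mul]; exact locNorm_nonneg _
    · have h1 := locNorm_smul_le c⁻¹ (c • a)
      rw [smul_smul, inv_mul_cancel₀ h, one_smul, norm_inv] at h1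
      have h2 := mul_le_mul_of_nonneg_left h1 (norm_nonneg c)
      rwa [mul_inv_cancel_left₀ (norm_ne_zero_iff.2 h)] at h2
  mul_le' := locNorm_mul_le
  star_mul_self' := locNorm_star_mul_self

end FibredCoarseEmbedding

end norm

end

noncomputable section

set_option linter.unusedSectionVars false

open scoped NNReal BoundedContinuousFunction ZeroAtInfty
open Coeff

/-! ### Columns over a C⋆-algebra -/

namespace CStarMatrix

section columns

variable {ι A : Type*} [Fintype ι] [NonUnitalCStarAlgebra A]

/-- The norm of a column with entries in a `C⋆`-algebra. -/
def colNorm (g : ι → A) : ℝ := √‖∑ i, star (g i) * g i‖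

theorem colNorm_nonneg (g : ι → A) : 0 ≤ colNorm g := Real.sqrt_nonneg _

variable [PartialOrder A] [StarOrderedRing A]

theorem norm_ofCol [DecidableEq ι] (j : ι) (g : ι → A) : ‖ofCol j g‖ = colNorm g := by
  rw [colNorm, ← norm_ofCol_sq j, Real.sqrt_sq (norm_nonneg _)]

theorem colNorm_le_of_sum_le {f g : ι → A} {r : ℝ} (hr : 0 ≤ r)
    (h : ∑ i, star (f i) * f i ≤ r ^ 2 • ∑ i, star (g i) * g i) : colNorm f ≤ r * colNorm g := by
  rw [colNorm, colNorm, ← Real.sqrt_sq hr, ← Real.sqrt_mul (sq_nonneg r)]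
  refine Real.sqrt_le_sqrt ?_
  rw [← Real.norm_of_nonneg (sq_nonneg r), ← norm_smul]
  refine CStarAlgebra.norm_le_norm_of_nonneg_of_le
    (Finset.sum_nonneg fun i _ => star_mul_self_nonneg _) ?_
  exact h

/-- The norm of a `CStarMatrix` is defined through its action on row vectors. Taking adjoints
identifies it with the operator norm on columns. -/
theorem norm_le_of_colNorm_le (M : CStarMatrix ι ι A) {r : ℝ} (hr : 0 ≤ r)
    (h : ∀ g : ι → A, colNorm (fun i => ∑ z, M i z * g z) ≤ r * colNorm g) : ‖M‖ ≤ r := by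
  rw [← norm_star, norm_def]
  refine (toCLM (star M)).opNorm_le_bound hr fun v => ?_
  have h1 (v : WithCStarModule A (ι → A)) : ‖v‖ = colNorm fun i => star (v i) := by
    rw [WithCStarModule.pi_norm, colNorm]
    simp [WithCStarModule.inner_def]
  rw [h1, h1]
  convert h fun i => star (v i) using 3 with i
  rw [toCLM_apply_eq_sum]
  simp [star_apply]

end columns

theorem colNorm_add_le {ι A : Type*} [Fintype ι] [NonUnitalCStarAlgebra A] (f g : ι → A) :
    colNorm (f + g) ≤ colNorm f + colNorm g := by
  classical
  let _ : PartialOrder A := CStarAlgebra.spectralOrder A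
  have : StarOrderedRing A := CStarAlgebra.spectralOrderedRing A
  rcases isEmpty_or_nonempty ι with h | ⟨⟨j⟩⟩
  · simp [colNorm]
  rw [← norm_ofCol j, ← norm_ofCol j, ← norm_ofCol j]
  refine le_trans (le_of_eq (congrArg _ ?_)) (norm_add_le _ _)
  ext i k
  rw [add_apply, ofCol_apply, ofCol_apply, ofCol_apply]
  split_ifs <;> simp

end CStarMatrix

/-! ### Matrices of functions and their values -/

section functions

open CStarMatrix

variable {ι : Type*} [Fintype ι] {H : Type*} [NormedAddCommGroup H] [InnerProductSpace ℝ H]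

/-- The evaluation at a point. -/
def evalHom (p : ℝ≥0 × H) : Fun H →⋆ₙₐ[ℂ] Coeff H where
  toFun F := F p
  map_smul' _ _ := rfl
  map_zero' := rfl
  map_add' _ _ := rfl
  map_mul' _ _ := rfl
  map_star' _ := rfl

/-- The value at a point of a matrix of functions. -/
def evalMatrix (M : ι → ι → Fun H) (p : ℝ≥0 × H) : CStarMatrix ι ι (Coeff H) :=
  CStarMatrix.ofMatrix fun i j => M i j p

theorem colNorm_mul_le (M : ι → ι → Fun H) {r : ℝ} (hM : ∀ p, ‖evalMatrix M p‖ ≤ r) (hr : 0 ≤ r)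
    (g : ι → Fun H) : colNorm (fun i => ∑ z, M i z * g z) ≤ r * colNorm g := by
  rw [colNorm, Real.sqrt_le_left (mul_nonneg hr (colNorm_nonneg _)), mul_pow, colNorm,
    Real.sq_sqrt (norm_nonneg _)]
  refine (BoundedContinuousFunction.norm_le (by positivity)).2 fun p => ?_
  have h1 := sum_star_mul_le (evalMatrix M p) (hM p) fun i => g i p
  have h2 := CStarAlgebra.norm_le_norm_of_nonneg_of_le
    (Finset.sum_nonneg fun i _ => star_mul_self_nonneg _) h1
  rw [norm_smul, Real.norm_of_nonneg (sq_nonneg r)] at h2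
  have e (f : ι → Fun H) : (∑ i, star (f i) * f i) p = ∑ i, star (f i p) * f i p := by
    change evalHom p _ = _
    rw [map_sum]; rfl
  have e' (i : ι) : (∑ z, M i z * g z) p = ∑ z, evalMatrix M p i z * g z p := by
    change evalHom p _ = _
    rw [map_sum]; rfl
  rw [e]
  simp only [e']
  refine h2.trans (mul_le_mul_of_nonneg_left ?_ (sq_nonneg r))
  rw [← e]
  exact BoundedContinuousFunction.norm_coe_le_norm _ p

/-- The bound is assumed only for columns over the closure of Z. This closure is a C⋆-algebra, so
the columns over it compute the norm of M as a matrix over it, and evaluation at p, being a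
`*`-homomorphism, does not increase that norm. -/
theorem norm_evalMatrix_le (Z : NonUnitalStarSubalgebra ℂ (Fun H)) (M : ι → ι → Fun H)
    (hM : ∀ i j, M i j ∈ Z) {r : ℝ} (hr : 0 ≤ r)
    (h : ∀ g : ι → Fun H, (∀ i, g i ∈ closure (Z : Set (Fun H))) →
      colNorm (fun i => ∑ z, M i z * g z) ≤ r * colNorm g) (p : ℝ≥0 × H) :
    ‖evalMatrix M p‖ ≤ r := by
  let A := Z.topologicalClosure
  have : IsClosed (A : Set (Fun H)) := Z.isClosed_topologicalClosure
  let _ : NonUnitalCStarAlgebra A := NonUnitalStarSubalgebra.nonUnitalCStarAlgebra A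
  let _ : PartialOrder A := CStarAlgebra.spectralOrder A
  have : StarOrderedRing A := CStarAlgebra.spectralOrderedRing A
  let M' : CStarMatrix ι ι A :=
    CStarMatrix.ofMatrix fun i j => ⟨M i j, Z.le_topologicalClosure (hM i j)⟩
  have e : evalMatrix M p = M'.map ((evalHom p).comp (NonUnitalStarSubalgebraClass.subtype A)) := rfl
  rw [e]
  refine (CStarMatrix.norm_map_le _ _).trans (norm_le_of_colNorm_le _ hr fun g => ?_)
  have e' (f : ι → A) : colNorm f = colNorm fun i => (f i : Fun H) := by
    have h1 : ((∑ i, star (f i) * f i : A) : Fun H) = ∑ i, star (f i : Fun H) * f i :=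
      map_sum (NonUnitalStarSubalgebraClass.subtype A) _ _
    rw [colNorm, colNorm, ← h1]
    rfl
  have h1 := h (fun i => (g i : Fun H)) fun i => (g i).2
  rw [e', e']
  convert h1 using 3 with i
  exact map_sum (NonUnitalStarSubalgebraClass.subtype A) _ _

/-- The Lipschitz functions of bounded support in the algebra of an affine subspace. -/
def lipschitzSubalgebra (V : AffineSubspace ℝ H) (o : H) : NonUnitalStarSubalgebra ℂ (Fun H) where
  carrier := {G | MemCoeff V G ∧ (∃ K : ℝ≥0, LipschitzWith K G) ∧ ∃ r, SuppIn o r G}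
  add_mem' := by
    rintro F G ⟨h1, ⟨K, hK⟩, r, hr⟩ ⟨h1', ⟨K', hK'⟩, r', hr'⟩
    refine ⟨h1.add h1', ⟨K + K', hK.add hK'⟩, max r r', fun p hp => ?_⟩
    rw [BoundedContinuousFunction.coe_add, Pi.add_apply, hr p ((le_max_left _ _).trans hp),
      hr' p ((le_max_right _ _).trans hp), add_zero]
  zero_mem' := ⟨MemCoeff.zero V, ⟨0, lipschitzWith_of_norm_sub_le fun p q => by simp⟩,
    0, fun _ _ => rfl⟩
  mul_mem' := by
    rintro F G ⟨h1, ⟨K, hK⟩, r, hr⟩ ⟨h1', ⟨K', hK'⟩, r', hr'⟩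
    refine ⟨h1.mul h1', ⟨_, lipschitzWith_fun_mul (C := ‖F‖₊) (C' := ‖G‖₊) hK hK' le_rfl le_rfl⟩,
      r, fun p hp => ?_⟩
    rw [BoundedContinuousFunction.coe_mul, Pi.mul_apply, hr p hp, zero_mul]
  smul_mem' := by
    rintro c F ⟨h1, ⟨K, hK⟩, r, hr⟩
    refine ⟨h1.smul c, ⟨_, lipschitzWith_fun_smul c hK⟩, r, fun p hp => ?_⟩
    change c • F p = 0
    rw [hr p hp, smul_zero]
  star_mem' := by
    rintro F ⟨h1, ⟨K, hK⟩, r, hr⟩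
    refine ⟨h1.star, ⟨K, lipschitzWith_fun_star hK⟩, r, fun p hp => ?_⟩
    rw [BoundedContinuousFunction.star_apply, hr p hp, star_zero]

theorem closure_lipschitzSubalgebra_subset (V : AffineSubspace ℝ H)
    [FiniteDimensional ℝ V.direction] (o : V) :
    closure (lipschitzSubalgebra V (o : H) : Set (Fun H)) ⊆ coeffAlg V := by
  refine closure_minimal ?_ isClosed_closure
  rintro G ⟨h1, ⟨K, hK⟩, r, hr⟩
  exact h1.mem_coeffAlg o hK hr

theorem zero_mem_coeffAlg (V : AffineSubspace ℝ H) : (0 : Fun H) ∈ coeffAlg V :=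
  subset_closure ⟨0, zero_mem _, fun s v u _ => by simp⟩

end functions

/-! ### The reduced norm -/

section reduced

open Filter CStarMatrix

variable {X : ℕ → Type u} [∀ n, MetricSpace (X n)] {H : Type v} [NormedAddCommGroup H]
  [InnerProductSpace ℝ H] {𝔢 : FibredCoarseEmbedding.{u, v, w} X H} [∀ n, Fintype (X n)]

namespace FibredCoarseEmbedding

/-- For each y, f(·)(y) is a column supported in B(y, l_n/2), on which S acts through the matrix in
the trivialisation at y. The resulting inequalities between positive elements are summed over y
before norms are taken. -/
theorem opBound_of_norm_loc_le {n : ℕ} {S : X n → X n → Fun H} {r : ℝ} (hr : 0 ≤ r)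
    (h : ∀ y p, ‖𝔢.loc n S y (𝔢.l n / 2) p‖ ≤ r) : 𝔢.OpBound n S r := by
  intro f hf
  unfold modNorm
  rw [Real.sqrt_le_left (mul_nonneg hr (Real.sqrt_nonneg _)), mul_pow, Real.sq_sqrt (norm_nonneg _)]
  refine (BoundedContinuousFunction.norm_le (by positivity)).2 fun p => ?_
  have e (f : X n → X n → Fun H) : (∑ x, ∑ y, star (f x y) * f x y) p
      = ∑ y, ∑ x, star (f x y p) * f x y p := by
    rw [Finset.sum_comm]
    change evalHom p _ = _
    simp only [map_sum]
    rfl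
  have e' (x y) : 𝔢.act n S f x y p = ∑ z, 𝔢.loc n S y (𝔢.l n / 2) p x z * f z y p := by
    unfold act
    by_cases hx : dist y x ≤ 𝔢.l n / 2
    · rw [if_pos hx]
      change evalHom p _ = _
      rw [map_sum]
      refine Finset.sum_congr rfl fun z _ => ?_
      change transport (𝔢.trans n y x) (S x z) p * f z y p = _
      by_cases hz : dist y z ≤ 𝔢.l n / 2
      · rw [loc_apply, if_pos ⟨by rwa [dist_comm], by rwa [dist_comm]⟩]
      · rw [hf.2 z y (not_le.1 hz)]
        exact (mul_zero _).trans (mul_zero _).symm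
    · rw [if_neg hx]
      symm
      refine Finset.sum_eq_zero fun z _ => ?_
      rw [loc_apply, if_neg (fun h => hx (by rw [dist_comm]; exact h.1)), zero_mul]
  rw [e]
  simp only [e']
  have h1 := CStarAlgebra.norm_le_norm_of_nonneg_of_le
    (Finset.sum_nonneg fun y _ => Finset.sum_nonneg fun x _ => star_mul_self_nonneg _)
    (Finset.sum_le_sum fun y (_ : y ∈ Finset.univ) =>
      sum_star_mul_le (𝔢.loc n S y (𝔢.l n / 2) p) (h y p) fun z => f z y p)
  rw [← Finset.smul_sum, norm_smul, Real.norm_of_nonneg (sq_nonneg r), ← e] at h1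
  exact h1.trans (mul_le_mul_of_nonneg_left (BoundedContinuousFunction.norm_coe_le_norm _ p)
    (sq_nonneg r))

open Classical in
variable (𝔢) in
/-- The matrix `S` over the ball `B(y, L)`, in the trivialisation at `y`. -/
def locFun (n : ℕ) (S : X n → X n → Fun H) (y : X n) (L : ℝ) : X n → X n → Fun H := fun x z =>
  if dist x y ≤ L ∧ dist z y ≤ L then transport (𝔢.trans n y x) (S x z) else 0

open Classical in
theorem locFun_apply (n : ℕ) (S : X n → X n → Fun H) (y : X n) (L : ℝ) (x z : X n) :
    𝔢.locFun n S y L x z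
      = if dist x y ≤ L ∧ dist z y ≤ L then transport (𝔢.trans n y x) (S x z) else 0 := rfl

theorem evalMatrix_locFun (n : ℕ) (S : X n → X n → Fun H) (y : X n) (L : ℝ) (p : ℝ≥0 × H) :
    evalMatrix (𝔢.locFun n S y L) p = 𝔢.loc n S y L p := by
  ext x z
  rw [loc_apply]
  change 𝔢.locFun n S y L x z p = _
  rw [locFun_apply]
  split_ifs <;> rfl

theorem locFun_add (n : ℕ) (S T : X n → X n → Fun H) (y : X n) (L : ℝ) :
    𝔢.locFun n (S + T) y L = 𝔢.locFun n S y L + 𝔢.locFun n T y L := by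
  ext1 x
  ext1 z
  rw [Pi.add_apply, Pi.add_apply, locFun_apply, locFun_apply, locFun_apply]
  split_ifs
  · rw [Pi.add_apply, Pi.add_apply, map_add]
  · rw [add_zero]

variable (𝔢) in
/-- The matrix `S` over the ball `B(y, L)` has norm at most `r` on columns over `A(V_n) ⊗ K`. -/
def ColBound (n : ℕ) (S : X n → X n → Fun H) (y : X n) (L r : ℝ) : Prop :=
  ∀ g : X n → Fun H, (∀ z, g z ∈ coeffAlg (𝔢.V n)) →
    colNorm (fun x => ∑ z, 𝔢.locFun n S y L x z * g z) ≤ r * colNorm g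

theorem ColBound.add {n : ℕ} {S T : X n → X n → Fun H} {y : X n} {L r s : ℝ}
    (hS : 𝔢.ColBound n S y L r) (hT : 𝔢.ColBound n T y L s) : 𝔢.ColBound n (S + T) y L (r + s) := by
  intro g hg
  rw [locFun_add]
  have e : (fun x => ∑ z, (𝔢.locFun n S y L + 𝔢.locFun n T y L) x z * g z)
      = (fun x => ∑ z, 𝔢.locFun n S y L x z * g z) + fun x => ∑ z, 𝔢.locFun n T y L x z * g z := by
    ext1 x
    simp only [Pi.add_apply, add_mul, Finset.sum_add_distrib]
  rw [e, add_mul]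
  exact (colNorm_add_le _ _).trans (add_le_add (hS g hg) (hT g hg))

theorem colBound_of_norm_loc_le {n : ℕ} {S : X n → X n → Fun H} {y : X n} {L r : ℝ} (hr : 0 ≤ r)
    (h : ∀ p, ‖𝔢.loc n S y L p‖ ≤ r) : 𝔢.ColBound n S y L r := fun g _ =>
  colNorm_mul_le _ (fun p => by rw [evalMatrix_locFun]; exact h p) hr g

theorem colNorm_cut_le {ι A : Type*} [Fintype ι] [NonUnitalCStarAlgebra A] (P : ι → Prop)
    [DecidablePred P] (g : ι → A) : colNorm (fun i => if P i then g i else 0) ≤ colNorm g := by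
  let _ : PartialOrder A := CStarAlgebra.spectralOrder A
  have : StarOrderedRing A := CStarAlgebra.spectralOrderedRing A
  refine (colNorm_le_of_sum_le (g := g) zero_le_one ?_).trans_eq (one_mul _)
  rw [one_pow, one_smul]
  refine Finset.sum_le_sum fun i _ => ?_
  split_ifs
  · exact le_rfl
  · rw [mul_zero]; exact star_mul_self_nonneg _

theorem modNorm_single {n : ℕ} (f : X n → X n → Fun H) (y : X n)
    (h : ∀ x y', y' ≠ y → f x y' = 0) : modNorm f = colNorm fun x => f x y := by
  rw [modNorm, colNorm]
  congr 2
  refine Finset.sum_congr rfl fun x _ => Finset.sum_eq_single y (fun y' _ hy => ?_) (by simp)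
  rw [h x y' hy, mul_zero]

/-- Test vectors concentrated at a single y recover the matrix over a ball around y. The ball must
have radius at most l_n/2 for them to belong to E_n. -/
theorem OpBound.colBound {n : ℕ} {S : X n → X n → Fun H} {r : ℝ} (h : 𝔢.OpBound n S r)
    (hr : 0 ≤ r) (y : X n) {L : ℝ} (hL : L ≤ 𝔢.l n / 2) : 𝔢.ColBound n S y L r := by
  classical
  intro g hg
  let f : X n → X n → Fun H := fun z y' => if y' = y then (if dist z y ≤ L then g z else 0) else 0
  have hf : 𝔢.InModule n f := by
    refine ⟨fun x y' => ?_, fun x y' hxy => ?_⟩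
    · simp only [f]
      split_ifs
      exacts [hg x, zero_mem_coeffAlg _, zero_mem_coeffAlg _]
    · simp only [f]
      split_ifs with h1 h2
      · rw [h1, dist_comm] at hxy
        linarith
      · rfl
      · rfl
  have h0 : ∀ x y', y' ≠ y → 𝔢.act n S f x y' = 0 := fun x y' hy => by
    unfold act
    split_ifs
    · exact Finset.sum_eq_zero fun z _ => by simp [f, hy]
    · rfl
  have h1 := h f hf
  rw [modNorm_single _ y h0, modNorm_single f y fun x y' hy => by simp [f, hy]] at h1
  have h2 := colNorm_cut_le (fun x => dist x y ≤ L) fun x => 𝔢.act n S f x y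
  have h3 := colNorm_cut_le (fun x => dist x y ≤ L) g
  have e : (fun x => f x y) = fun x => if dist x y ≤ L then g x else 0 := by
    ext1 x; simp [f]
  have e' : (fun x => ∑ z, 𝔢.locFun n S y L x z * g z)
      = fun x => if dist x y ≤ L then 𝔢.act n S f x y else 0 := by
    ext1 x
    by_cases hx : dist x y ≤ L
    · rw [if_pos hx]
      unfold act
      rw [if_pos (by rw [dist_comm]; linarith)]
      refine Finset.sum_congr rfl fun z _ => ?_
      rw [locFun_apply]
      by_cases hz : dist z y ≤ L <;> simp [f, hx, hz]
    · rw [if_neg hx]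
      refine Finset.sum_eq_zero fun z _ => ?_
      rw [locFun_apply, if_neg fun h => hx h.1, zero_mul]
  rw [e']
  rw [e] at h1
  exact h2.trans (h1.trans (mul_le_mul_of_nonneg_left h3 hr))

theorem ColBound.neg {n : ℕ} {S : X n → X n → Fun H} {y : X n} {L r : ℝ}
    (hS : 𝔢.ColBound n S y L r) : 𝔢.ColBound n (-S) y L r := by
  intro g hg
  convert hS g hg using 1
  have e (x z) : 𝔢.locFun n (-S) y L x z = -𝔢.locFun n S y L x z := by
    rw [locFun_apply, locFun_apply]
    split_ifs
    · rw [Pi.neg_apply, Pi.neg_apply, map_neg]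
    · rw [neg_zero]
  simp only [e, neg_mul, Finset.sum_neg_distrib, colNorm, star_neg, mul_neg, neg_neg]

theorem opBound_zero (n : ℕ) {r : ℝ} (hr : 0 ≤ r) : 𝔢.OpBound n (0 : X n → X n → Fun H) r :=
  opBound_of_norm_loc_le hr fun y p => by
    have : 𝔢.loc n 0 y (𝔢.l n / 2) p = 0 := by
      ext x z
      rw [loc_apply]
      split_ifs
      · rw [Pi.zero_apply, Pi.zero_apply, map_zero]; rfl
      · rfl
    rw [this, norm_zero]; exact hr

variable [UniformBoundedGeometry X]

/-- The entries over the ball belong to the algebra of Lipschitz functions of bounded support in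
A(V_n) ⊗ K, and columns over its closure are among those in the hypothesis. -/
theorem TameAt.norm_loc_le_of_colBound {k r s : ℝ} {K : ℝ≥0} {n : ℕ} {T : X n → X n → Fun H}
    (hT : 𝔢.TameAt k K r n T) (hk : 0 ≤ k) {y : X n} {L : ℝ} (hL : k + L ≤ 𝔢.l n) (hs : 0 ≤ s)
    (h : 𝔢.ColBound n T y L s) (p : ℝ≥0 × H) : ‖𝔢.loc n T y L p‖ ≤ s := by
  have hfin := 𝔢.finiteDimensional_V n
  let o : 𝔢.V n := ⟨𝔢.pt n y y, 𝔢.W_le_V n k y (𝔢.pt_self_mem_W hk y)⟩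
  rw [← evalMatrix_locFun]
  refine norm_evalMatrix_le (lipschitzSubalgebra (𝔢.V n) (o : H)) _ (fun x z => ?_) hs
    (fun g hg => h g fun z => closure_lipschitzSubalgebra_subset _ o (hg z)) p
  rw [locFun_apply]
  split_ifs with hxz
  · have hyx : dist y x ≤ L := by rw [dist_comm]; exact hxz.1
    have hL0 : 0 ≤ L := dist_nonneg.trans hyx
    have := 𝔢.finiteDimensional_W n (k + L) y
    refine ⟨(memCoeff_transport hk hyx hL (hT x z).1).mono
      (⟨_, 𝔢.pt_self_mem_W (by positivity) y⟩ : 𝔢.W n (k + L) y) (𝔢.W_le_V n _ y),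
      ⟨K, lipschitzWith_transport _ (hT x z).2.1⟩, _,
      (suppIn_transport _ (hT x z).2.2).of_norm_sub_le le_rfl⟩
  · exact zero_mem _

/-- The zero ghost suffices. A tame representative satisfies the operator bound for all large n, and
replacing it by 0 at the other n does not change its class. -/
theorem mem_reducedNormSet_of_lt {c : 𝔢.twistedAlgebra} {r : ℝ} (h : locNorm c < r) :
    r ∈ 𝔢.reducedNormSet c := by
  classical
  obtain ⟨T, hT, hc⟩ := mem_twistedAlgebra_iff.1 c.2
  have hr : 0 ≤ r := (locNorm_nonneg c).trans h.le
  have h1 := hT.eventually_loc_le_of_locBound (locBound_of_locNorm_lt hc h)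
  let P : ℕ → Prop := fun n => 𝔢.OpBound n (T.1 n) r
  have hP : ∀ᶠ n in atTop, P n := by
    filter_upwards [h1] with n hn
    exact opBound_of_norm_loc_le hr fun y p => hn y _ p (by linarith [𝔢.l_nonneg' n])
  let T' : 𝔢.Pre := ⟨fun n => if P n then T.1 n else 0, by
    obtain ⟨⟨C, hC⟩, ⟨R, hR⟩⟩ := T.2
    refine ⟨⟨max C 0, fun n x y => ?_⟩, ⟨R, fun n x y hxy => ?_⟩⟩
    · beta_reduce
      split_ifs
      · exact (hC n x y).trans (le_max_left _ _)
      · simp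
    · beta_reduce
      split_ifs
      · exact hR n x y hxy
      · rfl⟩
  refine ⟨hr, T', ?_, 0, ⟨⟨fun n x y => zero_mem_coeffAlg _, fun ε hε => ⟨0, ?_, ?_⟩⟩, ?_⟩, ?_⟩
  · rw [← hc]
    refine cls_eq_of_eventually (hP.mono fun n hn x y => ?_)
    change (if P n then T.1 n else 0) x y = _
    rw [if_pos hn]
  · rw [cls_zero]; exact zero_mem _
  · refine Eventually.of_forall fun n => ?_
    change 𝔢.OpBound n (0 - 0) ε
    rw [sub_zero]; exact opBound_zero n hε.le
  · intro R _ ε hε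
    refine Eventually.of_forall fun n x y => ?_
    have h5 : 𝔢.OpBound n 0 ε := opBound_zero n hε.le
    convert h5 using 1
    ext1 a
    ext1 b
    exact ite_self _
  · intro n
    change 𝔢.OpBound n ((if P n then T.1 n else 0) + 0) r
    rw [add_zero]
    split_ifs with hn
    · exact hn
    · exact opBound_zero n hr

/-- A tame representative T' is (T + S) + (T' - T) - S. Over a ball of fixed radius the last two
terms are eventually small, the second being null and the third a ghost. -/
theorem locNorm_le_of_mem_reducedNormSet {c : 𝔢.twistedAlgebra} {r : ℝ}
    (h : r ∈ 𝔢.reducedNormSet c) : locNorm c ≤ r := by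
  classical
  obtain ⟨hr, T, hT, S, ⟨-, hS⟩, hTS⟩ := h
  obtain ⟨T', hT', hc⟩ := mem_twistedAlgebra_iff.1 c.2
  refine le_of_forall_pos_le_add fun ε hε => ?_
  refine locNorm_le hc (by positivity) fun L => ?_
  obtain ⟨k, hk, K, s, -, hT''⟩ := hT'
  have h1 := LocBound.of_null (cls_eq.1 (hc.trans hT.symm)) (half_pos hε) L
  -- The ghost condition is stated for positive radii, hence the maximum with 1.
  filter_upwards [hT'', h1, hS (max L 1) (by positivity) (ε / 2) (half_pos hε),
    𝔢.eventually_le (k + 2 * max L 1)] with n h2 h3 h4 h5 y p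
  have hL := le_max_left L 1
  have hL' := le_max_right L 1
  refine h2.norm_loc_le_of_colBound hk (by linarith) (by positivity) ?_ p
  have hSc : 𝔢.ColBound n (S n) y L (ε / 2) := by
    intro g hg
    convert (h4 y y).colBound (half_pos hε).le y (L := L) (by linarith) g hg using 2
    ext1 x
    refine Finset.sum_congr rfl fun z _ => ?_
    rw [locFun_apply, locFun_apply]
    split_ifs with h7 h8
    · rfl
    · exact absurd ⟨h7.1.trans hL, h7.2.trans hL⟩ h8
    · rfl
  have h7 := ((hTS n).colBound hr y (L := L) (by linarith)).add
    ((colBound_of_norm_loc_le (half_pos hε).le (h3 y)).add hSc.neg)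
  convert h7 using 1
  · change T'.1 n = (T.1 n + S n) + ((T'.1 n - T.1 n) + -S n)
    abel
  · ring

theorem isGLB_reducedNormSet (c : 𝔢.twistedAlgebra) :
    IsGLB (𝔢.reducedNormSet c) (locSeminorm 𝔢 c) := by
  refine ⟨fun r hr => locNorm_le_of_mem_reducedNormSet hr, fun b hb => ?_⟩
  refine le_of_forall_pos_le_add fun ε hε => hb (mem_reducedNormSet_of_lt ?_)
  change locNorm c < locNorm c + ε
  linarith

end FibredCoarseEmbedding

end reduced

end

noncomputable section

set_option linter.unusedSectionVars false

open scoped NNReal BoundedContinuousFunction ZeroAtInfty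
open Coeff

/-! ### Partial sums of geometric series -/

section geometric

/-- The partial sums of the geometric series `M + M ^ 2 + ⋯`. -/
def geomSum {S : Type*} [NonUnitalNonAssocSemiring S] (M : S) : ℕ → S
  | 0 => 0
  | J + 1 => M + M * geomSum M J

theorem map_geomSum {S S' F : Type*} [NonUnitalNonAssocSemiring S] [NonUnitalNonAssocSemiring S']
    [FunLike F S S'] [NonUnitalRingHomClass F S S'] (f : F) (M : S) (J : ℕ) :
    f (geomSum M J) = geomSum (f M) J := by
  induction J with
  | zero => exact map_zero f
  | succ J ih => rw [geomSum, geomSum, map_add, map_mul, ih]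

variable {S : Type*} [NonUnitalNormedRing S]

theorem norm_geomSum_le {M : S} {q : ℝ} (hq : q < 1) (hM : ‖M‖ ≤ q) (J : ℕ) :
    ‖geomSum M J‖ ≤ q / (1 - q) := by
  have h0 : 0 ≤ q := (norm_nonneg M).trans hM
  have h1 : 0 < 1 - q := sub_pos.2 hq
  induction J with
  | zero => rw [geomSum, norm_zero]; positivity
  | succ J ih =>
    refine (norm_add_le _ _).trans ((add_le_add hM ((norm_mul_le _ _).trans
      (mul_le_mul hM ih (norm_nonneg _) h0))).trans_eq ?_)
    field_simp
    ring

theorem norm_geomSum_succ_sub_le {M : S} {q : ℝ} (hM : ‖M‖ ≤ q) (J : ℕ) :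
    ‖geomSum M (J + 1) - geomSum M J‖ ≤ q ^ (J + 1) := by
  have h0 : 0 ≤ q := (norm_nonneg M).trans hM
  induction J with
  | zero => simpa [geomSum] using hM
  | succ J ih =>
    rw [geomSum, geomSum.eq_def M (J + 1)]
    simp only
    rw [add_sub_add_left_eq_sub, ← mul_sub, pow_succ' q (J + 1)]
    exact (norm_mul_le _ _).trans (mul_le_mul hM ih (norm_nonneg _) h0)

/-- The bound does not depend on J. It gives Lipschitz constants that are uniform in the length of
the partial sum. -/
theorem norm_geomSum_sub_le {M M' : S} {q δ : ℝ} (hq : q < 1) (hM : ‖M‖ ≤ q) (hM' : ‖M'‖ ≤ q)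
    (hδ : ‖M - M'‖ ≤ δ) (J : ℕ) :
    ‖geomSum M J - geomSum M' J‖ ≤ δ * (1 + q / (1 - q)) / (1 - q) := by
  have h0 : 0 ≤ q := (norm_nonneg M).trans hM
  have h1 : 0 < 1 - q := sub_pos.2 hq
  have hδ0 : 0 ≤ δ := (norm_nonneg _).trans hδ
  induction J with
  | zero => rw [geomSum, geomSum, sub_zero, norm_zero]; positivity
  | succ J ih =>
    have e : geomSum M (J + 1) - geomSum M' (J + 1) = (M - M') + (M - M') * geomSum M J
        + M' * (geomSum M J - geomSum M' J) := by
      rw [geomSum, geomSum, sub_mul, mul_sub]; abel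
    rw [e]
    refine (norm_add₃_le.trans (add_le_add (add_le_add hδ ((norm_mul_le _ _).trans
      (mul_le_mul hδ (norm_geomSum_le hq hM J) (norm_nonneg _) hδ0))) ((norm_mul_le _ _).trans
      (mul_le_mul hM' ih (norm_nonneg _) h0)))).trans_eq ?_
    field_simp
    ring

end geometric

namespace CStarMatrix

theorem geomSum_succ_apply {ι A : Type*} [Fintype ι] [NonUnitalRing A] (M : CStarMatrix ι ι A)
    (J : ℕ) (i j : ι) : geomSum M (J + 1) i j = M i j + ∑ k, M i k * geomSum M J k j := by
  rw [geomSum, add_apply, mul_apply]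

theorem geomSum_apply_eq_zero {ι A : Type*} [Fintype ι] [NonUnitalRing A] {M : CStarMatrix ι ι A}
    {i : ι} (h : ∀ j, M i j = 0) (J : ℕ) (j : ι) : geomSum M J i j = 0 := by
  cases J with
  | zero => rfl
  | succ J =>
    rw [geomSum_succ_apply, h, zero_add]
    exact Finset.sum_eq_zero fun k _ => by rw [h, zero_mul]

theorem geomSum_apply_eq_zero' {ι A : Type*} [Fintype ι] [NonUnitalRing A] {M : CStarMatrix ι ι A}
    {j : ι} (h : ∀ i, M i j = 0) (J : ℕ) (i : ι) : geomSum M J i j = 0 := by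
  induction J generalizing i with
  | zero => rfl
  | succ J ih =>
    rw [geomSum_succ_apply, h, zero_add]
    exact Finset.sum_eq_zero fun k _ => by rw [ih, mul_zero]

theorem geomSum_map_apply {ι A B : Type*} [Fintype ι] [NonUnitalRing A] [StarRing A] [Module ℂ A]
    [NonUnitalRing B] [StarRing B] [Module ℂ B] (f : A →⋆ₙₐ[ℂ] B) (M : CStarMatrix ι ι A) (J : ℕ)
    (i j : ι) : f (geomSum M J i j) = geomSum (M.map f) J i j :=
  congrFun (congrFun (map_geomSum (mapₙₐ (n := ι) f) M J) i) j

end CStarMatrix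

/-! ### Quasi-inverses in the algebraic twisted algebra -/

section inverse

open Filter CStarMatrix

variable {X : ℕ → Type u} [∀ n, MetricSpace (X n)] {H : Type v} [NormedAddCommGroup H]
  [InnerProductSpace ℝ H] {𝔢 : FibredCoarseEmbedding.{u, v, w} X H} [∀ n, Fintype (X n)]

namespace FibredCoarseEmbedding

open Classical in
variable (𝔢) in
/-- The rows of `T` over the ball `B(x, D)`, in the trivialisation at `x`. -/
def rowsFun (n : ℕ) (T : X n → X n → Fun H) (D : ℝ) (x : X n) : CStarMatrix (X n) (X n) (Fun H) :=
  CStarMatrix.ofMatrix fun w z => if dist w x ≤ D then transport (𝔢.trans n x w) (T w z) else 0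

open Classical in
theorem rowsFun_apply (n : ℕ) (T : X n → X n → Fun H) (D : ℝ) (x w z : X n) :
    𝔢.rowsFun n T D x w z = if dist w x ≤ D then transport (𝔢.trans n x w) (T w z) else 0 := rfl

theorem rowsFun_self (n : ℕ) (T : X n → X n → Fun H) {D : ℝ} (hD : 0 ≤ D) (x z : X n) :
    𝔢.rowsFun n T D x x z = T x z := by
  rw [rowsFun_apply, if_pos (by rwa [dist_self]), trans_self, transport_refl]

open Classical in
theorem rowsFun_map_evalHom {n : ℕ} {T : X n → X n → Fun H} {D R : ℝ} (hR0 : 0 ≤ R)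
    (hR : ∀ x y : X n, R < dist x y → T x y = 0) (x : X n) (p : ℝ≥0 × H) :
    (𝔢.rowsFun n T D x).map (evalHom p)
      = CStarMatrix.rowCut (fun w => dist w x ≤ D) (𝔢.loc n T x (D + R) p) := by
  ext w z
  rw [CStarMatrix.rowCut_apply, CStarMatrix.map_apply, rowsFun_apply, loc_apply]
  by_cases hw : dist w x ≤ D
  · rw [if_pos hw, if_pos hw]
    by_cases hz : dist z x ≤ D + R
    · rw [if_pos ⟨by linarith, hz⟩]; rfl
    · rw [if_neg fun h => hz h.2, hR w z, map_zero, map_zero]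
      have := dist_triangle z w x
      rw [dist_comm z w] at this
      linarith
  · rw [if_neg hw, if_neg hw, map_zero]

/-- The local series fit together. If row z vanishes at p, both sides are zero. Otherwise rows x and
z are both nonzero at p, so every row that is nonzero at p is within D of x and of z, and the two
local matrices have the same values at p. -/
theorem geomSum_transport_apply {k r D R : ℝ} {K : ℝ≥0} {n : ℕ} {T : X n → X n → Fun H}
    (hT : 𝔢.TameAt k K r n T) (hD0 : 0 ≤ D) (hR0 : 0 ≤ R)
    (hD : ∀ t, 0 ≤ t → 𝔢.ρm t < 2 * r → t ≤ D) (hR : ∀ x y : X n, R < dist x y → T x y = 0)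
    (hl : D + R ≤ 𝔢.l n) {x z : X n} {p : ℝ≥0 × H} (h : T x z p ≠ 0) (J : ℕ) (y : X n) :
    transport (𝔢.trans n x z) (geomSum (𝔢.rowsFun n T D z) J z y) p
      = geomSum (𝔢.rowsFun n T D x) J z y p := by
  have h0 (x : X n) : dist x x ≤ 𝔢.l n := by rw [dist_self]; exact 𝔢.l_nonneg' n
  have hxz : dist z x ≤ R := by
    by_contra h'
    exact h (by rw [hR x z (by rw [dist_comm]; exact not_le.1 h')]; rfl)
  have hxp : ‖p.2 - 𝔢.pt n x x‖ < r := hT.dist_lt (h0 x) (z := z) (by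
    rwa [trans_self, transport_refl])
  let f : Fun H →⋆ₙₐ[ℂ] Coeff H := (evalHom p).comp (transport (𝔢.trans n x z))
  change f (geomSum (𝔢.rowsFun n T D z) J z y) = evalHom p (geomSum (𝔢.rowsFun n T D x) J z y)
  rw [geomSum_map_apply, geomSum_map_apply]
  have hf {w : X n} (hw : dist w z ≤ D) (u : X n) :
      (𝔢.rowsFun n T D z).map f w u = transport (𝔢.trans n x w) (T w u) p := by
    rw [CStarMatrix.map_apply, rowsFun_apply, if_pos hw]
    change transport (𝔢.trans n x z) (transport (𝔢.trans n z w) (T w u)) p = _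
    rw [transport_trans_trans (q := w) (by linarith [dist_triangle w z x]) (by linarith) (h0 w)]
  have hf' {w : X n} (hw : dist w x ≤ D) (u : X n) :
      (𝔢.rowsFun n T D x).map (evalHom p) w u = transport (𝔢.trans n x w) (T w u) p := by
    rw [CStarMatrix.map_apply, rowsFun_apply, if_pos hw]; rfl
  have hzz : dist z z ≤ D := by rwa [dist_self]
  by_cases hz : ∀ u, transport (𝔢.trans n x z) (T z u) p = 0
  · rw [geomSum_apply_eq_zero fun u => by rw [hf hzz, hz u],
      geomSum_apply_eq_zero fun u => ?_]
    by_cases hzx : dist z x ≤ D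
    · rw [hf' hzx, hz u]
    · rw [CStarMatrix.map_apply, rowsFun_apply, if_neg hzx, map_zero]
  · push Not at hz
    obtain ⟨u₀, hu₀⟩ := hz
    have hzp : ‖p.2 - 𝔢.pt n x z‖ < r := hT.dist_lt (by linarith) hu₀
    suffices e : (𝔢.rowsFun n T D z).map f = (𝔢.rowsFun n T D x).map (evalHom p) by rw [e]
    ext w u
    by_cases hw : dist w z ≤ D
    · rw [hf hw]
      by_cases hwx : dist w x ≤ D
      · rw [hf' hwx]
      · rw [CStarMatrix.map_apply, rowsFun_apply, if_neg hwx, map_zero]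
        by_contra hne
        have hwl : dist w x ≤ 𝔢.l n := by linarith [dist_triangle w z x]
        exact hwx (dist_le_of_norm_sub_pt_lt hD hwl (h0 x) (hT.dist_lt hwl hne) hxp)
    · rw [CStarMatrix.map_apply, rowsFun_apply, if_neg hw, map_zero]
      symm
      by_cases hwx : dist w x ≤ D
      · rw [hf' hwx]
        by_contra hne
        exact hw (dist_le_of_norm_sub_pt_lt hD (by linarith) (by linarith)
          (hT.dist_lt (by linarith) hne) hzp)
      · rw [CStarMatrix.map_apply, rowsFun_apply, if_neg hwx, map_zero]

variable [UniformBoundedGeometry X]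

theorem memCoeff_geomSum {n : ℕ} {V : AffineSubspace ℝ H} {M : CStarMatrix (X n) (X n) (Fun H)}
    (h : ∀ i j, MemCoeff V (M i j)) (J : ℕ) (i j : X n) : MemCoeff V (geomSum M J i j) := by
  induction J generalizing i with
  | zero => exact MemCoeff.zero V
  | succ J ih =>
    rw [geomSum_succ_apply]
    exact (h i j).add (MemCoeff.sum _ _ fun z _ => (h i z).mul (ih z))

theorem norm_rowsFun_map_le {n : ℕ} {T : X n → X n → Fun H} {D R q : ℝ} (hR0 : 0 ≤ R)
    (hR : ∀ x y : X n, R < dist x y → T x y = 0) (x : X n) (p : ℝ≥0 × H)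
    (h : ‖𝔢.loc n T x (D + R) p‖ ≤ q) : ‖(𝔢.rowsFun n T D x).map (evalHom p)‖ ≤ q := by
  classical
  rw [rowsFun_map_evalHom hR0 hR]
  exact (norm_rowCut_le _ _).trans h

theorem norm_rowsFun_map_sub_le {k r D R : ℝ} {K : ℝ≥0} {n N : ℕ} {T : X n → X n → Fun H}
    (hT : 𝔢.TameAt k K r n T) (hR0 : 0 ≤ R) (hR : ∀ x y : X n, R < dist x y → T x y = 0)
    (x : X n) (hN : {y | dist y x ≤ D + R}.ncard ≤ N) (p p' : ℝ≥0 × H) :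
    ‖(𝔢.rowsFun n T D x).map (evalHom p) - (𝔢.rowsFun n T D x).map (evalHom p')‖
      ≤ N * (N * (K * dist p p')) := by
  classical
  refine norm_le_of_support _ (Finset.univ.filter fun y => dist y x ≤ D + R) ?_ (by positivity)
    (fun w z hwz => ?_) fun w z => ?_
  · rw [← Set.ncard_coe_finset]
    simpa using hN
  · rw [CStarMatrix.sub_apply, rowsFun_map_evalHom hR0 hR, rowsFun_map_evalHom hR0 hR,
      rowCut_apply, rowCut_apply, loc_apply, loc_apply] at hwz
    by_contra h'
    have h'' : ¬(dist w x ≤ D + R ∧ dist z x ≤ D + R) := fun h => h' (by simpa using h)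
    exact hwz (by rw [if_neg h'', if_neg h'', ite_self, sub_zero])
  · rw [CStarMatrix.sub_apply, CStarMatrix.map_apply, CStarMatrix.map_apply, rowsFun_apply]
    split_ifs
    · exact norm_coe_sub_le (lipschitzWith_transport _ (hT w z).2.1) p p'
    · rw [map_zero, map_zero, sub_zero, norm_zero]; positivity

variable (𝔢) in
/-- The local inverses: row `x` of the geometric series of `T` in the trivialisation at `x`. -/
def geomRows (n : ℕ) (T : X n → X n → Fun H) (D : ℝ) : X n → X n → Fun H := fun x y =>
  geomSum (𝔢.rowsFun n T D x) n x y

theorem geomRows_apply_eq (n : ℕ) (T : X n → X n → Fun H) (D : ℝ) (x y : X n) (p : ℝ≥0 × H) :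
    𝔢.geomRows n T D x y p = geomSum ((𝔢.rowsFun n T D x).map (evalHom p)) n x y :=
  geomSum_map_apply (evalHom p) _ n x y

theorem norm_geomRows_le {n : ℕ} {T : X n → X n → Fun H} {D R q : ℝ} (hR0 : 0 ≤ R)
    (hR : ∀ x y : X n, R < dist x y → T x y = 0) (hq0 : 0 ≤ q) (hq : q < 1)
    (h : ∀ x p, ‖𝔢.loc n T x (D + R) p‖ ≤ q) (x y : X n) :
    ‖𝔢.geomRows n T D x y‖ ≤ q / (1 - q) := by
  have h1 : 0 < 1 - q := sub_pos.2 hq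
  refine (BoundedContinuousFunction.norm_le (by positivity)).2 fun p => ?_
  rw [geomRows_apply_eq]
  exact norm_entry_le_norm.trans (norm_geomSum_le hq (norm_rowsFun_map_le hR0 hR x p (h x p)) n)

theorem geomRows_eq_zero {n : ℕ} {T : X n → X n → Fun H} {D R : ℝ}
    (hR : ∀ x y : X n, R < dist x y → T x y = 0) {x y : X n} (hxy : D + R < dist x y) :
    𝔢.geomRows n T D x y = 0 := by
  refine geomSum_apply_eq_zero' (fun w => ?_) n x
  rw [rowsFun_apply]
  split_ifs with h
  · rw [hR w y, map_zero]
    linarith [dist_triangle x w y, dist_comm x w]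
  · rfl

/-- Every term of row x begins with an entry of row x of T, which fixes the support. All factors
come from rows over B(x, D), which gives the locality radius k + D. None of the constants depends on
the number of terms. -/
theorem tameAt_geomRows {k r D R q : ℝ} {K : ℝ≥0} {n N : ℕ} {T : X n → X n → Fun H}
    (hT : 𝔢.TameAt k K r n T) (hk : 0 ≤ k) (hD0 : 0 ≤ D) (hR0 : 0 ≤ R)
    (hR : ∀ x y : X n, R < dist x y → T x y = 0) (hl : k + D ≤ 𝔢.l n) (hq0 : 0 ≤ q) (hq : q < 1)
    (h : ∀ x p, ‖𝔢.loc n T x (D + R) p‖ ≤ q)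
    (hN : ∀ x : X n, {y | dist y x ≤ D + R}.ncard ≤ N) :
    𝔢.TameAt (k + D) (N * (N * K) * (1 + q / (1 - q)) / (1 - q)).toNNReal r n
      (𝔢.geomRows n T D) := by
  have h1 : 0 < 1 - q := sub_pos.2 hq
  intro x y
  refine ⟨memCoeff_geomSum (fun w z => ?_) n x y, ?_, fun p hp => ?_⟩
  · rw [rowsFun_apply]
    split_ifs with hw
    · exact memCoeff_transport hk (by rwa [dist_comm]) hl (hT w z).1
    · exact MemCoeff.zero _
  · refine lipschitzWith_of_norm_sub_le fun p p' => ?_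
    rw [geomRows_apply_eq, geomRows_apply_eq, ← CStarMatrix.sub_apply]
    refine norm_entry_le_norm.trans ((norm_geomSum_sub_le hq
      (norm_rowsFun_map_le hR0 hR x p (h x p)) (norm_rowsFun_map_le hR0 hR x p' (h x p'))
      (norm_rowsFun_map_sub_le hT hR0 hR x (hN x) p p') n).trans_eq ?_)
    rw [Real.coe_toNNReal _ (by positivity)]
    field_simp
  · rw [geomRows_apply_eq]
    refine geomSum_apply_eq_zero (fun z => ?_) n y
    rw [CStarMatrix.map_apply, rowsFun_self n T hD0]
    exact (hT x z).2.2 p hp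

/-- Because the local series fit together, T + T S - S is at each point a difference of consecutive
partial sums. The partial sum used at n has n terms, so the error q ^ (n + 1) tends to zero with n.
-/
theorem norm_geomRows_sub_le {k r D R q : ℝ} {K : ℝ≥0} {n : ℕ} {T : MatSeq X H}
    (hT : 𝔢.TameAt k K r n (T n)) (hD0 : 0 ≤ D) (hR0 : 0 ≤ R)
    (hD : ∀ t, 0 ≤ t → 𝔢.ρm t < 2 * r → t ≤ D)
    (hR : ∀ x y : X n, R < dist x y → T n x y = 0) (hl : D + R ≤ 𝔢.l n) (hq0 : 0 ≤ q)
    (h : ∀ x p, ‖𝔢.loc n (T n) x (D + R) p‖ ≤ q) {S : MatSeq X H}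
    (hS : S n = 𝔢.geomRows n (T n) D) (x y : X n) :
    ‖T n x y + 𝔢.mulSeq T S n x y - S n x y‖ ≤ q ^ (n + 1) := by
  refine (BoundedContinuousFunction.norm_le (by positivity)).2 fun p => ?_
  have e : (T n x y + 𝔢.mulSeq T S n x y - S n x y) p
      = (geomSum ((𝔢.rowsFun n (T n) D x).map (evalHom p)) (n + 1)
        - geomSum ((𝔢.rowsFun n (T n) D x).map (evalHom p)) n) x y := by
    rw [CStarMatrix.sub_apply, ← geomRows_apply_eq, hS, geomSum_succ_apply, CStarMatrix.map_apply,
      rowsFun_self n (T n) hD0]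
    change evalHom p (T n x y + ∑ z, T n x z * transport (𝔢.trans n x z) (S n z y)
      - 𝔢.geomRows n (T n) D x y) = _
    rw [map_sub, map_add, map_sum]
    refine congrArg₂ (· - ·) (congrArg₂ (· + ·) rfl (Finset.sum_congr rfl fun z _ => ?_)) rfl
    rw [map_mul, CStarMatrix.map_apply, rowsFun_self n (T n) hD0]
    change T n x z p * _ = T n x z p * _
    by_cases hz : T n x z p = 0
    · rw [hz, zero_mul, zero_mul]
    · rw [hS, ← geomSum_map_apply]
      congr 1
      exact geomSum_transport_apply hT hD0 hR0 hD hR hl hz n y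
  rw [e]
  exact norm_entry_le_norm.trans
    (norm_geomSum_succ_sub_le (norm_rowsFun_map_le hR0 hR x p (h x p)) n)

/-- Elements of norm less than one are quasi-invertible. -/
theorem exists_eq_add_mul {a : 𝔢.twistedAlgebra} (ha : locNorm a < 1) :
    ∃ b : 𝔢.twistedAlgebra, b = a + a * b := by
  classical
  obtain ⟨T, hT, hc⟩ := mem_twistedAlgebra_iff.1 a.2
  obtain ⟨q, hq1, hq⟩ := exists_between ha
  have hq0 : 0 ≤ q := (locNorm_nonneg a).trans hq1.le
  have hloc := hT.eventually_loc_le_of_locBound (locBound_of_locNorm_lt hc hq1)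
  obtain ⟨k, hk, K, r, hr, hT⟩ := hT
  obtain ⟨R', hR'⟩ := T.2.2
  let R := max R' 0
  have hR0 : 0 ≤ R := le_max_right _ _
  have hR (n) (x y : X n) (hxy : R < dist x y) : T.1 n x y = 0 :=
    hR' n x y ((le_max_left _ _).trans_lt hxy)
  obtain ⟨D, hD0, hD⟩ := 𝔢.exists_radius r
  obtain ⟨N, hN⟩ := UniformBoundedGeometry.exists_bound (X := X) (D + R)
  -- All conditions that hold only for large n. Elsewhere S is set to zero, since bounds and
  -- propagation are required at every n.
  let P : ℕ → Prop := fun n => 𝔢.TameAt k K r n (T.1 n) ∧ k + D + R ≤ 𝔢.l n ∧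
    ∀ x p, ‖𝔢.loc n (T.1 n) x (D + R) p‖ ≤ q
  have hP : ∀ᶠ n in atTop, P n := by
    filter_upwards [hT, 𝔢.eventually_le (k + D + R), hloc] with n h1 h2 h3
    exact ⟨h1, h2, fun x p => h3 x _ p (by linarith)⟩
  let S : 𝔢.Pre := ⟨fun n => if P n then 𝔢.geomRows n (T.1 n) D else 0, by
    have h1 : 0 < 1 - q := sub_pos.2 hq
    refine ⟨⟨q / (1 - q), fun n x y => ?_⟩, ⟨D + R, fun n x y hxy => ?_⟩⟩
    · beta_reduce
      split_ifs with hn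
      · exact norm_geomRows_le hR0 (hR n) hq0 hq hn.2.2 x y
      · rw [Pi.zero_apply, Pi.zero_apply, norm_zero]; positivity
    · beta_reduce
      split_ifs
      · exact geomRows_eq_zero (hR n) hxy
      · rfl⟩
  have hS {n} (hn : P n) : S.1 n = 𝔢.geomRows n (T.1 n) D := if_pos hn
  have hSt : 𝔢.Tame S.1 := by
    refine ⟨k + D, by positivity,
      (N * (N * K) * (1 + q / (1 - q)) / (1 - q)).toNNReal, r, hr, hP.mono fun n hn => ?_⟩
    rw [hS hn]
    exact tameAt_geomRows hn.1 hk hD0 hR0 (hR n) (by linarith [hn.2.1]) hq0 hq hn.2.2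
      fun x => (hN n x).2
  refine ⟨⟨𝔢.cls S, mem_twistedAlgebra_iff.2 ⟨S, hSt, rfl⟩⟩, Subtype.ext ?_⟩
  change 𝔢.cls S = a.1 + a.1 * 𝔢.cls S
  rw [← hc, ← cls_mul, ← cls_add]
  symm
  rw [cls_eq]
  intro ε hε
  have h1 := (tendsto_pow_atTop_nhds_zero_of_lt_one hq0 hq).comp (tendsto_add_atTop_nat 1)
  filter_upwards [hP, h1.eventually_le_const hε] with n hn hε x y
  exact (norm_geomRows_sub_le (T := T.1) (S := S.1) hn.1 hD0 hR0 hD (hR n)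
    (by linarith [hn.2.1]) hq0 hn.2.2 (hS hn) x y).trans hε

end FibredCoarseEmbedding

end inverse

end

noncomputable section

set_option linter.unusedSectionVars false

open scoped NNReal BoundedContinuousFunction ZeroAtInfty
open Coeff

/-- In a `C⋆`-algebra, `1 - y* y` is not right invertible if `y* y` has norm one. -/
theorem CStarAlgebra.norm_ne_one_of_mul_eq_one {E : Type*} [CStarAlgebra E] [Nontrivial E] {y b : E}
    (h : (1 - star y * y) * b = 1) : ‖star y * y‖ ≠ 1 := by
  let _ : PartialOrder E := CStarAlgebra.spectralOrder E
  have : StarOrderedRing E := CStarAlgebra.spectralOrderedRing E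
  intro h1
  have h2 := CStarAlgebra.norm_mem_spectrum_of_nonneg (star_mul_self_nonneg y)
  rw [h1, spectrum.mem_iff, map_one] at h2
  have h3 : star b * (1 - star y * y) = 1 := by
    have := congrArg star h
    rwa [star_mul, star_sub, star_mul, star_star, star_one] at this
  -- The adjoint of the right inverse b is a left inverse, so 1 would lie outside the spectrum of y*
  -- y.
  exact h2 (isUnit_iff_exists.2 ⟨b, h, by rwa [← left_inv_eq_right_inv h3 h]⟩)

/-! ### The maximal norm -/

section maximal

variable {X : ℕ → Type u} [∀ n, MetricSpace (X n)] {H : Type v} [NormedAddCommGroup H]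
  [InnerProductSpace ℝ H] {𝔢 : FibredCoarseEmbedding.{u, v, w} X H} [∀ n, Fintype (X n)]
  [UniformBoundedGeometry X]

namespace FibredCoarseEmbedding

/-- If φ increased the norm of c, a multiple d of c would have `locNorm d < 1` and ‖φ(d)‖ = 1. Then
d* d is quasi-invertible inside the algebraic algebra, so 1 - φ(d* d) has a right inverse, although
φ(d* d) is positive of norm 1. -/
theorem norm_apply_le_locNorm {K : Type*} [NormedAddCommGroup K] [InnerProductSpace ℂ K]
    [CompleteSpace K] (φ : 𝔢.twistedAlgebra →⋆ₙₐ[ℂ] (K →L[ℂ] K)) (c : 𝔢.twistedAlgebra) :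
    ‖φ c‖ ≤ locNorm c := by
  by_contra! h
  have h0 : 0 < ‖φ c‖ := (locNorm_nonneg c).trans_lt h
  have : Nontrivial (K →L[ℂ] K) := ⟨φ c, 0, norm_pos_iff.1 h0⟩
  let d : 𝔢.twistedAlgebra := ((‖φ c‖⁻¹ : ℝ) : ℂ) • c
  have hd : locNorm d < 1 := by
    refine (locNorm_smul_le _ c).trans_lt ?_
    rw [Complex.norm_real, norm_inv, norm_norm, inv_mul_lt_iff₀ h0, mul_one]
    exact h
  have hd' : locNorm (star d * d) < 1 := by
    rw [locNorm_star_mul_self]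
    exact mul_lt_one_of_nonneg_of_lt_one_left (locNorm_nonneg d) hd hd.le
  have hφ : ‖φ d‖ = 1 := by
    rw [map_smul, norm_smul, Complex.norm_real, norm_inv, norm_norm, inv_mul_cancel₀ h0.ne']
  obtain ⟨b, hb⟩ := exists_eq_add_mul hd'
  have h1 : φ b = star (φ d) * φ d + star (φ d) * φ d * φ b := by
    rw [← map_star, ← map_mul, ← map_mul, ← map_add, ← hb]
  refine CStarAlgebra.norm_ne_one_of_mul_eq_one (y := φ d) (b := 1 + φ b) ?_ ?_
  · rw [sub_mul, one_mul, mul_add, mul_one, ← h1]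
    abel
  · rw [CStarRing.norm_star_mul_self, hφ, one_mul]

/-- The supremum is attained: the completion for `locNorm` is a C⋆-algebra, and a GNS representation
that preserves the norm of the image of c restricts to the algebraic algebra. -/
theorem isLUB_maxNormSet (c : 𝔢.twistedAlgebra) : IsLUB (𝔢.maxNormSet c) (locSeminorm 𝔢 c) := by
  refine ⟨?_, fun b hb => ?_⟩
  · rintro _ ⟨K, _, _, _, φ, rfl⟩
    exact norm_apply_le_locNorm φ c
  · obtain ⟨K, i1, i2, i3, φ, hφ⟩ := NonUnitalCStarAlgebra.exists_representation_norm_eq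
      (locSeminorm 𝔢).Completed (CStarSeminorm.Completed.of (locSeminorm 𝔢) c)
    refine hb ⟨K, i1, i2, i3, φ.comp
      { toFun := CStarSeminorm.Completed.of (locSeminorm 𝔢)
        map_smul' := CStarSeminorm.Completed.of_smul
        map_zero' := CStarSeminorm.Completed.of_zero
        map_add' := CStarSeminorm.Completed.of_add
        map_mul' := CStarSeminorm.Completed.of_mul
        map_star' := CStarSeminorm.Completed.of_star }, ?_⟩
    rw [← CStarSeminorm.Completed.norm_of, ← hφ]
    rfl

theorem canonicalQuotient_self (p : CStarSeminorm 𝔢.twistedAlgebra) (h : ∀ c, p c ≤ p c)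
    (x : p.Completed) : canonicalQuotient p p h x = x := by
  induction x using CStarSeminorm.Completed.ind with
  | hc => exact isClosed_eq (CStarSeminorm.continuous_complMap _ _) continuous_id
  | h a => exact CStarSeminorm.complMap_of _ _ a

end FibredCoarseEmbedding

end maximal

end

theorem mainTheorem8 {X : ℕ → Type u} [∀ n, MetricSpace (X n)] [∀ n, Fintype (X n)]
    [UniformBoundedGeometry X] {H : Type v} [NormedAddCommGroup H] [InnerProductSpace ℝ H]
    [CompleteSpace H] (𝔢 : FibredCoarseEmbedding.{u, v, w} X H) :
    ∃ pmax pred : CStarSeminorm 𝔢.twistedAlgebra,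
      (∀ c, IsLUB (𝔢.maxNormSet c) (pmax c)) ∧ (∀ c, IsGLB (𝔢.reducedNormSet c) (pred c)) ∧
      ∃ hle : ∀ c, pred c ≤ pmax c,
        Function.Bijective (FibredCoarseEmbedding.canonicalQuotient pmax pred hle) := by
  -- The same seminorm serves as maximal and as reduced norm, so the canonical map agrees with the
  -- identity on a dense subset, hence everywhere.
  let p := FibredCoarseEmbedding.locSeminorm 𝔢
  refine ⟨p, p, FibredCoarseEmbedding.isLUB_maxNormSet, FibredCoarseEmbedding.isGLB_reducedNormSet,
    fun _ => le_rfl, ?_⟩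
  have h : ⇑(FibredCoarseEmbedding.canonicalQuotient p p fun _ => le_rfl) = id :=
    funext (FibredCoarseEmbedding.canonicalQuotient_self p _)
  rw [h]
  exact Function.bijective_id
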